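/- **Notation.** Let $\mathbb D=\{z\in\mathbb C:|z|<1\}$. A Schwarz function is an analytic $w:\mathbb D\to\mathbb D$ with $w(0)=0$; for functions $F,G$ on $\mathbb D$ (analytic or harmonic), $F\prec G$ means $F=G\circ w$ for some Schwarz function $w$. Let $\psi$ be analytic and univalent on $\mathbb D$ with $\operatorname{Re}\psi>0$, $\psi(0)=1$, $\psi'(0)>0$ and $\psi(\mathbb D)$ symmetric about the real axis. The Ma–Minda class $\mathcal S^*(\psi)$ consists of the analytic functions $f(z)=z+\sum_{m\ge2}a_mz^m$ on $\mathbb D$ with $zf'(z)/f(z)\prec\psi(z)$. Let $f_0(z)=z+\cdots$ be the analytic function on $\mathbb D$ with $zf_0'(z)/f_0(z)=\psi(z)$, that is, $f_0(z)=z\exp\int_0^1\frac{\psi(tz)-1}{t}\,dt$; if $f_0(z)=\sum_{m\ge1}\alpha_mz^m$, put $\hat f_0(r)=\sum_{m\ge1}|\alpha_m|r^m$ for $0\le r<1$ and $f_0(-1)=\lim_{t\to1^-}f_0(-t)$. For $K\ge1$ put $k=(K-1)/(K+1)$. A harmonic map $h=f+\overline g$ on $\mathbb D$ ($f,g$ analytic,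 $g(0)=0$) is sense-preserving $K$-quasiconformal if it is a homeomorphism onto its image, $|f'|^2-|g'|^2>0$ and $|g'/f'|\le k$ on $\mathbb D$. **Theorem.** Let $\psi$ be as above and $K\ge1$. The function $f_0$ is well defined, the series $\hat f_0(r)$ converges for $0\le r<1$, the limit $f_0(-1)$ exists and is real, and the equation $$\frac{2K}{K+1}\,\hat f_0(r)=-f_0(-1)$$ has exactly one root $r_0$ in $(0,1)$. Put $r^*=\min\{r_0,\tfrac13\}$. 1. Let $h=f+\overline g$ be a sense-preserving $K$-quasiconformal harmonic map of $\mathbb D$ with $f\in\mathcal S^*(\psi)$, and let $h_1=f_1+\overline{g_1}\prec h$, where $f_1(z)=\sum_{m\ge0}c_mz^m$ and $g_1(z)=\sum_{m\ge1}d_mz^m$ are analytic on $\mathbb D$. Then, with $d(f(0),\partial f(\mathbb D))$ the Euclidean distance from $f(0)$ to the boundary of $f(\mathbb D)$, for $0\le r\le r^*$ the series below converges and $$\sum_{m=1}^\infty(|c_m|+|d_m|)\,r^m\le d(f(0),\partial f(\mathbb D)).$$ 2. (Sharpness.) Suppose that $\hat f_0=f_0$ (that is, all Taylor coefficients of $f_0$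 are real and non-negative) and $r^*=r_0$. Then $f_0\in\mathcal S^*(\psi)$, the map $p=f_0+k\overline{f_0}$ is sense-preserving $K$-quasiconformal, and for $h=h_1=p$ equality holds in the inequality of part 1 at $r=r_0$, while the series converges and the inequality fails for every $r\in(r_0,1)$. -/

import Mathlib

noncomputable section

namespace HarmonicBohr

/-- The open unit disk of the complex plane. -/
def unitDisk : Set ℂ := Metric.ball (0 : ℂ) 1

/-- Schwarz functions: analytic self-maps of the unit disk that fix the origin. -/
structure IsSchwarz (w : ℂ → ℂ) : Prop where
  analytic : DifferentiableOn ℂ w unitDisk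
  map_zero : w 0 = 0
  mapsTo : Set.MapsTo w unitDisk unitDisk

/-- Subordination `F ≺ G` on the unit disk, for analytic or harmonic functions alike. -/
def Subordinate (F G : ℂ → ℂ) : Prop :=
  ∃ w : ℂ → ℂ, IsSchwarz w ∧ ∀ z ∈ unitDisk, F z = G (w z)

/-- The class `𝒜`: analytic functions on the disk of the form `z + a₂ z² + a₃ z³ + ⋯`. -/
structure IsNormalized (f : ℂ → ℂ) : Prop where
  analytic : DifferentiableOn ℂ f unitDisk
  map_zero : f 0 = 0
  deriv_zero : deriv f 0 = 1

/-- The functions `ψ` used to define the Ma–Minda classes: analytic and univalent on the disk, with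
positive real part, `ψ 0 = 1`, `ψ' 0 > 0`, and image symmetric about the real axis. -/
structure IsMaMinda (ψ : ℂ → ℂ) : Prop where
  analytic : DifferentiableOn ℂ ψ unitDisk
  univalent : Set.InjOn ψ unitDisk
  re_pos : ∀ z ∈ unitDisk, 0 < (ψ z).re
  map_zero : ψ 0 = 1
  deriv_im : (deriv ψ 0).im = 0
  deriv_re_pos : 0 < (deriv ψ 0).re
  symmetric : ∀ v ∈ ψ '' unitDisk, starRingEnd ℂ v ∈ ψ '' unitDisk

/-- The function `z f'(z) / f(z)`, with its removable singularity at `0` (for `f ∈ 𝒜`) filled in by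
the value `1`. -/
def starlikeQuotient (f : ℂ → ℂ) (z : ℂ) : ℂ :=
  if z = 0 then 1 else z * deriv f z / f z

/-- The Ma–Minda starlike class `𝒮*(ψ)`: `f ∈ 𝒜` with `z f' / f ≺ ψ`. -/
structure IsMaMindaStarlike (ψ f : ℂ → ℂ) : Prop where
  normalized : IsNormalized f
  ne_zero : ∀ z ∈ unitDisk, z ≠ 0 → f z ≠ 0
  subordinate : Subordinate (starlikeQuotient f) ψ

/-- The complex-valued harmonic function `f + \bar g`. -/
def harmonicMap (f g : ℂ → ℂ) (z : ℂ) : ℂ := f z + starRingEnd ℂ (g z)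

/-- `h = f + \bar g`, with `f`, `g` analytic on the disk and `g 0 = 0`, is a sense-preserving
`K`-quasiconformal harmonic mapping: a homeomorphism of the disk onto its image with Jacobian
`|f'|² - |g'|² > 0`, whose dilatation satisfies `|g' / f'| ≤ (K - 1) / (K + 1)`. -/
structure IsQuasiconformalHarmonic (K : ℝ) (f g : ℂ → ℂ) : Prop where
  analytic_left : DifferentiableOn ℂ f unitDisk
  analytic_right : DifferentiableOn ℂ g unitDisk
  right_zero : g 0 = 0
  homeomorphism : Topology.IsEmbedding (unitDisk.domRestrict (harmonicMap f g))
  sense_preserving : ∀ z ∈ unitDisk, 0 < ‖deriv f z‖ ^ 2 - ‖deriv g z‖ ^ 2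
  dilatation : ∀ z ∈ unitDisk, ‖deriv g z / deriv f z‖ ≤ (K - 1) / (K + 1)

/-- The `m`-th Taylor coefficient of `f` at the origin. -/
def taylorCoeff (f : ℂ → ℂ) (m : ℕ) : ℂ := iteratedDeriv m f 0 / (m.factorial : ℂ)

/-- The extremal function `f₀` of `𝒮*(ψ)`: the solution
`f₀(z) = z exp (∫₀¹ (ψ(tz) - 1) / t dt)` of `z f₀' / f₀ = ψ`. -/
def extremal (ψ : ℂ → ℂ) (z : ℂ) : ℂ :=
  z * Complex.exp (∫ t in (0 : ℝ)..1, (ψ ((t : ℂ) * z) - 1) / (t : ℂ))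

/-- The co-analytic part `k f₀`, `k = (K - 1) / (K + 1)`, of the map `f₀ + k \bar f₀`. -/
def extremalCo (K : ℝ) (ψ : ℂ → ℂ) (z : ℂ) : ℂ :=
  (((K - 1) / (K + 1) : ℝ) : ℂ) * extremal ψ z

/-- `f̂(r) = ∑ |aₘ| rᵐ`, where the `aₘ` are the Taylor coefficients of `f`. -/
def majorant (f : ℂ → ℂ) (r : ℝ) : ℝ := ∑' m : ℕ, ‖taylorCoeff f m‖ * r ^ m

/-- The term of index `m ≥ 1` in the Bohr sum of `f + \bar g`. -/
def bohrTerm (f g : ℂ → ℂ) (r : ℝ) (m : ℕ) : ℝ :=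
  (‖taylorCoeff f m‖ + ‖taylorCoeff g m‖) * r ^ m

/-- `∑_{m ≥ 1} (|cₘ| + |dₘ|) rᵐ`, where `cₘ`, `dₘ` are the Taylor coefficients of `f`, `g`. -/
def bohrSum (f g : ℂ → ℂ) (r : ℝ) : ℝ := ∑' m : ℕ, bohrTerm f g r (m + 1)

/-- `d(f(0), ∂f(𝔻))`. -/
def boundaryDist (f : ℂ → ℂ) : ℝ := Metric.infDist (f 0) (frontier (f '' unitDisk))

end HarmonicBohr

end

open HarmonicBohr

namespace HarmonicBohr

/-! ### Taylor coefficients and majorant series on the unit disk -/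

/-! Write F̂ for the majorant of F, B = ψ'(0), Q(z) = ∫₀¹ (ψ(tz) - 1)/t dt, so that f₀ = z e^Q, and
ℓ = -f₀(-1).

Harmonic part. By uniqueness of the decomposition, f₁ = f ∘ ω and g₁ = g ∘ ω for a Schwarz function
ω. Bohr's inequality gives ω̂(r) ≤ r for r ≤ 1/3, so composition with ω does not increase majorants.
With g' = κ f' and |κ| ≤ k, Bohr's inequality for κ gives ĝ ≤ k f̂ there. Hence the Bohr sum is at
most (1 + k) f̂(r) = 2K/(K+1) f̂(r) (`bohrSum_le_of_subordinate`).

Analytic part. Each f in the class is z e^P with P = ∫₀¹ (ψ(w(tz)) - 1)/t dt for a Schwarz function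
w. The coefficients of ψ may have mixed signs, and f̂ ≤ f̂₀ is not what gets proved. Instead f̂ may
exceed f̂₀ by a factor that the distance to the boundary also gains. With a = |w'(0)|: (i) d(0,
∂f(𝔻)) ≥ ℓ e^{B(1-a)/6} (`mul_exp_le_boundaryDist`); (ii) f̂(r) ≤ f̂₀(r) e^{B(1-a)/6} for 0 < r ≤
1/3 (`majorant_mul_exp_le`). Since 2K/(K+1) f̂₀(r) ≤ ℓ for r ≤ r₀, the two combine.

For (i), ψ - 1 is typically real, and Robertson's representation bounds ψ(y) - ψ(x) from below on
the diameter. A minimum-point argument turns this into a growth theorem with a surplus depending on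
1 - a (`re_logPrimitive_comp_ge`). For (ii), P(z) = Q(cz) + Δ(z) with c = w'(0). Dilating by c
shrinks the majorant of e^Q, while Δ̂ is O(1 - a) with explicit constants, from the coefficient
bounds |bₙ| ≤ nB and |bₙ| ≤ 2 for ψ.

Sharpness: f₀ is the case w = id, a = 1, where -ℓ really is a boundary point and f̂₀ is strictly
increasing. -/

theorem _root_.HasSum.congr_fun' {ι α : Type*} [AddCommMonoid α] [TopologicalSpace α]
    {f g : ι → α} {a : α} (h : HasSum f a) (hfg : ∀ i, g i = f i) : HasSum g a := by
  rwa [funext hfg]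

theorem isOpen_unitDisk : IsOpen unitDisk := Metric.isOpen_ball

theorem mem_unitDisk {z : ℂ} : z ∈ unitDisk ↔ ‖z‖ < 1 := mem_ball_zero_iff

theorem zero_mem_unitDisk : (0 : ℂ) ∈ unitDisk := by simp [mem_unitDisk]

theorem isPreconnected_unitDisk : IsPreconnected unitDisk :=
  (convex_ball (0 : ℂ) 1).isPreconnected

theorem unitDisk_mem_nhds {z : ℂ} (hz : z ∈ unitDisk) : unitDisk ∈ nhds z :=
  isOpen_unitDisk.mem_nhds hz

theorem hasSum_taylorCoeff {f : ℂ → ℂ} (hf : DifferentiableOn ℂ f unitDisk) {z : ℂ}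
    (hz : z ∈ unitDisk) : HasSum (fun m : ℕ => taylorCoeff f m * z ^ m) (f z) := by
  refine (Complex.hasSum_taylorSeries_on_ball hf hz).congr_fun' fun m => ?_
  simp only [taylorCoeff, sub_zero, smul_eq_mul]
  ring

/-- Uniqueness of power series on a disk of any radius: the tool by which all coefficient identities
below are read off from sums. -/
theorem taylorCoeff_eq_of_hasSum {f : ℂ → ℂ} {c : ℕ → ℂ} {ρ : ℝ} (hρ : 0 < ρ)
    (h : ∀ z : ℂ, ‖z‖ < ρ → HasSum (fun m : ℕ => c m * z ^ m) (f z)) (m : ℕ) :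
    taylorCoeff f m = c m := by
  have hp : HasFPowerSeriesOnBall f (FormalMultilinearSeries.ofScalars ℂ c) 0
      (ENNReal.ofReal ρ) := by
    refine ⟨?_, by simpa using hρ, ?_⟩
    · refine ENNReal.le_of_forall_nnreal_lt fun s hs => ?_
      have hs' : (s : ℝ) < ρ := by
        have := (ENNReal.lt_ofReal_iff_toReal_lt ENNReal.coe_ne_top).1 hs
        simpa using this
      refine FormalMultilinearSeries.le_radius_of_tendsto _ (l := 0) ?_
      have h1 := (h (s : ℂ) (by simpa using hs')).summable.tendsto_atTop_zero.norm
      simp only [norm_zero] at h1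
      refine h1.congr fun n => ?_
      simp
    · intro y hy
      have hy' : ‖y‖ < ρ := by
        rw [Metric.eball_ofReal] at hy
        simpa using hy
      rw [zero_add]
      refine (h y hy').congr_fun' fun n => ?_
      simp [mul_comm]
  have h1 := hp.factorial_smul (1 : ℂ) m
  have h2 : iteratedDeriv m f 0 = (m.factorial : ℂ) * c m := by
    rw [iteratedDeriv_eq_iteratedFDeriv, ← h1]
    simp
  rw [taylorCoeff, h2]
  field_simp [Nat.factorial_ne_zero]

theorem taylorCoeff_congr {f g : ℂ → ℂ} (h : Set.EqOn f g unitDisk) (m : ℕ) :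
    taylorCoeff f m = taylorCoeff g m := by
  have : f =ᶠ[nhds 0] g := Filter.eventuallyEq_of_mem (unitDisk_mem_nhds zero_mem_unitDisk) h
  rw [taylorCoeff, taylorCoeff, this.iteratedDeriv_eq]

theorem majorant_congr {f g : ℂ → ℂ} (h : Set.EqOn f g unitDisk) (r : ℝ) :
    majorant f r = majorant g r := by
  simp only [majorant, taylorCoeff_congr h]

@[simp] theorem taylorCoeff_zero (f : ℂ → ℂ) : taylorCoeff f 0 = f 0 := by
  simp [taylorCoeff]

@[simp] theorem taylorCoeff_one (f : ℂ → ℂ) : taylorCoeff f 1 = deriv f 0 := by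
  simp [taylorCoeff]

theorem summable_majorant {f : ℂ → ℂ} (hf : DifferentiableOn ℂ f unitDisk) {r : ℝ}
    (hr0 : 0 ≤ r) (hr : r < 1) : Summable fun m : ℕ => ‖taylorCoeff f m‖ * r ^ m := by
  have h := (hasSum_taylorCoeff hf (z := (r : ℂ))
    (by simpa [mem_unitDisk, abs_of_nonneg hr0] using hr)).summable.norm
  simpa [abs_of_nonneg hr0] using h

theorem majorant_nonneg (f : ℂ → ℂ) {r : ℝ} (hr0 : 0 ≤ r) : 0 ≤ majorant f r :=
  tsum_nonneg fun _ => by positivity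

theorem norm_le_majorant {f : ℂ → ℂ} (hf : DifferentiableOn ℂ f unitDisk) {r : ℝ} (hr : r < 1)
    {z : ℂ} (hz : ‖z‖ ≤ r) : ‖f z‖ ≤ majorant f r := by
  have hr0 : 0 ≤ r := (norm_nonneg z).trans hz
  rw [← (hasSum_taylorCoeff hf (mem_unitDisk.2 (hz.trans_lt hr))).tsum_eq]
  refine tsum_of_norm_bounded (summable_majorant hf hr0 hr).hasSum fun m => ?_
  rw [norm_mul, norm_pow]
  gcongr

/-- Countable subadditivity of the majorant. -/
theorem majorant_le_tsum {f : ℂ → ℂ} {F : ℕ → ℂ → ℂ} {r : ℝ}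
    (hF : ∀ n, DifferentiableOn ℂ (F n) unitDisk) (hr0 : 0 < r) (hr : r < 1)
    (hs : Summable fun n => majorant (F n) r)
    (hsum : ∀ z : ℂ, ‖z‖ < r → HasSum (fun n => F n z) (f z)) :
    majorant f r ≤ ∑' n, majorant (F n) r := by
  obtain ⟨A, hA⟩ : ∃ A : ℕ → ℕ → ℂ, ∀ n m, taylorCoeff (F n) m = A n m := ⟨_, fun _ _ => rfl⟩
  have hFs : ∀ n, Summable fun m : ℕ => ‖A n m‖ * r ^ m := fun n => by
    simpa only [hA] using summable_majorant (hF n) hr0.le hr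
  have hFz : ∀ n, ∀ z : ℂ, ‖z‖ < r → HasSum (fun m : ℕ => A n m * z ^ m) (F n z) := fun n z hz => by
    simpa only [hA] using hasSum_taylorCoeff (hF n) (mem_unitDisk.2 (hz.trans hr))
  have hmaj : ∀ n, majorant (F n) r = ∑' m, ‖A n m‖ * r ^ m := fun n => by
    simp only [majorant, hA]
  simp only [hmaj] at hs ⊢
  clear hA hmaj hF
  have hdouble : Summable fun p : ℕ × ℕ => ‖A p.1 p.2‖ * r ^ p.2 :=
    (summable_prod_of_nonneg fun p => by positivity).2 ⟨hFs, hs⟩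
  have hdouble' : Summable fun p : ℕ × ℕ => ‖A p.2 p.1‖ * r ^ p.1 := hdouble.prod_symm
  have hcol : ∀ m, Summable fun n => ‖A n m‖ := fun m => by
    have := (hdouble'.prod_factor m).mul_right ((r ^ m)⁻¹)
    refine this.congr fun n => ?_
    field_simp
  have hcoef : ∀ m, taylorCoeff f m = ∑' n, A n m := by
    -- The double series converges absolutely for |z| < r, so summing it by columns gives a power
    -- series for `f`, whose coefficients are unique.
    refine taylorCoeff_eq_of_hasSum (c := fun m => ∑' n, A n m) hr0 fun z hz => ?_
    have hsz : Summable fun p : ℕ × ℕ => A p.1 p.2 * z ^ p.2 := by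
      refine Summable.of_norm_bounded hdouble fun p => ?_
      rw [norm_mul, norm_pow]
      gcongr
    have h1 := hsz.hasSum.prod_fiberwise fun n => hFz n z hz
    have h2 : (∑' p : ℕ × ℕ, A p.1 p.2 * z ^ p.2) = f z := h1.unique (hsum z hz)
    rw [← h2]
    have h3 : HasSum (fun p : ℕ × ℕ => A p.2 p.1 * z ^ p.1)
        (∑' p : ℕ × ℕ, A p.1 p.2 * z ^ p.2) :=
      (Equiv.prodComm ℕ ℕ).hasSum_iff.2 hsz.hasSum
    exact h3.prod_fiberwise fun m => ((hcol m).of_norm.hasSum).mul_right (z ^ m)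
  have hle : ∀ m, ‖taylorCoeff f m‖ * r ^ m ≤ ∑' n, ‖A n m‖ * r ^ m := fun m => by
    rw [hcoef, tsum_mul_right]
    gcongr
    exact norm_tsum_le_tsum_norm (hcol m)
  have hs2 : Summable fun m => ∑' n, ‖A n m‖ * r ^ m := hdouble'.prod
  calc majorant f r ≤ ∑' m, ∑' n, ‖A n m‖ * r ^ m :=
        (Summable.of_nonneg_of_le (fun _ => by positivity) hle hs2).tsum_le_tsum hle hs2
    _ = ∑' n, ∑' m, ‖A n m‖ * r ^ m :=
        Summable.tsum_comm (f := fun n m => ‖A n m‖ * r ^ m) hdouble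

theorem taylorCoeff_mul {f g : ℂ → ℂ} (hf : DifferentiableOn ℂ f unitDisk)
    (hg : DifferentiableOn ℂ g unitDisk) (m : ℕ) :
    taylorCoeff (fun z => f z * g z) m =
      ∑ p ∈ Finset.HasAntidiagonal.antidiagonal m, taylorCoeff f p.1 * taylorCoeff g p.2 := by
  refine taylorCoeff_eq_of_hasSum (c := fun m => ∑ p ∈ Finset.HasAntidiagonal.antidiagonal m,
    taylorCoeff f p.1 * taylorCoeff g p.2) one_pos (fun z hz => ?_) m
  have hz := mem_unitDisk.2 hz
  have h1 := hasSum_taylorCoeff hf hz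
  have h2 := hasSum_taylorCoeff hg hz
  have h3 := (summable_norm_sum_mul_antidiagonal_of_summable_norm h1.summable.norm
    h2.summable.norm).of_norm.hasSum
  rw [← tsum_mul_tsum_eq_tsum_sum_antidiagonal_of_summable_norm h1.summable.norm
    h2.summable.norm, h1.tsum_eq, h2.tsum_eq] at h3
  refine h3.congr_fun' fun n => ?_
  rw [Finset.sum_mul]
  refine Finset.sum_congr rfl fun p hp => ?_
  rw [← Finset.HasAntidiagonal.mem_antidiagonal.1 hp, pow_add]
  ring

theorem majorant_mul_le {f g : ℂ → ℂ} (hf : DifferentiableOn ℂ f unitDisk)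
    (hg : DifferentiableOn ℂ g unitDisk) {r : ℝ} (hr0 : 0 ≤ r) (hr : r < 1) :
    majorant (fun z => f z * g z) r ≤ majorant f r * majorant g r := by
  have h1 := summable_majorant hf hr0 hr
  have h2 := summable_majorant hg hr0 hr
  have h1' := h1.norm
  have h2' := h2.norm
  rw [majorant, majorant, majorant, tsum_mul_tsum_eq_tsum_sum_antidiagonal_of_summable_norm h1' h2']
  refine (summable_majorant (hf.mul hg) hr0 hr).tsum_le_tsum (fun m => ?_)
    (summable_norm_sum_mul_antidiagonal_of_summable_norm h1' h2').of_norm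
  rw [taylorCoeff_mul hf hg]
  calc _ ≤ (∑ p ∈ Finset.HasAntidiagonal.antidiagonal m, ‖taylorCoeff f p.1 * taylorCoeff g p.2‖) * r ^ m := by
        gcongr
        exact norm_sum_le _ _
    _ = _ := by
        rw [Finset.sum_mul]
        refine Finset.sum_congr rfl fun p hp => ?_
        rw [← Finset.HasAntidiagonal.mem_antidiagonal.1 hp, pow_add, norm_mul]
        ring

theorem taylorCoeff_const (c : ℂ) (m : ℕ) :
    taylorCoeff (fun _ => c) m = if m = 0 then c else 0 := by
  refine taylorCoeff_eq_of_hasSum (c := fun m => if m = 0 then c else 0) one_pos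
    (fun z _ => ?_) m
  refine (hasSum_ite_eq 0 c).congr_fun' fun n => ?_
  split_ifs with h <;> simp [h]

theorem majorant_const (c : ℂ) (r : ℝ) : majorant (fun _ => c) r = ‖c‖ := by
  rw [majorant, tsum_eq_single 0]
  · simp
  · intro m hm
    simp [taylorCoeff_const, hm]

theorem majorant_pow_le {f : ℂ → ℂ} (hf : DifferentiableOn ℂ f unitDisk) {r : ℝ} (hr0 : 0 ≤ r)
    (hr : r < 1) (n : ℕ) : majorant (fun z => f z ^ n) r ≤ majorant f r ^ n := by
  induction n with
  | zero => simp [majorant_const]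
  | succ n ih =>
    simp only [pow_succ]
    refine (majorant_mul_le (hf.fun_pow n) hf hr0 hr).trans ?_
    gcongr
    exact majorant_nonneg f hr0

theorem taylorCoeff_const_mul {f : ℂ → ℂ} (hf : DifferentiableOn ℂ f unitDisk) (c : ℂ) (m : ℕ) :
    taylorCoeff (fun z => c * f z) m = c * taylorCoeff f m := by
  refine taylorCoeff_eq_of_hasSum (c := fun m => c * taylorCoeff f m) one_pos (fun z hz => ?_) m
  simpa only [mul_assoc] using (hasSum_taylorCoeff hf (mem_unitDisk.2 hz)).mul_left c

theorem majorant_const_mul {f : ℂ → ℂ} (hf : DifferentiableOn ℂ f unitDisk) (c : ℂ) (r : ℝ) :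
    majorant (fun z => c * f z) r = ‖c‖ * majorant f r := by
  simp only [majorant, taylorCoeff_const_mul hf, norm_mul, mul_assoc, tsum_mul_left]

theorem taylorCoeff_add {f g : ℂ → ℂ} (hf : DifferentiableOn ℂ f unitDisk)
    (hg : DifferentiableOn ℂ g unitDisk) (m : ℕ) :
    taylorCoeff (fun z => f z + g z) m = taylorCoeff f m + taylorCoeff g m := by
  refine taylorCoeff_eq_of_hasSum (c := fun m => taylorCoeff f m + taylorCoeff g m) one_pos (fun z hz => ?_) m
  simpa only [add_mul] using
    (hasSum_taylorCoeff hf (mem_unitDisk.2 hz)).add (hasSum_taylorCoeff hg (mem_unitDisk.2 hz))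

theorem taylorCoeff_sub {f g : ℂ → ℂ} (hf : DifferentiableOn ℂ f unitDisk)
    (hg : DifferentiableOn ℂ g unitDisk) (m : ℕ) :
    taylorCoeff (fun z => f z - g z) m = taylorCoeff f m - taylorCoeff g m := by
  refine taylorCoeff_eq_of_hasSum (c := fun m => taylorCoeff f m - taylorCoeff g m) one_pos (fun z hz => ?_) m
  simpa only [sub_mul] using
    (hasSum_taylorCoeff hf (mem_unitDisk.2 hz)).sub (hasSum_taylorCoeff hg (mem_unitDisk.2 hz))

theorem majorant_add_le {f g : ℂ → ℂ} (hf : DifferentiableOn ℂ f unitDisk)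
    (hg : DifferentiableOn ℂ g unitDisk) {r : ℝ} (hr0 : 0 ≤ r) (hr : r < 1) :
    majorant (fun z => f z + g z) r ≤ majorant f r + majorant g r := by
  have h1 := summable_majorant hf hr0 hr
  have h2 := summable_majorant hg hr0 hr
  rw [majorant, majorant, majorant, ← h1.tsum_add h2]
  refine (summable_majorant (hf.add hg) hr0 hr).tsum_le_tsum (fun m => ?_) (h1.add h2)
  rw [taylorCoeff_add hf hg, ← add_mul]
  gcongr
  exact norm_add_le _ _

theorem taylorCoeff_comp_const_mul {f : ℂ → ℂ} (hf : DifferentiableOn ℂ f unitDisk) {c : ℂ}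
    (hc : ‖c‖ ≤ 1) (m : ℕ) : taylorCoeff (fun z => f (c * z)) m = taylorCoeff f m * c ^ m := by
  refine taylorCoeff_eq_of_hasSum (c := fun m => taylorCoeff f m * c ^ m) one_pos (fun z hz => ?_) m
  have hcz : c * z ∈ unitDisk := by
    rw [mem_unitDisk, norm_mul]
    nlinarith [norm_nonneg z, norm_nonneg c]
  simpa only [mul_pow, mul_assoc] using hasSum_taylorCoeff hf hcz

theorem taylorCoeff_deriv {f : ℂ → ℂ} (m : ℕ) :
    taylorCoeff (deriv f) m = (m + 1) * taylorCoeff f (m + 1) := by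
  rw [taylorCoeff, taylorCoeff, iteratedDeriv_succ', Nat.factorial_succ]
  push_cast
  field_simp

theorem taylorCoeff_id_mul_succ {f : ℂ → ℂ} (hf : DifferentiableOn ℂ f unitDisk) (m : ℕ) :
    taylorCoeff (fun z => z * f z) (m + 1) = taylorCoeff f m := by
  have : ∀ n, taylorCoeff (fun z => z * f z) n =
      (fun n : ℕ => Nat.casesOn n 0 (fun k => taylorCoeff f k) : ℕ → ℂ) n := by
    refine taylorCoeff_eq_of_hasSum one_pos (fun z hz => ?_)
    rw [← hasSum_nat_add_iff' 1]
    simp only [Finset.range_one, Finset.sum_singleton]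
    rw [show (Nat.rec 0 (fun n _ => taylorCoeff f n) 0 : ℂ) = 0 from rfl, zero_mul, sub_zero]
    refine ((hasSum_taylorCoeff hf (mem_unitDisk.2 hz)).mul_left z).congr_fun' fun n => ?_
    rw [pow_succ]; ring
  rw [this]

theorem majorant_id_mul {f : ℂ → ℂ} (hf : DifferentiableOn ℂ f unitDisk) {r : ℝ} (hr0 : 0 ≤ r)
    (hr : r < 1) : majorant (fun z => z * f z) r = r * majorant f r := by
  have h : Summable fun m => ‖taylorCoeff (fun z => z * f z) m‖ * r ^ m :=
    summable_majorant (differentiableOn_id.mul hf) hr0 hr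
  rw [majorant, h.tsum_eq_zero_add, majorant, ← tsum_mul_left]
  simp only [taylorCoeff_id_mul_succ hf]
  simp only [taylorCoeff_zero, zero_mul, norm_zero, zero_add, pow_succ]
  exact tsum_congr fun m => by ring

theorem majorant_mono (f : ℂ → ℂ) (hf : DifferentiableOn ℂ f unitDisk) {r s : ℝ} (hr0 : 0 ≤ r)
    (hrs : r ≤ s) (hs : s < 1) : majorant f r ≤ majorant f s :=
  (summable_majorant hf hr0 (hrs.trans_lt hs)).tsum_le_tsum (fun m => by gcongr)
    (summable_majorant hf (hr0.trans hrs) hs)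

theorem majorant_strictMonoOn {f : ℂ → ℂ} (hf : DifferentiableOn ℂ f unitDisk)
    (h1 : deriv f 0 ≠ 0) : StrictMonoOn (majorant f) (Set.Ico 0 1) := by
  intro r hr s hs hrs
  refine (summable_majorant hf hr.1 hr.2).tsum_lt_tsum (i := 1) (fun m => ?_) ?_
    (summable_majorant hf hs.1 hs.2)
  · have := hr.1
    gcongr
  · have : 0 < ‖deriv f 0‖ := norm_pos_iff.2 h1
    simp only [taylorCoeff_one, pow_one]
    gcongr

theorem continuousOn_majorant {f : ℂ → ℂ} (hf : DifferentiableOn ℂ f unitDisk) {R : ℝ}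
    (hR : R < 1) : ContinuousOn (majorant f) (Set.Icc 0 R) := by
  rcases lt_or_ge R 0 with h | h
  · simp [Set.Icc_eq_empty (not_le.2 h)]
  refine continuousOn_tsum (fun m => by fun_prop) (summable_majorant hf h hR) fun m r hr => ?_
  have := hr.1
  rw [Real.norm_of_nonneg (by positivity)]
  gcongr
  exact hr.2

/-- Expand f ∘ w = ∑ aₙ wⁿ and use that the majorant is countably subadditive and submultiplicative.
-/
theorem majorant_comp_le {f w : ℂ → ℂ} (hf : DifferentiableOn ℂ f unitDisk)
    (hw : DifferentiableOn ℂ w unitDisk) {r : ℝ} (hr0 : 0 < r)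
    (hr : r < 1) (h : majorant w r < 1) :
    majorant (fun z => f (w z)) r ≤ majorant f (majorant w r) := by
  have hle : ∀ n, majorant (fun z => taylorCoeff f n * w z ^ n) r ≤
      ‖taylorCoeff f n‖ * majorant w r ^ n := fun n => by
    rw [majorant_const_mul (hw.fun_pow n)]
    gcongr
    exact majorant_pow_le hw hr0.le hr n
  have hs := summable_majorant hf (majorant_nonneg w hr0.le) h
  have hs' : Summable fun n => majorant (fun z => taylorCoeff f n * w z ^ n) r :=
    Summable.of_nonneg_of_le (fun n => majorant_nonneg _ hr0.le) hle hs
  refine (majorant_le_tsum (F := fun n z => taylorCoeff f n * w z ^ n)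
    (fun n => (hw.fun_pow n).const_mul _) hr0 hr hs' fun z hz => ?_).trans (hs'.tsum_le_tsum hle hs)
  exact hasSum_taylorCoeff hf
    (mem_unitDisk.2 ((norm_le_majorant hw hr hz.le).trans_lt h))

theorem majorant_exp_le {g : ℂ → ℂ} (hg : DifferentiableOn ℂ g unitDisk) {r : ℝ} (hr0 : 0 < r)
    (hr : r < 1) : majorant (fun z => Complex.exp (g z)) r ≤ Real.exp (majorant g r) := by
  have hle : ∀ n, majorant (fun z => ((n.factorial : ℂ)⁻¹) * g z ^ n) r ≤
      ((n.factorial : ℝ)⁻¹) * majorant g r ^ n := fun n => by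
    rw [majorant_const_mul (hg.fun_pow n)]
    simp only [norm_inv, Complex.norm_natCast]
    gcongr
    exact majorant_pow_le hg hr0.le hr n
  have hs : HasSum (fun n : ℕ => ((n.factorial : ℝ)⁻¹) * majorant g r ^ n)
      (Real.exp (majorant g r)) := by
    simpa [Real.exp_eq_exp_ℝ] using NormedSpace.exp_series_hasSum_exp' (𝕂 := ℝ) (majorant g r)
  have hs' : Summable fun n : ℕ => majorant (fun z => ((n.factorial : ℂ)⁻¹) * g z ^ n) r :=
    Summable.of_nonneg_of_le (fun n => majorant_nonneg _ hr0.le) hle hs.summable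
  refine (majorant_le_tsum (F := fun n z => ((n.factorial : ℂ)⁻¹) * g z ^ n)
    (fun n => (hg.fun_pow n).const_mul _) hr0 hr hs' fun z hz => ?_).trans
    ((hs'.tsum_le_tsum hle hs.summable).trans_eq hs.tsum_eq)
  simpa [Complex.exp_eq_exp_ℂ] using NormedSpace.exp_series_hasSum_exp' (𝕂 := ℂ) (g z)


/-! ### Circle averages, positive real parts and typically real functions -/

theorem sphere_subset_unitDisk {R : ℝ} (hR : R < 1) : Metric.sphere (0 : ℂ) R ⊆ unitDisk :=
  fun z hz => mem_unitDisk.2 (by rw [mem_sphere_zero_iff_norm.1 hz]; exact hR)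

theorem diffContOnCl_of_unitDisk {f : ℂ → ℂ} (hf : DifferentiableOn ℂ f unitDisk) {R : ℝ}
    (hR : R < 1) : DiffContOnCl ℂ f (Metric.ball 0 R) := by
  refine (hf.mono ?_).diffContOnCl_ball (subset_refl (Metric.closedBall (0 : ℂ) R))
  exact Metric.closedBall_subset_ball hR

theorem circleAverage_eq_apply_zero {f : ℂ → ℂ} (hf : DifferentiableOn ℂ f unitDisk) {R : ℝ}
    (hR0 : 0 ≤ R) (hR : R < 1) : Real.circleAverage f 0 R = f 0 := by
  refine DiffContOnCl.circleAverage ?_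
  rw [abs_of_nonneg hR0]
  exact diffContOnCl_of_unitDisk hf hR

theorem re_circleAverage {f : ℂ → ℂ} {R : ℝ} (hf : CircleIntegrable f 0 R) :
    (Real.circleAverage f 0 R).re = Real.circleAverage (fun z => (f z).re) 0 R :=
  (Complex.reCLM.circleAverage_comp_comm hf).symm

theorem conj_circleAverage {f : ℂ → ℂ} {R : ℝ} (hf : CircleIntegrable f 0 R) :
    starRingEnd ℂ (Real.circleAverage f 0 R) =
      Real.circleAverage (fun z => starRingEnd ℂ (f z)) 0 R :=
  (Complex.conjCLE.toContinuousLinearMap.circleAverage_comp_comm hf).symm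

theorem norm_circleAverage_le {f : ℂ → ℂ} {R : ℝ} :
    ‖Real.circleAverage f 0 R‖ ≤ Real.circleAverage (fun z => ‖f z‖) 0 R := by
  rw [Real.circleAverage, Real.circleAverage, norm_smul, smul_eq_mul,
    Real.norm_of_nonneg (inv_nonneg.2 Real.two_pi_pos.le)]
  gcongr
  exact intervalIntegral.norm_integral_le_integral_norm Real.two_pi_pos.le

theorem circleAverage_inv_pow_mul {f : ℂ → ℂ} (hf : DifferentiableOn ℂ f unitDisk) {R : ℝ}
    (hR0 : 0 < R) (hR : R < 1) (n : ℕ) :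
    Real.circleAverage (fun z => z⁻¹ ^ n * f z) 0 R = taylorCoeff f n := by
  lift R to NNReal using hR0.le
  have hp := (hf.mono (Metric.closedBall_subset_ball hR)).hasFPowerSeriesOnBall
    (NNReal.coe_pos.1 hR0)
  have h := hp.factorial_smul (1 : ℂ) n
  rw [cauchyPowerSeries_apply] at h
  have h2 : iteratedDeriv n f 0 = n.factorial • ((2 * Real.pi * Complex.I : ℂ)⁻¹ •
      ∮ z in C(0, R), (1 / (z - 0)) ^ n • (z - 0)⁻¹ • f z) := by
    rw [h, iteratedDeriv_eq_iteratedFDeriv]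
  rw [taylorCoeff, h2, Real.circleAverage_eq_circleIntegral hR0.ne', nsmul_eq_mul,
    mul_div_cancel_left₀ _ (by exact_mod_cast n.factorial_ne_zero)]
  congr 2
  funext z
  simp only [sub_zero, one_div, smul_eq_mul]
  ring

theorem inv_eq_conj_div_of_mem_sphere {R : ℝ} {z : ℂ} (hz : z ∈ Metric.sphere (0 : ℂ) |R|) :
    z⁻¹ = starRingEnd ℂ z / (R : ℂ) ^ 2 := by
  rw [Complex.inv_def, Complex.normSq_eq_norm_sq, mem_sphere_zero_iff_norm.1 hz, sq_abs]
  push_cast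
  rfl

theorem circleAverage_pow_mul_eq_zero {f : ℂ → ℂ} (hf : DifferentiableOn ℂ f unitDisk) {R : ℝ}
    (hR0 : 0 ≤ R) (hR : R < 1) {n : ℕ} (hn : n ≠ 0) :
    Real.circleAverage (fun z => z ^ n * f z) 0 R = 0 := by
  have h : DifferentiableOn ℂ (fun z => z ^ n * f z) unitDisk :=
    (differentiableOn_id.pow n).mul hf
  rw [circleAverage_eq_apply_zero h hR0 hR]
  simp [hn]

/-- Functions here are analytic only on the open disk, so integral inequalities are proved on
circles of radius R < 1 and then R → 1. -/
theorem le_of_forall_lt_one {g : ℝ → ℝ} {a : ℝ} (hg : ContinuousAt g 1)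
    {ρ : ℝ} (hρ : ρ < 1) (h : ∀ R, ρ < R → R < 1 → g R ≤ a) : g 1 ≤ a := by
  refine le_of_tendsto (hg.tendsto.mono_left (nhdsWithin_le_nhds (s := Set.Iio 1))) ?_
  filter_upwards [Ioo_mem_nhdsLT hρ] with R hR using h R hR.1 hR.2

theorem continuousOn_inv_sphere {R : ℝ} (hR0 : 0 < R) :
    ContinuousOn (fun z : ℂ => z⁻¹) (Metric.sphere (0 : ℂ) R) := by
  refine continuousOn_id.inv₀ fun z hz => ?_
  rw [id, ← norm_pos_iff, mem_sphere_zero_iff_norm.1 hz]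
  exact hR0

/-- **Carathéodory's coefficient bound** for functions with non-negative real part. -/
theorem norm_taylorCoeff_le_of_re_nonneg {p : ℂ → ℂ} (hp : DifferentiableOn ℂ p unitDisk)
    (hre : ∀ z ∈ unitDisk, 0 ≤ (p z).re) {n : ℕ} (hn : n ≠ 0) :
    ‖taylorCoeff p n‖ ≤ 2 * (p 0).re := by
  have key : ∀ R : ℝ, 0 < R → R < 1 → R ^ n * ‖taylorCoeff p n‖ ≤ 2 * (p 0).re := by
    intro R hR0 hR
    have hRa : |R| = R := abs_of_pos hR0
    have hpc := hp.continuousOn.mono (sphere_subset_unitDisk hR)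
    have hinv := continuousOn_inv_sphere hR0
    -- Adding this vanishing integral replaces p by p + p̄ = 2 Re p, which is non-negative and has
    -- known mean.
    have hzero : Real.circleAverage (fun z => z⁻¹ ^ n * starRingEnd ℂ (p z)) 0 R = 0 := by
      have h0 := circleAverage_pow_mul_eq_zero hp hR0.le hR hn
      have h1 : Real.circleAverage (fun z => z⁻¹ ^ n * starRingEnd ℂ (p z)) 0 R =
          Real.circleAverage (fun z => ((((R : ℂ) ^ 2)⁻¹) ^ n) • starRingEnd ℂ (z ^ n * p z)) 0 R := by
        refine Real.circleAverage_congr_sphere fun z hz => ?_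
        simp only [inv_eq_conj_div_of_mem_sphere hz, map_mul, map_pow, smul_eq_mul]
        ring
      rw [h1, Real.circleAverage_fun_smul, ← conj_circleAverage, h0]
      · simp
      · exact ((continuousOn_id.fun_pow n).fun_mul hpc).circleIntegrable hR0.le
    have hsum : taylorCoeff p n =
        Real.circleAverage (fun z => z⁻¹ ^ n * ((2 * (p z).re : ℝ) : ℂ)) 0 R := by
      rw [← circleAverage_inv_pow_mul hp hR0 hR n, ← add_zero (Real.circleAverage (fun z => z⁻¹ ^ n * p z) 0 R)]
      nth_rewrite 2 [← hzero]
      rw [← Real.circleAverage_fun_add]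
      · congr 1
        funext z
        rw [← mul_add, Complex.add_conj]
      · exact ((hinv.fun_pow n).fun_mul hpc).circleIntegrable hR0.le
      · exact ((hinv.fun_pow n).fun_mul
          (Complex.continuous_conj.comp_continuousOn hpc)).circleIntegrable hR0.le
    have hle : ‖taylorCoeff p n‖ ≤ (R ^ n)⁻¹ * (2 * (p 0).re) := by
      rw [hsum]
      refine norm_circleAverage_le.trans_eq ?_
      rw [← circleAverage_eq_apply_zero hp hR0.le hR, re_circleAverage
        (hpc.circleIntegrable hR0.le), ← smul_eq_mul 2, ← Real.circleAverage_fun_smul, ← smul_eq_mul,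
        ← Real.circleAverage_fun_smul]
      refine Real.circleAverage_congr_sphere fun z hz => ?_
      have h2 := hre z (sphere_subset_unitDisk hR (hRa ▸ hz))
      have h3 := mem_sphere_zero_iff_norm.1 hz
      simp only [norm_mul, norm_pow, norm_inv, h3, hRa, Complex.norm_real, smul_eq_mul,
        Real.norm_eq_abs, abs_of_nonneg h2, Nat.abs_ofNat, inv_pow]
    have : R ^ n * ‖taylorCoeff p n‖ ≤ R ^ n * ((R ^ n)⁻¹ * (2 * (p 0).re)) := by gcongr
    rwa [mul_inv_cancel_left₀ (pow_pos hR0 n).ne'] at this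
  have := le_of_forall_lt_one (g := fun R => R ^ n * ‖taylorCoeff p n‖) (by fun_prop) one_half_lt_one
    fun R hR => key R (one_half_pos.trans hR)
  simpa using this

/-- **Harnack's inequality** for functions with non-negative real part. -/
theorem harnack_lower {p : ℂ → ℂ} (hp : DifferentiableOn ℂ p unitDisk)
    (hre : ∀ z ∈ unitDisk, 0 ≤ (p z).re) {w : ℂ} (hw : w ∈ unitDisk) :
    (1 - ‖w‖) / (1 + ‖w‖) * (p 0).re ≤ (p w).re := by
  have hw1 := mem_unitDisk.1 hw
  have hw0 := norm_nonneg w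
  have key : ∀ R : ℝ, ‖w‖ < R → R < 1 → (R - ‖w‖) / (R + ‖w‖) * (p 0).re ≤ (p w).re := by
    intro R hwR hR
    have hR0 : 0 < R := hw0.trans_lt hwR
    have hRa : |R| = R := abs_of_pos hR0
    have hpc := hp.continuousOn.mono (sphere_subset_unitDisk hR)
    have hwb : w ∈ Metric.ball (0 : ℂ) R := mem_ball_zero_iff.2 hwR
    have hker : ContinuousOn (fun z : ℂ => ((z + w) / (z - w)).re) (Metric.sphere 0 R) := by
      refine Complex.continuous_re.comp_continuousOn ((by fun_prop : ContinuousOn _ _).div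
        (by fun_prop) fun z hz => sub_ne_zero.2 ?_)
      rintro rfl
      rw [mem_sphere_zero_iff_norm] at hz
      exact hwR.ne hz
    have h1 := (diffContOnCl_of_unitDisk hp hR).circleAverage_re_herglotzRieszKernel_smul' hwb
    simp only [sub_zero] at h1
    have hker' : ContinuousOn (fun z : ℂ => ((z + w) / (z - w)).re • p z) (Metric.sphere 0 R) :=
      hker.smul hpc
    rw [← h1, re_circleAverage (hker'.circleIntegrable hR0.le),
      ← circleAverage_eq_apply_zero hp hR0.le hR, re_circleAverage (hpc.circleIntegrable hR0.le),
      ← smul_eq_mul, ← Real.circleAverage_fun_smul]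
    refine Real.circleAverage_mono ?_ ?_ fun z hz => ?_
    · exact ContinuousOn.circleIntegrable hR0.le
        ((Complex.continuous_re.comp_continuousOn hpc).fun_const_smul _)
    · exact (Complex.continuous_re.comp_continuousOn hker').circleIntegrable hR0.le
    · rw [hRa] at hz
      have h2 := le_re_herglotzRieszKernel hz hwb
      simp only [sub_zero] at h2
      have h3 := hre z (sphere_subset_unitDisk hR hz)
      simp only [smul_eq_mul, Complex.real_smul, Complex.re_ofReal_mul]
      gcongr
  refine le_of_forall_lt_one (g := fun R => (R - ‖w‖) / (R + ‖w‖) * (p 0).re) ?_ hw1 key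
  refine ContinuousAt.mul (ContinuousAt.div (by fun_prop) (by fun_prop) (by positivity))
    (by fun_prop)

/-- The inequality |sin (n+1)θ| ≤ (n+1)|sin θ| in polar form; it is the source of the factor n in
the bound |bₙ| ≤ nB. -/
theorem abs_im_pow_le (z : ℂ) (n : ℕ) : |(z ^ (n + 1)).im| ≤ (n + 1) * ‖z‖ ^ n * |z.im| := by
  induction n with
  | zero => simp
  | succ n ih =>
    rw [pow_succ, Complex.mul_im]
    calc |(z ^ (n + 1)).re * z.im + (z ^ (n + 1)).im * z.re|
        ≤ |(z ^ (n + 1)).re| * |z.im| + |(z ^ (n + 1)).im| * |z.re| := by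
          rw [← abs_mul, ← abs_mul]; exact abs_add_le _ _
      _ ≤ ‖z‖ ^ (n + 1) * |z.im| + (n + 1) * ‖z‖ ^ n * |z.im| * ‖z‖ := by
          gcongr
          · rw [← norm_pow]; exact Complex.abs_re_le_norm _
          · exact Complex.abs_re_le_norm _
      _ = _ := by push_cast; ring

/-- On the circle of radius `R`, the real parts of the Taylor coefficients of an analytic function
are given by an integral of its imaginary part against `Im zⁿ`. -/
theorem re_taylorCoeff_eq_circleAverage {F : ℂ → ℂ} (hF : DifferentiableOn ℂ F unitDisk)
    {R : ℝ} (hR0 : 0 < R) (hR : R < 1) {n : ℕ} (hn : n ≠ 0) :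
    (R ^ 2) ^ n * (taylorCoeff F n).re =
      Real.circleAverage (fun z => 2 * (z ^ n).im * (F z).im) 0 R := by
  have hpc := hF.continuousOn.mono (sphere_subset_unitDisk hR)
  have hinv := continuousOn_inv_sphere hR0
  -- The subtracted integral is zero. On the circle R²ⁿ z⁻ⁿ is the conjugate of zⁿ, so the combined
  -- kernel is purely imaginary and only Im F survives in the real part.
  have h1 : (taylorCoeff F n) * ((R : ℂ) ^ 2) ^ n =
      Real.circleAverage (fun z => (((R : ℂ) ^ 2) ^ n) • (z⁻¹ ^ n * F z) - z ^ n * F z) 0 R := by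
    rw [Real.circleAverage_fun_sub, circleAverage_pow_mul_eq_zero hF hR0.le hR hn,
      Real.circleAverage_fun_smul, circleAverage_inv_pow_mul hF hR0 hR, smul_eq_mul]
    · ring
    · exact (((hinv.fun_pow n).fun_mul hpc).fun_const_smul _).circleIntegrable hR0.le
    · exact ((continuousOn_id.fun_pow n).fun_mul hpc).circleIntegrable hR0.le
  have h2 : (R ^ 2) ^ n * (taylorCoeff F n).re = ((taylorCoeff F n) * ((R : ℂ) ^ 2) ^ n).re := by
    rw [← Complex.ofReal_pow, ← Complex.ofReal_pow, Complex.re_mul_ofReal, mul_comm]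
  rw [h2, h1, re_circleAverage]
  · refine Real.circleAverage_congr_sphere fun z hz => ?_
    have hRc : ((R : ℂ) ^ 2) ^ n ≠ 0 := by simp [hR0.ne']
    have : ((R : ℂ) ^ 2) ^ n • (z⁻¹ ^ n * F z) - z ^ n * F z =
        (starRingEnd ℂ (z ^ n) - z ^ n) * F z := by
      rw [inv_eq_conj_div_of_mem_sphere hz, map_pow, div_pow, smul_eq_mul]
      field_simp
    simp only [this, Complex.mul_re, Complex.sub_re, Complex.sub_im, Complex.conj_re,
      Complex.conj_im]
    ring
  · exact ((((hinv.fun_pow n).fun_mul hpc).fun_const_smul _).fun_sub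
      ((continuousOn_id.fun_pow n).fun_mul hpc)).circleIntegrable hR0.le

/-- Rogosinski's coefficient bound for typically real functions. -/
theorem abs_re_taylorCoeff_le {F : ℂ → ℂ} (hF : DifferentiableOn ℂ F unitDisk)
    (him : ∀ z ∈ unitDisk, 0 ≤ z.im * (F z).im) (n : ℕ) :
    |(taylorCoeff F (n + 1)).re| ≤ (n + 1) * (deriv F 0).re := by
  have key : ∀ R : ℝ, 0 < R → R < 1 →
      R ^ n * |(taylorCoeff F (n + 1)).re| ≤ (n + 1) * (deriv F 0).re := by
    intro R hR0 hR
    have hRa : |R| = R := abs_of_pos hR0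
    have hpc := hF.continuousOn.mono (sphere_subset_unitDisk hR)
    have himc : ContinuousOn (fun z => (F z).im) (Metric.sphere 0 R) :=
      Complex.continuous_im.comp_continuousOn hpc
    have h1 := re_taylorCoeff_eq_circleAverage hF hR0 hR n.succ_ne_zero
    have h2 := re_taylorCoeff_eq_circleAverage hF hR0 hR one_ne_zero
    have h3 : |(R ^ 2) ^ (n + 1) * (taylorCoeff F (n + 1)).re| ≤
        ((n + 1) * R ^ n) * ((R ^ 2) ^ 1 * (taylorCoeff F 1).re) := by
      rw [h1, h2, ← smul_eq_mul ((n + 1) * R ^ n), ← Real.circleAverage_fun_smul]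
      refine Real.abs_circleAverage_le_circleAverage_abs.trans ?_
      have hc1 : ContinuousOn (fun z : ℂ => 2 * (z ^ (n + 1)).im * (F z).im) (Metric.sphere 0 R) :=
        (by fun_prop : ContinuousOn (fun z : ℂ => 2 * (z ^ (n + 1)).im) _).mul himc
      have hc2 : ContinuousOn (fun z : ℂ => 2 * (z ^ 1).im * (F z).im) (Metric.sphere 0 R) :=
        (by fun_prop : ContinuousOn (fun z : ℂ => 2 * (z ^ 1).im) _).mul himc
      refine Real.circleAverage_mono (hc1.abs.circleIntegrable hR0.le)
        ((hc2.fun_const_smul _).circleIntegrable hR0.le) fun z hz => ?_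
      rw [hRa] at hz
      have h4 := him z (sphere_subset_unitDisk hR hz)
      have h5 := abs_im_pow_le z n
      rw [mem_sphere_zero_iff_norm.1 hz] at h5
      simp only [Pi.abs_apply, pow_one, smul_eq_mul]
      rw [mul_assoc 2 z.im, ← abs_of_nonneg h4, abs_mul, abs_mul, abs_mul z.im, abs_two]
      calc 2 * |(z ^ (n + 1)).im| * |(F z).im|
          ≤ 2 * ((n + 1) * R ^ n * |z.im|) * |(F z).im| := by gcongr
        _ = _ := by ring
    rw [abs_mul, abs_of_pos (by positivity), taylorCoeff_one] at h3
    have h6 : R ^ (n + 2) * (R ^ n * |(taylorCoeff F (n + 1)).re|) ≤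
        R ^ (n + 2) * ((n + 1) * (deriv F 0).re) := by
      calc _ = (R ^ 2) ^ (n + 1) * |(taylorCoeff F (n + 1)).re| := by ring
        _ ≤ _ := h3
        _ = _ := by ring
    exact le_of_mul_le_mul_left h6 (by positivity)
  have := le_of_forall_lt_one (g := fun R => R ^ n * |(taylorCoeff F (n + 1)).re|) (by fun_prop)
    one_half_lt_one fun R hR => key R (one_half_pos.trans hR)
  simpa using this

/-- The Robertson representation of a typically real function on the real diameter. -/
theorem re_eq_circleAverage_robertson {F : ℂ → ℂ} (hF : DifferentiableOn ℂ F unitDisk)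
    (hF0 : F 0 = 0) {R x : ℝ} (hxR : |x| < R) (hR : R < 1) :
    (F x).re = Real.circleAverage (fun z => 2 * z.im * (F z).im * (x / ‖z - x‖ ^ 2)) 0 R := by
  have hR0 : 0 < R := (abs_nonneg x).trans_lt hxR
  have hRa : |R| = R := abs_of_pos hR0
  have hpc := hF.continuousOn.mono (sphere_subset_unitDisk hR)
  have hne : ∀ z ∈ Metric.sphere (0 : ℂ) R, z - (x : ℂ) ≠ 0 := fun z hz h => by
    rw [sub_eq_zero] at h
    rw [mem_sphere_zero_iff_norm, h, Complex.norm_real] at hz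
    exact hxR.ne hz
  have hne0 : ∀ z ∈ Metric.sphere (0 : ℂ) R, z ≠ 0 := fun z hz h => by
    rw [mem_sphere_zero_iff_norm, h, norm_zero] at hz
    exact hR0.ne hz
  have h1 : Real.circleAverage (fun z => (z / (z - x)) • F z) 0 R = F x := by
    have := DiffContOnCl.circleAverage_smul_div (f := F) (c := 0) (R := R) (w := (x : ℂ))
      (by rw [hRa]; exact diffContOnCl_of_unitDisk hF hR)
      (by rw [hRa, mem_ball_zero_iff, Complex.norm_real]; exact hxR)
    simpa only [sub_zero] using this
  have hden : ∀ z ∈ Metric.closedBall (0 : ℂ) R, (R : ℂ) ^ 2 - x * z ≠ 0 := fun z hz h => by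
    have h2 := congrArg norm (sub_eq_zero.1 h)
    rw [mem_closedBall_zero_iff] at hz
    rw [norm_pow, norm_mul, Complex.norm_real, Complex.norm_real, Real.norm_of_nonneg hR0.le,
      Real.norm_eq_abs] at h2
    nlinarith [abs_nonneg x, norm_nonneg z]
  have hG : DifferentiableOn ℂ (fun z => ((R : ℂ) ^ 2 / ((R : ℂ) ^ 2 - x * z)) * F z)
      (Metric.closedBall 0 R) :=
    (DifferentiableOn.div (by fun_prop) (by fun_prop) hden).mul
      (hF.mono (Metric.closedBall_subset_ball hR))
  -- This kernel has its pole at the reflected point R²/x, outside the disk, so its mean is F(0) =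
  -- 0. Subtracting it from the Cauchy kernel leaves x(z̄ - z)/|z - x|², which is again imaginary.
  have h2 : Real.circleAverage (fun z => ((R : ℂ) ^ 2 / ((R : ℂ) ^ 2 - x * z)) * F z) 0 R = 0 := by
    rw [DiffContOnCl.circleAverage]
    · simp [hF0]
    · rw [hRa]
      exact hG.diffContOnCl_ball (subset_refl _)
  have hi1 : CircleIntegrable (fun z => (z / (z - x)) • F z) 0 R :=
    ((ContinuousOn.div (by fun_prop) (by fun_prop) hne).smul hpc).circleIntegrable hR0.le
  have hi2 : CircleIntegrable (fun z => ((R : ℂ) ^ 2 / ((R : ℂ) ^ 2 - x * z)) * F z) 0 R :=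
    (hG.continuousOn.mono Metric.sphere_subset_closedBall).circleIntegrable hR0.le
  have hi3 : CircleIntegrable (fun z =>
      (z / (z - x)) • F z - ((R : ℂ) ^ 2 / ((R : ℂ) ^ 2 - x * z)) * F z) 0 R := hi1.sub hi2
  rw [← h1, ← sub_zero (Real.circleAverage (fun z => (z / (z - x)) • F z) 0 R)]
  nth_rewrite 2 [← h2]
  rw [← Real.circleAverage_fun_sub hi1 hi2,
    re_circleAverage hi3]
  refine Real.circleAverage_congr_sphere fun z hz => ?_
  rw [hRa] at hz
  have e1 := hne z hz
  have e2 : starRingEnd ℂ z - x ≠ 0 := fun h => e1 (by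
    have := congrArg (starRingEnd ℂ) h
    simpa using this)
  have e3 : (R : ℂ) ^ 2 = z * starRingEnd ℂ z := by
    rw [Complex.mul_conj, Complex.normSq_eq_norm_sq, mem_sphere_zero_iff_norm.1 hz]
    push_cast
    rfl
  have e4 : (z - x) * (starRingEnd ℂ z - x) = ((‖z - x‖ ^ 2 : ℝ) : ℂ) := by
    rw [← Complex.normSq_eq_norm_sq, ← Complex.mul_conj]
    simp
  have e5 : (z / (z - x)) • F z - ((R : ℂ) ^ 2 / ((R : ℂ) ^ 2 - x * z)) * F z =
      ((x / ‖z - x‖ ^ 2 : ℝ) : ℂ) * ((starRingEnd ℂ z - z) * F z) := by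
    have e6 : (R : ℂ) ^ 2 / ((R : ℂ) ^ 2 - x * z) =
        starRingEnd ℂ z / (starRingEnd ℂ z - x) := by
      rw [e3, show z * starRingEnd ℂ z - x * z = z * (starRingEnd ℂ z - x) by ring,
        mul_div_mul_left _ _ (hne0 z hz)]
    rw [e6, Complex.ofReal_div, ← e4, smul_eq_mul]
    field_simp
    ring
  simp only [e5]
  rw [Complex.re_ofReal_mul, Complex.mul_re, Complex.sub_re, Complex.sub_im, Complex.conj_re,
    Complex.conj_im]
  ring

/-- Typically real functions grow along the real diameter at least as fast as the Koebe function
decreases. -/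
theorem typicallyReal_growth {F : ℂ → ℂ} (hF : DifferentiableOn ℂ F unitDisk) (hF0 : F 0 = 0)
    (him : ∀ z ∈ unitDisk, 0 ≤ z.im * (F z).im) {x y : ℝ} (hx : |x| < 1) (hy : |y| < 1)
    (hxy : x ≤ y) :
    (deriv F 0).re * ((y - x) * (1 - x * y) / ((1 + |x|) ^ 2 * (1 + |y|) ^ 2)) ≤
      (F y).re - (F x).re := by
  have key : ∀ R : ℝ, max |x| |y| < R → R < 1 →
      (R ^ 2 * (deriv F 0).re) * ((y - x) * (R ^ 2 - x * y) / ((R + |x|) ^ 2 * (R + |y|) ^ 2)) ≤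
      (F y).re - (F x).re := by
    intro R hm hR
    have hxR := (le_max_left _ _).trans_lt hm
    have hyR := (le_max_right _ _).trans_lt hm
    have hR0 : 0 < R := (abs_nonneg x).trans_lt hxR
    have hRa : |R| = R := abs_of_pos hR0
    have hpc := hF.continuousOn.mono (sphere_subset_unitDisk hR)
    have himc : ContinuousOn (fun z => (F z).im) (Metric.sphere 0 R) :=
      Complex.continuous_im.comp_continuousOn hpc
    have hc1 : ContinuousOn (fun z : ℂ => 2 * z.im * (F z).im) (Metric.sphere 0 R) :=
      (by fun_prop : ContinuousOn (fun z : ℂ => 2 * z.im) _).mul himc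
    have hlow : ∀ t : ℝ, |t| < R → ∀ z ∈ Metric.sphere (0 : ℂ) R, 0 < ‖z - t‖ := fun t ht z hz => by
      have := norm_sub_norm_le z t
      rw [mem_sphere_zero_iff_norm.1 hz, Complex.norm_real, Real.norm_eq_abs] at this
      linarith
    have hci : ∀ t : ℝ, |t| < R →
        CircleIntegrable (fun z : ℂ => 2 * z.im * (F z).im * (t / ‖z - t‖ ^ 2)) 0 R := fun t ht =>
      (hc1.mul (ContinuousOn.div (by fun_prop) (by fun_prop)
        fun z hz => (pow_pos (hlow t ht z hz) 2).ne')).circleIntegrable hR0.le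
    have h2 := re_taylorCoeff_eq_circleAverage hF hR0 hR one_ne_zero
    rw [taylorCoeff_one, pow_one] at h2
    rw [re_eq_circleAverage_robertson hF hF0 hxR hR, re_eq_circleAverage_robertson hF hF0 hyR hR,
      ← Real.circleAverage_fun_sub (hci y hyR) (hci x hxR), h2, mul_comm, ← smul_eq_mul,
      ← Real.circleAverage_fun_smul]
    simp only [pow_one]
    refine Real.circleAverage_mono ((hc1.fun_const_smul _).circleIntegrable hR0.le)
      ((hci y hyR).sub (hci x hxR)) fun z hz => ?_
    rw [hRa] at hz
    have hz4 := him z (sphere_subset_unitDisk hR hz)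
    have hzn := mem_sphere_zero_iff_norm.1 hz
    have hsq : ∀ t : ℝ, ‖z - t‖ ^ 2 = R ^ 2 - 2 * t * z.re + t ^ 2 := fun t => by
      rw [← hzn, ← Complex.normSq_eq_norm_sq, ← Complex.normSq_eq_norm_sq, Complex.normSq_apply,
        Complex.normSq_apply]
      simp
      ring
    have hup : ∀ t : ℝ, ‖z - t‖ ≤ R + |t| := fun t => by
      have := norm_sub_le z t
      rwa [hzn, Complex.norm_real, Real.norm_eq_abs] at this
    have hdx := hlow x hxR z hz
    have hdy := hlow y hyR z hz
    have hnum : 0 ≤ R ^ 2 - x * y := by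
      have : x * y ≤ |x| * |y| := by rw [← abs_mul]; exact le_abs_self _
      nlinarith [abs_nonneg x, abs_nonneg y]
    have hdiff : y / ‖z - y‖ ^ 2 - x / ‖z - x‖ ^ 2 =
        (y - x) * (R ^ 2 - x * y) / (‖z - x‖ ^ 2 * ‖z - y‖ ^ 2) := by
      rw [div_sub_div _ _ (by positivity) (by positivity), hsq, hsq]
      congr 1 <;> ring
    have hfin : (y - x) * (R ^ 2 - x * y) / ((R + |x|) ^ 2 * (R + |y|) ^ 2) ≤
        y / ‖z - y‖ ^ 2 - x / ‖z - x‖ ^ 2 := by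
      rw [hdiff]
      have := sub_nonneg.2 hxy
      gcongr
      · exact hup x
      · exact hup y
    rw [smul_eq_mul, ← mul_sub, mul_comm]
    gcongr
    rw [mul_assoc]
    positivity
  have := le_of_forall_lt_one (g := fun R => (R ^ 2 * (deriv F 0).re) *
    ((y - x) * (R ^ 2 - x * y) / ((R + |x|) ^ 2 * (R + |y|) ^ 2))) ?_ (max_lt hx hy) key
  · simpa using this
  · refine ContinuousAt.mul (by fun_prop) (ContinuousAt.div (by fun_prop) (by fun_prop) ?_)
    positivity


/-! ### Injective analytic functions and the symmetry of Ma–Minda functions -/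

theorem isOpen_image_of_injOn {f : ℂ → ℂ} (hf : DifferentiableOn ℂ f unitDisk)
    (hinj : Set.InjOn f unitDisk) {s : Set ℂ} (hs : s ⊆ unitDisk) (hso : IsOpen s) :
    IsOpen (f '' s) := by
  rcases (hf.analyticOnNhd isOpen_unitDisk).is_constant_or_isOpen isPreconnected_unitDisk with h | h
  · obtain ⟨w, hw⟩ := h
    have h2 : (1 / 2 : ℂ) ∈ unitDisk := by rw [mem_unitDisk]; norm_num
    have := hinj zero_mem_unitDisk h2 ((hw 0 zero_mem_unitDisk).trans (hw _ h2).symm)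
    norm_num at this
  · exact h s hs hso

/-- The inverse is continuous by the open mapping theorem and differentiable where f' ≠ 0. Zeros of
f' are isolated, as f is not locally constant, so the remaining points are removable singularities.
-/
theorem exists_holomorphic_inverse {f : ℂ → ℂ} (hf : DifferentiableOn ℂ f unitDisk)
    (hinj : Set.InjOn f unitDisk) :
    ∃ g : ℂ → ℂ, DifferentiableOn ℂ g (f '' unitDisk) ∧ ∀ z ∈ unitDisk, g (f z) = z := by
  have hopen := isOpen_image_of_injOn hf hinj (subset_refl _) isOpen_unitDisk
  set g := Function.invFunOn f unitDisk with hg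
  have hgf : ∀ z ∈ unitDisk, g (f z) = z := fun z hz => hinj.leftInvOn_invFunOn hz
  have hcont : ∀ z ∈ unitDisk, ContinuousAt g (f z) := fun z hz => by
    rw [ContinuousAt, hgf z hz]
    intro V hV
    obtain ⟨O, hOV, hO, hzO⟩ := mem_nhds_iff.1 (Filter.inter_mem hV (unitDisk_mem_nhds hz))
    have hOD : O ⊆ unitDisk := hOV.trans Set.inter_subset_right
    refine Filter.mem_map.2 (Filter.mem_of_superset
      ((isOpen_image_of_injOn hf hinj hOD hO).mem_nhds ⟨z, hzO, rfl⟩) ?_)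
    rintro _ ⟨u, hu, rfl⟩
    rw [Set.mem_preimage, hgf u (hOD hu)]
    exact (hOV hu).1
  have hdiff : ∀ z ∈ unitDisk, deriv f z ≠ 0 → DifferentiableAt ℂ g (f z) := fun z hz h0 => by
    have hd : HasDerivAt f (deriv f z) (g (f z)) := by
      rw [hgf z hz]
      exact (hf.differentiableAt (unitDisk_mem_nhds hz)).hasDerivAt
    refine (hd.of_local_left_inverse (hcont z hz) h0 ?_).differentiableAt
    filter_upwards [hopen.mem_nhds ⟨z, hz, rfl⟩]
    rintro _ ⟨u, hu, rfl⟩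
    rw [hgf u hu]
  refine ⟨g, ?_, hgf⟩
  rintro _ ⟨z, hz, rfl⟩
  refine DifferentiableAt.differentiableWithinAt ?_
  have hd' : AnalyticAt ℂ (deriv f) z :=
    ((hf.analyticOnNhd isOpen_unitDisk) z hz).deriv
  rcases hd'.eventually_eq_zero_or_eventually_ne_zero with h | h
  · exfalso
    obtain ⟨ε, hε, hball⟩ := Metric.mem_nhds_iff.1 (Filter.inter_mem h (unitDisk_mem_nhds hz))
    have hconst : ∀ y ∈ Metric.ball z ε, f y = f z := fun y hy =>
      (convex_ball z ε).is_const_of_fderivWithin_eq_zero (𝕜 := ℂ)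
        (hf.mono fun u hu => (hball hu).2) (fun u hu => by
          rw [fderivWithin_of_isOpen Metric.isOpen_ball hu]
          ext
          simpa using (hball hu).1) hy (Metric.mem_ball_self hε)
    have hy : z + (ε / 2 : ℝ) ∈ Metric.ball z ε := by
      rw [Metric.mem_ball, dist_eq_norm, add_sub_cancel_left, Complex.norm_real,
        Real.norm_of_nonneg (by positivity)]
      linarith
    have := hinj (hball hy).2 hz (hconst _ hy)
    rw [add_eq_left, Complex.ofReal_eq_zero] at this
    linarith
  · refine (Complex.analyticAt_of_differentiable_on_punctured_nhds_of_continuousAt ?_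
      (hcont z hz)).differentiableAt
    rw [eventually_nhdsWithin_iff] at h ⊢
    have h1 := (hcont z hz).eventually (by rw [hgf z hz]; exact h)
    filter_upwards [h1, hopen.mem_nhds ⟨z, hz, rfl⟩]
    rintro _ hu1 ⟨u, hu, rfl⟩ hne
    rw [hgf u hu] at hu1
    exact hdiff u hu (hu1 fun h => hne (by rw [Set.mem_singleton_iff.1 h]; rfl))

theorem conj_mem_unitDisk {z : ℂ} (hz : z ∈ unitDisk) : starRingEnd ℂ z ∈ unitDisk := by
  rw [mem_unitDisk] at *
  rwa [Complex.norm_conj]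

namespace IsMaMinda

variable {ψ : ℂ → ℂ}

/-- Since ψ(𝔻) is symmetric, ψ⁻¹ applied to the conjugate of ψ(z̄) is a self-map of the disk. It
fixes 0 with derivative 1 because ψ'(0) is real and non-zero, so it is the identity by the equality
case of Schwarz's lemma. -/
theorem apply_conj (hψ : IsMaMinda ψ) {z : ℂ} (hz : z ∈ unitDisk) :
    ψ (starRingEnd ℂ z) = starRingEnd ℂ (ψ z) := by
  obtain ⟨g, hg, hgψ⟩ := exists_holomorphic_inverse hψ.analytic hψ.univalent
  have hψg : ∀ y ∈ ψ '' unitDisk, g y ∈ unitDisk ∧ ψ (g y) = y := by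
    rintro _ ⟨u, hu, rfl⟩
    rw [hgψ u hu]
    exact ⟨hu, rfl⟩
  set χ : ℂ → ℂ := fun z => starRingEnd ℂ (ψ (starRingEnd ℂ z)) with hχ
  have hχm : ∀ z ∈ unitDisk, χ z ∈ ψ '' unitDisk := fun z hz =>
    hψ.symmetric _ ⟨_, conj_mem_unitDisk hz, rfl⟩
  have hχd : ∀ z ∈ unitDisk, HasDerivAt χ (starRingEnd ℂ (deriv ψ (starRingEnd ℂ z))) z :=
    fun z hz => by
      have := (hψ.analytic.differentiableAt
        (unitDisk_mem_nhds (conj_mem_unitDisk hz))).hasDerivAt.conj_conj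
      simpa [hχ, Function.comp_def] using this
  have hopen := isOpen_image_of_injOn hψ.analytic hψ.univalent (subset_refl _) isOpen_unitDisk
  have hgd : ∀ y ∈ ψ '' unitDisk, DifferentiableAt ℂ g y := fun y hy =>
    hg.differentiableAt (hopen.mem_nhds hy)
  have hχ0 : χ 0 = ψ 0 := by simp [hχ, hψ.map_zero]
  have hv0 : g (χ 0) = 0 := by rw [hχ0, hgψ 0 zero_mem_unitDisk]
  have hvd : DifferentiableOn ℂ (fun z => g (χ z)) unitDisk := fun z hz =>
    ((hgd _ (hχm z hz)).comp z (hχd z hz).differentiableAt).differentiableWithinAt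
  have hreal : starRingEnd ℂ (deriv ψ 0) = deriv ψ 0 := Complex.conj_eq_iff_im.2 hψ.deriv_im
  have hg1 := hgd _ ⟨0, zero_mem_unitDisk, rfl⟩
  have hψd := (hψ.analytic.differentiableAt (unitDisk_mem_nhds zero_mem_unitDisk)).hasDerivAt
  have hone : deriv g (ψ 0) * deriv ψ 0 = 1 := by
    have h1 : HasDerivAt (g ∘ ψ) (deriv g (ψ 0) * deriv ψ 0) 0 := hg1.hasDerivAt.comp 0 hψd
    have h2 : (g ∘ ψ) =ᶠ[nhds 0] id :=
      Filter.eventuallyEq_of_mem (unitDisk_mem_nhds zero_mem_unitDisk) fun z hz => hgψ z hz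
    exact h1.deriv.symm.trans (h2.deriv_eq.trans (deriv_id 0))
  have hvder : deriv (fun z => g (χ z)) 0 = 1 := by
    have h1 := hχd 0 zero_mem_unitDisk
    rw [_root_.map_zero, hreal] at h1
    have h2 : HasDerivAt g (deriv g (ψ 0)) (χ 0) := by rw [hχ0]; exact hg1.hasDerivAt
    exact (h2.comp 0 h1).deriv.trans hone
  have heq := Complex.affine_of_mapsTo_ball_of_norm_dslope_eq_div (c := 0) (R₁ := 1) (R₂ := 1)
    (z₀ := 0) hvd (fun z hz => by
      rw [hv0]
      exact Metric.ball_subset_closedBall (hψg _ (hχm z hz)).1) zero_mem_unitDisk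
    (by rw [dslope_same, show deriv (fun z => g (χ z)) 0 = 1 from hvder]; simp)
  have hid : g (χ z) = z := by
    have := heq hz
    rw [dslope_same] at this
    simpa [hv0, hvder] using this
  have := (hψg _ (hχm z hz)).2
  rw [hid] at this
  rw [this, hχ, Complex.conj_conj]

theorem im_eq_zero_of_apply (hψ : IsMaMinda ψ) {z : ℂ} (hz : z ∈ unitDisk)
    (h : (ψ z).im = 0) : z.im = 0 := by
  refine Complex.conj_eq_iff_im.1 (hψ.univalent (conj_mem_unitDisk hz) hz ?_)
  rw [hψ.apply_conj hz, Complex.conj_eq_iff_im.2 h]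

theorem im_apply_ofReal (hψ : IsMaMinda ψ) {x : ℝ} (hx : |x| < 1) : (ψ x).im = 0 := by
  have := hψ.apply_conj (z := x) (by rwa [mem_unitDisk, Complex.norm_real])
  rw [Complex.conj_ofReal] at this
  exact Complex.conj_eq_iff_im.1 this.symm

/-- Univalence and symmetry keep Im ψ from vanishing on the upper half-disk, so its sign is constant
there; ψ'(0) > 0 makes it positive just above the origin on the imaginary axis. -/
theorem im_nonneg_of_im_pos (hψ : IsMaMinda ψ) {z : ℂ} (hz : z ∈ unitDisk) (him : 0 < z.im) :
    0 ≤ (ψ z).im := by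
  by_contra! hneg
  set U : Set ℂ := unitDisk ∩ {z | 0 < z.im} with hU
  have hUc : IsPreconnected U :=
    ((convex_ball (0 : ℂ) 1).inter (convex_halfSpace_im_gt 0)).isPreconnected
  have hcont : ContinuousOn (fun z => (ψ z).im) U :=
    Complex.continuous_im.comp_continuousOn (hψ.analytic.continuousOn.mono Set.inter_subset_left)
  obtain ⟨u, huU, hu⟩ : ∃ u ∈ U, 0 < (ψ u).im := by
    have hd := (hψ.analytic.differentiableAt (unitDisk_mem_nhds zero_mem_unitDisk)).hasDerivAt
    have hd1 : HasDerivAt (fun t : ℝ => (ψ ((t : ℂ) * Complex.I)).im) (deriv ψ 0).re 0 := by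
      have h1 : HasDerivAt (fun t : ℝ => (t : ℂ) * Complex.I) (1 * Complex.I) 0 :=
        (Complex.ofRealCLM.hasDerivAt (x := 0)).mul_const Complex.I
      have h2 : HasDerivAt ψ (deriv ψ 0) (((0 : ℝ) : ℂ) * Complex.I) := by simpa using hd
      have h3 := (Complex.imCLM.hasFDerivAt.comp_hasDerivAt (0 : ℝ) (h2.comp (0 : ℝ) h1))
      simpa [Function.comp_def] using h3
    have h4 := (hasDerivAt_iff_tendsto_slope.1 hd1).eventually (lt_mem_nhds hψ.deriv_re_pos)
    have h5 : ∀ᶠ t : ℝ in nhdsWithin 0 (Set.Ioi 0),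
        0 < slope (fun t : ℝ => (ψ ((t : ℂ) * Complex.I)).im) 0 t :=
      h4.filter_mono (nhdsWithin_mono _ fun t ht => ne_of_gt ht)
    obtain ⟨t, ht, ht0, ht1⟩ := (h5.and (Ioo_mem_nhdsGT (zero_lt_one' ℝ))).exists
    refine ⟨(t : ℂ) * Complex.I, ⟨?_, by simpa using ht0⟩, ?_⟩
    · rw [mem_unitDisk]
      simpa [abs_of_pos ht0] using ht1
    · rw [slope_def_field] at ht
      simp only [Complex.ofReal_zero, zero_mul, hψ.map_zero, Complex.one_im, sub_zero] at ht
      exact (div_pos_iff_of_pos_right ht0).1 ht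
  obtain ⟨v, hvU, hv⟩ := hUc.intermediate_value ⟨hz, him⟩ huU hcont ⟨hneg.le, hu.le⟩
  exact hvU.2.ne' (hψ.im_eq_zero_of_apply hvU.1 hv)

theorem im_mul_im_nonneg (hψ : IsMaMinda ψ) {z : ℂ} (hz : z ∈ unitDisk) :
    0 ≤ z.im * (ψ z - 1).im := by
  rw [Complex.sub_im, Complex.one_im, sub_zero]
  rcases lt_trichotomy z.im 0 with h | h | h
  · have := hψ.im_nonneg_of_im_pos (conj_mem_unitDisk hz) (by simpa using h)
    rw [hψ.apply_conj hz, Complex.conj_im] at this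
    exact mul_nonneg_of_nonpos_of_nonpos h.le (by linarith)
  · simp [h]
  · exact mul_nonneg h.le (hψ.im_nonneg_of_im_pos hz h)

theorem analytic_sub_one (hψ : IsMaMinda ψ) : DifferentiableOn ℂ (fun z => ψ z - 1) unitDisk :=
  hψ.analytic.sub_const 1

theorem im_taylorCoeff (hψ : IsMaMinda ψ) (m : ℕ) : (taylorCoeff ψ m).im = 0 := by
  refine Complex.conj_eq_iff_im.1 (taylorCoeff_eq_of_hasSum (f := ψ)
    (c := fun m => starRingEnd ℂ (taylorCoeff ψ m)) one_pos (fun z hz => ?_) m).symm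
  have hz := mem_unitDisk.2 hz
  have h := Complex.hasSum_conj'.2 (hasSum_taylorCoeff hψ.analytic (conj_mem_unitDisk hz))
  simpa [hψ.apply_conj hz] using h

end IsMaMinda


/-! ### Bounded functions on the disk and Schwarz functions -/

theorem exists_norm_eq_one_mul_eq_norm (c : ℂ) : ∃ u : ℂ, ‖u‖ = 1 ∧ u * c = ‖c‖ := by
  rcases eq_or_ne c 0 with rfl | hc
  · exact ⟨1, by simp, by simp⟩
  · have h : (‖c‖ : ℂ) ≠ 0 := by simpa using hc
    refine ⟨starRingEnd ℂ c / ‖c‖, by simp [hc], ?_⟩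
    rw [div_mul_eq_mul_div, Complex.conj_mul', div_eq_iff h, sq]

theorem sub_norm_le_re_const_sub_mul {φ : ℂ → ℂ} {M : ℝ} {u z : ℂ} (hu : ‖u‖ = 1) :
    M - ‖φ z‖ ≤ ((M : ℂ) - u * φ z).re := by
  have := Complex.re_le_norm (u * φ z)
  rw [norm_mul, hu, one_mul] at this
  rw [Complex.sub_re, Complex.ofReal_re]
  linarith

/-- Carathéodory's bound for M - uφ, with the unimodular u chosen so that uφ(0) = |φ(0)|. -/
theorem norm_taylorCoeff_le_of_bounded {φ : ℂ → ℂ} {M : ℝ} (hφ : DifferentiableOn ℂ φ unitDisk)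
    (hM : ∀ z ∈ unitDisk, ‖φ z‖ ≤ M) {n : ℕ} (hn : n ≠ 0) :
    ‖taylorCoeff φ n‖ ≤ 2 * (M - ‖φ 0‖) := by
  obtain ⟨u, hu, hu0⟩ := exists_norm_eq_one_mul_eq_norm (φ 0)
  have huφ : DifferentiableOn ℂ (fun z => u * φ z) unitDisk := hφ.const_mul u
  have h := norm_taylorCoeff_le_of_re_nonneg (p := fun z => (M : ℂ) - u * φ z)
    (huφ.const_sub _) (fun z hz =>
      (sub_nonneg.2 (hM z hz)).trans (sub_norm_le_re_const_sub_mul hu)) hn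
  rw [taylorCoeff_sub (differentiableOn_const _) huφ, taylorCoeff_const, if_neg hn,
    taylorCoeff_const_mul hφ, zero_sub, norm_neg, norm_mul, hu, one_mul, hu0] at h
  simpa using h

/-- Harnack's inequality for 1 - uφ; this time u rotates the value at z, not at 0, onto the positive
axis. -/
theorem norm_le_of_bounded {φ : ℂ → ℂ} (hφ : DifferentiableOn ℂ φ unitDisk)
    (hM : ∀ z ∈ unitDisk, ‖φ z‖ ≤ 1) {z : ℂ} (hz : z ∈ unitDisk) :
    ‖φ z‖ ≤ 1 - (1 - ‖z‖) / (1 + ‖z‖) * (1 - ‖φ 0‖) := by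
  obtain ⟨u, hu, hu0⟩ := exists_norm_eq_one_mul_eq_norm (φ z)
  have h := harnack_lower (p := fun z => ((1 : ℝ) : ℂ) - u * φ z)
    ((hφ.const_mul u).const_sub _) (fun z hz =>
      (sub_nonneg.2 (hM z hz)).trans (sub_norm_le_re_const_sub_mul hu)) hz
  have h0 := sub_norm_le_re_const_sub_mul (φ := φ) (M := 1) (z := 0) hu
  have hz1 := mem_unitDisk.1 hz
  have h1 : 0 ≤ (1 - ‖z‖) / (1 + ‖z‖) := div_nonneg (by linarith) (by positivity)
  have h2 := (mul_le_mul_of_nonneg_left h0 h1).trans h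
  rw [hu0] at h2
  simp only [Complex.sub_re, Complex.ofReal_re] at h2
  linarith

theorem majorant_sub_apply_zero_le {φ : ℂ → ℂ} {M : ℝ} (hφ : DifferentiableOn ℂ φ unitDisk)
    (hM : ∀ z ∈ unitDisk, ‖φ z‖ ≤ M) {r : ℝ} (hr0 : 0 ≤ r) (hr : r < 1) :
    majorant (fun z => φ z - φ 0) r ≤ 2 * (M - ‖φ 0‖) * (r / (1 - r)) := by
  have hd : DifferentiableOn ℂ (fun z => φ z - φ 0) unitDisk := hφ.sub_const _
  have hs := summable_majorant hd hr0 hr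
  have hg : HasSum (fun m : ℕ => 2 * (M - ‖φ 0‖) * (r * r ^ m))
      (2 * (M - ‖φ 0‖) * (r / (1 - r))) := by
    rw [div_eq_mul_inv]
    exact ((hasSum_geometric_of_lt_one hr0 hr).mul_left r).mul_left _
  rw [majorant, hs.tsum_eq_zero_add, ← hg.tsum_eq]
  simp only [taylorCoeff_zero, sub_self, norm_zero, zero_mul, zero_add]
  refine ((summable_nat_add_iff 1).2 hs).tsum_le_tsum (fun m => ?_) hg.summable
  rw [taylorCoeff_sub hφ (differentiableOn_const _), taylorCoeff_const, if_neg m.succ_ne_zero,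
    sub_zero, pow_succ']
  gcongr
  exact norm_taylorCoeff_le_of_bounded hφ hM m.succ_ne_zero

/-- **Bohr's inequality.** -/
theorem majorant_le_of_bounded {φ : ℂ → ℂ} {M : ℝ} (hφ : DifferentiableOn ℂ φ unitDisk)
    (hM : ∀ z ∈ unitDisk, ‖φ z‖ ≤ M) {r : ℝ} (hr0 : 0 ≤ r) (hr : r ≤ 1 / 3) :
    majorant φ r ≤ M := by
  have hd : DifferentiableOn ℂ (fun z => φ z - φ 0) unitDisk := hφ.sub_const _
  have hr1 : r < 1 := by linarith
  have h0 := hM 0 zero_mem_unitDisk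
  have h1 := majorant_add_le hd (differentiableOn_const (φ 0)) hr0 hr1
  simp only [sub_add_cancel, majorant_const] at h1
  have h2 := majorant_sub_apply_zero_le hφ hM hr0 hr1
  -- This is where 1/3 enters: |φ(0)| + 2(M - |φ(0)|)·(1/2) = M.
  have h3 : r / (1 - r) ≤ 1 / 2 := by
    rw [div_le_iff₀ (by linarith)]
    linarith
  nlinarith

namespace IsSchwarz

variable {w : ℂ → ℂ}

theorem differentiableOn_dslope (hw : IsSchwarz w) :
    DifferentiableOn ℂ (dslope w 0) unitDisk :=
  (Complex.differentiableOn_dslope (unitDisk_mem_nhds zero_mem_unitDisk)).2 hw.analytic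

theorem apply_eq (hw : IsSchwarz w) (z : ℂ) : w z = z * dslope w 0 z := by
  have := sub_smul_dslope w 0 z
  rw [hw.map_zero, sub_zero, sub_zero, smul_eq_mul] at this
  exact this.symm

theorem norm_dslope_le_one (hw : IsSchwarz w) {z : ℂ} (hz : z ∈ unitDisk) :
    ‖dslope w 0 z‖ ≤ 1 := by
  have := Complex.norm_dslope_le_div_of_mapsTo_ball (c := 0) (R₁ := 1) (R₂ := 1) hw.analytic
    (fun z hz => by
      rw [hw.map_zero]
      exact Metric.ball_subset_closedBall (hw.mapsTo hz)) hz
  simpa using this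

theorem majorant_le (hw : IsSchwarz w) {r : ℝ} (hr0 : 0 ≤ r) (hr : r ≤ 1 / 3) :
    majorant w r ≤ r := by
  rw [funext hw.apply_eq, majorant_id_mul hw.differentiableOn_dslope hr0 (by linarith)]
  exact mul_le_of_le_one_right hr0
    (majorant_le_of_bounded hw.differentiableOn_dslope (fun z hz => hw.norm_dslope_le_one hz) hr0 hr)

theorem differentiableOn_comp (hw : IsSchwarz w) {f : ℂ → ℂ} (hf : DifferentiableOn ℂ f unitDisk) :
    DifferentiableOn ℂ (fun z => f (w z)) unitDisk :=
  hf.comp hw.analytic hw.mapsTo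

/-- Subordination does not increase the majorant on `[0, 1/3]`. -/
theorem majorant_comp_le (hw : IsSchwarz w) {f : ℂ → ℂ} (hf : DifferentiableOn ℂ f unitDisk)
    {r : ℝ} (hr0 : 0 < r) (hr : r ≤ 1 / 3) : majorant (fun z => f (w z)) r ≤ majorant f r := by
  have h := hw.majorant_le hr0.le hr
  exact (HarmonicBohr.majorant_comp_le hf hw.analytic hr0 (by linarith) (by linarith)).trans
    (majorant_mono f hf (majorant_nonneg _ hr0.le) h (by linarith))

end IsSchwarz

/-! ### The integral operator `F ↦ ∫₀¹ F(tz)/t dt` and the extremal function -/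

/-- The primitive of `F(z)/z` that vanishes at the origin. -/
noncomputable def logPrimitive (F : ℂ → ℂ) (z : ℂ) : ℂ := ∫ t in (0 : ℝ)..1, F ((t : ℂ) * z) / (t : ℂ)

theorem ofReal_mul_mem_unitDisk {t : ℝ} (h0 : 0 ≤ t) (h1 : t ≤ 1) {z : ℂ} (hz : z ∈ unitDisk) :
    (t : ℂ) * z ∈ unitDisk := by
  rw [mem_unitDisk] at *
  rw [norm_mul, Complex.norm_real, Real.norm_of_nonneg h0]
  exact (mul_le_of_le_one_left (norm_nonneg z) h1).trans_lt hz

theorem mul_dslope_zero {F : ℂ → ℂ} (hF0 : F 0 = 0) (z : ℂ) : z * dslope F 0 z = F z := by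
  have := sub_smul_dslope F 0 z
  rwa [hF0, sub_zero, sub_zero, smul_eq_mul] at this

theorem logPrimitive_zero {F : ℂ → ℂ} (hF0 : F 0 = 0) : logPrimitive F 0 = 0 := by
  simp [logPrimitive, hF0]

theorem hasDerivAt_logPrimitive {F : ℂ → ℂ} (hF : DifferentiableOn ℂ F unitDisk) (hF0 : F 0 = 0)
    {z : ℂ} (hz : z ∈ unitDisk) : HasDerivAt (logPrimitive F) (dslope F 0 z) z := by
  have hd : DifferentiableOn ℂ (dslope F 0) unitDisk :=
    (Complex.differentiableOn_dslope (unitDisk_mem_nhds zero_mem_unitDisk)).2 hF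
  -- Q is a primitive of F(z)/z on the disk; integrating along the radius to z identifies it with
  -- the defining integral.
  obtain ⟨Q, hQ0, hQ⟩ := (DifferentiableOn.isExactOn_ball hd).with_val_at 0 0
  have heq : ∀ z ∈ unitDisk, logPrimitive F z = Q z := by
    intro z hz
    have h1 : logPrimitive F z = ∫ t in (0 : ℝ)..1, z * dslope F 0 ((t : ℂ) * z) := by
      refine intervalIntegral.integral_congr_ae (Filter.Eventually.of_forall fun t ht => ?_)
      rw [Set.uIoc_of_le zero_le_one] at ht
      have ht0 : (t : ℂ) ≠ 0 := by exact_mod_cast ht.1.ne'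
      rw [div_eq_iff ht0, ← mul_dslope_zero hF0 ((t : ℂ) * z)]
      ring
    have hmem : ∀ t ∈ Set.uIcc (0 : ℝ) 1, (t : ℂ) * z ∈ unitDisk := fun t ht => by
      rw [Set.uIcc_of_le zero_le_one] at ht
      exact ofReal_mul_mem_unitDisk ht.1 ht.2 hz
    have hder : ∀ t ∈ Set.uIcc (0 : ℝ) 1,
        HasDerivAt (fun t : ℝ => Q ((t : ℂ) * z)) (z * dslope F 0 ((t : ℂ) * z)) t := fun t ht => by
      have h2 : HasDerivAt (fun t : ℝ => (t : ℂ) * z) (1 * z) t :=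
        (Complex.ofRealCLM.hasDerivAt (x := t)).mul_const z
      have h3 := (hQ _ (hmem t ht)).comp t h2
      rwa [one_mul, mul_comm] at h3
    rw [h1, intervalIntegral.integral_eq_sub_of_hasDerivAt hder]
    · simp [hQ0]
    · refine ContinuousOn.intervalIntegrable (continuousOn_const.mul ?_)
      exact hd.continuousOn.comp (by fun_prop) hmem
  exact (hQ z hz).congr_of_eventuallyEq
    (Filter.eventuallyEq_of_mem (unitDisk_mem_nhds hz) heq)

theorem differentiableOn_logPrimitive {F : ℂ → ℂ} (hF : DifferentiableOn ℂ F unitDisk)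
    (hF0 : F 0 = 0) : DifferentiableOn ℂ (logPrimitive F) unitDisk := fun _ hz =>
  (hasDerivAt_logPrimitive hF hF0 hz).differentiableAt.differentiableWithinAt

theorem taylorCoeff_logPrimitive {F : ℂ → ℂ} (hF : DifferentiableOn ℂ F unitDisk) (hF0 : F 0 = 0)
    (m : ℕ) : taylorCoeff (logPrimitive F) (m + 1) = taylorCoeff F (m + 1) / (m + 1) := by
  have hd : DifferentiableOn ℂ (dslope F 0) unitDisk :=
    (Complex.differentiableOn_dslope (unitDisk_mem_nhds zero_mem_unitDisk)).2 hF
  have h1 := taylorCoeff_deriv (f := logPrimitive F) m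
  rw [taylorCoeff_congr (g := dslope F 0) fun z hz => (hasDerivAt_logPrimitive hF hF0 hz).deriv,
    ← taylorCoeff_id_mul_succ hd, funext (mul_dslope_zero hF0)] at h1
  rw [h1, mul_div_cancel_left₀]
  exact_mod_cast m.succ_ne_zero

theorem extremal_eq (ψ : ℂ → ℂ) (z : ℂ) :
    extremal ψ z = z * Complex.exp (logPrimitive (fun z => ψ z - 1) z) := rfl

namespace IsMaMinda

variable {ψ : ℂ → ℂ}

theorem sub_one_zero (hψ : IsMaMinda ψ) : (fun z => ψ z - 1) 0 = 0 := by simp [hψ.map_zero]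

theorem hasDerivAt_extremal (hψ : IsMaMinda ψ) {z : ℂ} (hz : z ∈ unitDisk) :
    HasDerivAt (extremal ψ) (Complex.exp (logPrimitive (fun z => ψ z - 1) z) * ψ z) z := by
  have h := (hasDerivAt_id z).mul
    (hasDerivAt_logPrimitive hψ.analytic_sub_one hψ.sub_one_zero hz).cexp
  have h2 := mul_dslope_zero (F := fun z => ψ z - 1) hψ.sub_one_zero z
  refine h.congr_deriv ?_
  simp only [id] at h2 ⊢
  linear_combination Complex.exp (logPrimitive (fun z => ψ z - 1) z) * h2

theorem differentiableOn_extremal (hψ : IsMaMinda ψ) :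
    DifferentiableOn ℂ (extremal ψ) unitDisk := fun _ hz =>
  (hψ.hasDerivAt_extremal hz).differentiableAt.differentiableWithinAt

theorem deriv_extremal_zero (hψ : IsMaMinda ψ) : deriv (extremal ψ) 0 = 1 := by
  rw [(hψ.hasDerivAt_extremal zero_mem_unitDisk).deriv, hψ.map_zero,
    logPrimitive_zero hψ.sub_one_zero]
  simp

theorem extremal_zero (ψ : ℂ → ℂ) : extremal ψ 0 = 0 := by simp [extremal]

theorem isNormalized_extremal (hψ : IsMaMinda ψ) : IsNormalized (extremal ψ) :=
  ⟨hψ.differentiableOn_extremal, extremal_zero ψ, hψ.deriv_extremal_zero⟩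

theorem extremal_ne_zero (ψ : ℂ → ℂ) {z : ℂ} (hz : z ≠ 0) : extremal ψ z ≠ 0 :=
  mul_ne_zero hz (Complex.exp_ne_zero _)

theorem starlikeQuotient_extremal (hψ : IsMaMinda ψ) {z : ℂ} (hz : z ∈ unitDisk) :
    starlikeQuotient (extremal ψ) z = ψ z := by
  rw [starlikeQuotient]
  split_ifs with h
  · rw [h, hψ.map_zero]
  · rw [(hψ.hasDerivAt_extremal hz).deriv, div_eq_iff (extremal_ne_zero ψ h), extremal_eq]
    ring

theorem isMaMindaStarlike_extremal (hψ : IsMaMinda ψ) : IsMaMindaStarlike ψ (extremal ψ) :=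
  ⟨hψ.isNormalized_extremal, fun _ _ h => extremal_ne_zero ψ h, fun z => z,
    ⟨differentiableOn_id, rfl, fun _ h => h⟩, fun _ hz => hψ.starlikeQuotient_extremal hz⟩

theorem comp_sub_one_zero (hψ : IsMaMinda ψ) {w : ℂ → ℂ} (hw : IsSchwarz w) :
    (fun z => ψ (w z) - 1) 0 = 0 := by simp [hw.map_zero, hψ.map_zero]

theorem differentiableOn_comp_sub_one (hψ : IsMaMinda ψ) {w : ℂ → ℂ} (hw : IsSchwarz w) :
    DifferentiableOn ℂ (fun z => ψ (w z) - 1) unitDisk :=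
  (hw.differentiableOn_comp hψ.analytic).sub_const 1

end IsMaMinda

/-- Structure of the functions in a Ma–Minda class. -/
theorem IsMaMindaStarlike.exists_eq_mul_exp {ψ f : ℂ → ℂ} (hψ : IsMaMinda ψ)
    (hf : IsMaMindaStarlike ψ f) : ∃ w, IsSchwarz w ∧ ∀ z ∈ unitDisk,
      f z = z * Complex.exp (logPrimitive (fun z => ψ (w z) - 1) z) := by
  obtain ⟨w, hw, hfw⟩ := hf.subordinate
  refine ⟨w, hw, ?_⟩
  set G : ℂ → ℂ := fun z => ψ (w z) - 1 with hG
  have hG0 : G 0 = 0 := hψ.comp_sub_one_zero hw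
  have hGd : DifferentiableOn ℂ G unitDisk := hψ.differentiableOn_comp_sub_one hw
  have hfd := hf.normalized.analytic
  set k : ℂ → ℂ := fun z => f z * Complex.exp (-logPrimitive G z) with hk
  have hkd : ∀ z ∈ unitDisk, HasDerivAt k (deriv f z * Complex.exp (-logPrimitive G z) +
      f z * (Complex.exp (-logPrimitive G z) * -dslope G 0 z)) z := fun z hz =>
    (hfd.differentiableAt (unitDisk_mem_nhds hz)).hasDerivAt.mul
      (hasDerivAt_logPrimitive hGd hG0 hz).neg.cexp
  have hkD : DifferentiableOn ℂ k unitDisk := fun z hz =>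
    (hkd z hz).differentiableAt.differentiableWithinAt
  -- The quotient k = f e^{-P} satisfies Euler's equation z k' = k, whose only power series
  -- solutions are multiples of z; the normalization f'(0) = 1 gives k = z.
  have heuler : ∀ z ∈ unitDisk, z * deriv k z = k z := by
    intro z hz
    rcases eq_or_ne z 0 with rfl | h0
    · simp [hk, hf.normalized.map_zero]
    · have h1 := hfw z hz
      rw [starlikeQuotient, if_neg h0, div_eq_iff (hf.ne_zero z hz h0)] at h1
      have h2 : z * dslope G 0 z = ψ (w z) - 1 := mul_dslope_zero hG0 z
      rw [(hkd z hz).deriv, hk]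
      linear_combination Complex.exp (-logPrimitive G z) * h1 -
        f z * Complex.exp (-logPrimitive G z) * h2
  have hk'D : DifferentiableOn ℂ (deriv k) unitDisk := hkD.deriv isOpen_unitDisk
  have hcoef : ∀ m : ℕ, m ≠ 1 → taylorCoeff k m = 0 := by
    intro m hm
    rcases m with _ | m
    · simp [hk, hf.normalized.map_zero]
    · have h1 := taylorCoeff_id_mul_succ hk'D m
      rw [taylorCoeff_congr heuler, taylorCoeff_deriv] at h1
      have h2 : (m : ℂ) * taylorCoeff k (m + 1) = 0 := by linear_combination -h1
      exact (mul_eq_zero.1 h2).resolve_left (by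
        have : m ≠ 0 := fun h => hm (by rw [h])
        exact_mod_cast this)
  have hkone : taylorCoeff k 1 = 1 := by
    rw [taylorCoeff_one, (hkd 0 zero_mem_unitDisk).deriv, hf.normalized.deriv_zero,
      hf.normalized.map_zero, logPrimitive_zero hG0]
    simp
  intro z hz
  have h1 : k z = z := by
    rw [← (hasSum_taylorCoeff hkD hz).tsum_eq, tsum_eq_single 1 fun m hm => by
      rw [hcoef m hm, zero_mul], hkone, one_mul, pow_one]
  rw [hk] at h1
  nth_rewrite 2 [← h1]
  rw [mul_assoc, ← Complex.exp_add, neg_add_cancel, Complex.exp_zero, mul_one]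


/-! ### Growth of Ma–Minda starlike functions -/

namespace IsMaMinda

variable {ψ : ℂ → ℂ}

theorem re_growth (hψ : IsMaMinda ψ) {x y : ℝ} (hx : |x| < 1) (hy : |y| < 1) (hxy : x ≤ y) :
    (deriv ψ 0).re * ((y - x) * (1 - x * y) / ((1 + |x|) ^ 2 * (1 + |y|) ^ 2)) ≤
      (ψ y).re - (ψ x).re := by
  have h := typicallyReal_growth (F := fun z => ψ z - 1) hψ.analytic_sub_one hψ.sub_one_zero
    (fun z hz => hψ.im_mul_im_nonneg hz) hx hy hxy
  simpa [deriv_sub_const] using h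

theorem norm_taylorCoeff_le_two (hψ : IsMaMinda ψ) {n : ℕ} (hn : n ≠ 0) :
    ‖taylorCoeff ψ n‖ ≤ 2 := by
  simpa [hψ.map_zero] using
    norm_taylorCoeff_le_of_re_nonneg hψ.analytic (fun z hz => (hψ.re_pos z hz).le) hn

theorem taylorCoeff_sub_one_succ (hψ : IsMaMinda ψ) (n : ℕ) :
    taylorCoeff (fun z => ψ z - 1) (n + 1) = taylorCoeff ψ (n + 1) := by
  rw [taylorCoeff_sub hψ.analytic (differentiableOn_const _), taylorCoeff_const,
    if_neg n.succ_ne_zero, sub_zero]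

theorem norm_taylorCoeff_succ_le (hψ : IsMaMinda ψ) (n : ℕ) :
    ‖taylorCoeff ψ (n + 1)‖ ≤ (n + 1) * (deriv ψ 0).re := by
  have h := abs_re_taylorCoeff_le (F := fun z => ψ z - 1) hψ.analytic_sub_one
    (fun z hz => hψ.im_mul_im_nonneg hz) n
  rw [hψ.taylorCoeff_sub_one_succ, deriv_sub_const,
    Complex.abs_re_eq_norm.2 (hψ.im_taylorCoeff _)] at h
  exact h

theorem deriv_re_le_two (hψ : IsMaMinda ψ) : (deriv ψ 0).re ≤ 2 := by
  have h := hψ.norm_taylorCoeff_le_two one_ne_zero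
  rw [taylorCoeff_one] at h
  exact (Complex.re_le_norm _).trans h

theorem hasDerivAt_re_logPrimitive (hψ : IsMaMinda ψ) {x : ℝ} (hx : |x| < 1) :
    HasDerivAt (fun x : ℝ => (logPrimitive (fun z => ψ z - 1) x).re)
      (dslope (fun z => ψ z - 1) 0 x).re x := by
  have hz : (x : ℂ) ∈ unitDisk := by rwa [mem_unitDisk, Complex.norm_real]
  exact (hasDerivAt_logPrimitive hψ.analytic_sub_one hψ.sub_one_zero hz).real_of_complex

theorem re_dslope_pos (hψ : IsMaMinda ψ) {x : ℝ} (hx : |x| < 1) :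
    0 < (dslope (fun z => ψ z - 1) 0 x).re := by
  have hB := hψ.deriv_re_pos
  rcases eq_or_ne x 0 with rfl | h0
  · simpa [deriv_sub_const] using hB
  have h1 := congrArg Complex.re (mul_dslope_zero (F := fun z => ψ z - 1) hψ.sub_one_zero x)
  simp only [Complex.re_ofReal_mul, Complex.sub_re, Complex.one_re] at h1
  have hx0 : |(0 : ℝ)| < 1 := by simp
  have h1x : 0 < (1 + |(0:ℝ)|) ^ 2 * (1 + |x|) ^ 2 := by positivity
  rcases lt_or_gt_of_ne h0 with h | h
  · have h2 := hψ.re_growth hx hx0 h.le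
    have : 0 < (deriv ψ 0).re * ((0 - x) * (1 - x * 0) / ((1 + |x|) ^ 2 * (1 + |(0:ℝ)|) ^ 2)) := by
      have : 0 < 0 - x := by linarith
      rw [mul_zero, sub_zero, mul_one]
      positivity
    rw [Complex.ofReal_zero, hψ.map_zero, Complex.one_re] at h2
    nlinarith
  · have h2 := hψ.re_growth hx0 hx h.le
    have : 0 < (deriv ψ 0).re * ((x - 0) * (1 - 0 * x) / ((1 + |(0:ℝ)|) ^ 2 * (1 + |x|) ^ 2)) := by
      have : 0 < x - 0 := by linarith
      rw [zero_mul, sub_zero 1, mul_one]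
      positivity
    rw [Complex.ofReal_zero, hψ.map_zero, Complex.one_re] at h2
    nlinarith

theorem strictMonoOn_re_logPrimitive (hψ : IsMaMinda ψ) :
    StrictMonoOn (fun x : ℝ => (logPrimitive (fun z => ψ z - 1) x).re) (Set.Ioo (-1) 1) := by
  refine strictMonoOn_of_deriv_pos (convex_Ioo _ _) (fun x hx =>
    (hψ.hasDerivAt_re_logPrimitive (abs_lt.2 hx)).continuousAt.continuousWithinAt) fun x hx => ?_
  rw [interior_Ioo] at hx
  rw [(hψ.hasDerivAt_re_logPrimitive (abs_lt.2 hx)).deriv]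
  exact hψ.re_dslope_pos (abs_lt.2 hx)

theorem im_logPrimitive_ofReal (hψ : IsMaMinda ψ) {x : ℝ} (hx : |x| < 1) :
    (logPrimitive (fun z => ψ z - 1) x).im = 0 := by
  have h : logPrimitive (fun z => ψ z - 1) x =
      ∫ t in (0 : ℝ)..1, ((((ψ ((t : ℂ) * x)).re - 1) / t : ℝ) : ℂ) := by
    refine intervalIntegral.integral_congr_ae (Filter.Eventually.of_forall fun t ht => ?_)
    rw [Set.uIoc_of_le zero_le_one] at ht
    have h1 : |t * x| < 1 := by
      rw [abs_mul, abs_of_pos ht.1]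
      exact (mul_le_of_le_one_left (abs_nonneg x) ht.2).trans_lt hx
    have h2 : (((ψ ((t : ℂ) * x)).re : ℝ) : ℂ) = ψ ((t : ℂ) * x) := by
      have := hψ.im_apply_ofReal h1
      rw [Complex.ofReal_mul] at this
      exact Complex.ext rfl (by simp [this])
    push_cast
    rw [h2]
  rw [h, intervalIntegral.integral_ofReal, Complex.ofReal_im]

/-- The function `t ↦ -f₀(-t)` on `[0, 1)`. -/
theorem extremal_neg_ofReal (hψ : IsMaMinda ψ) {t : ℝ} (ht : |t| < 1) :
    extremal ψ (-(t : ℂ)) =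
      -((t * Real.exp (logPrimitive (fun z => ψ z - 1) ((-t : ℝ) : ℂ)).re : ℝ) : ℂ) := by
  have him := hψ.im_logPrimitive_ofReal (x := -t) (by rwa [abs_neg])
  have hre : logPrimitive (fun z => ψ z - 1) ((-t : ℝ) : ℂ) =
      (((logPrimitive (fun z => ψ z - 1) ((-t : ℝ) : ℂ)).re : ℝ) : ℂ) :=
    Complex.ext rfl (by rw [him, Complex.ofReal_im])
  rw [extremal_eq, ← Complex.ofReal_neg, hre]
  push_cast
  rw [neg_mul, Complex.ofReal_re]

/-- The function t ↦ -f₀(-t) has derivative e^{Q(-t)} ψ(-t) ≥ 0, and it is at most 1 because Q(-t) <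
0. The bound ℓ ≤ 1 is needed for the radius equation to have a root. -/
theorem exists_radial_limit (hψ : IsMaMinda ψ) : ∃ ℓ : ℝ, 0 < ℓ ∧ ℓ ≤ 1 ∧
    Filter.Tendsto (fun t : ℝ => t * Real.exp (logPrimitive (fun z => ψ z - 1) ((-t : ℝ) : ℂ)).re)
      (nhdsWithin 1 (Set.Iio 1)) (nhds ℓ) := by
  set m : ℝ → ℝ := fun t => t * Real.exp (logPrimitive (fun z => ψ z - 1) ((-t : ℝ) : ℂ)).re with hm
  have habs : ∀ t ∈ Set.Ioo (0 : ℝ) 1, |-t| < 1 := fun t ht => by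
    rw [abs_neg, abs_of_pos ht.1]
    exact ht.2
  have hder : ∀ t ∈ Set.Ioo (0 : ℝ) 1, HasDerivAt m
      (Real.exp (logPrimitive (fun z => ψ z - 1) ((-t : ℝ) : ℂ)).re * (ψ ((-t : ℝ) : ℂ)).re) t := by
    intro t ht
    have h1 := (hψ.hasDerivAt_re_logPrimitive (habs t ht)).comp t (hasDerivAt_neg t)
    have h2 := (hasDerivAt_id t).mul h1.exp
    refine h2.congr_deriv ?_
    have h3 := congrArg Complex.re
      (mul_dslope_zero (F := fun z => ψ z - 1) hψ.sub_one_zero ((-t : ℝ) : ℂ))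
    simp only [Complex.re_ofReal_mul, Complex.sub_re, Complex.one_re] at h3
    simp only [id, Function.comp_apply]
    linear_combination Real.exp (logPrimitive (fun z => ψ z - 1) ((-t : ℝ) : ℂ)).re * h3
  have hmono : MonotoneOn m (Set.Ioo 0 1) := by
    refine monotoneOn_of_deriv_nonneg (convex_Ioo _ _)
      (fun t ht => (hder t ht).continuousAt.continuousWithinAt)
      (fun t ht => ?_) fun t ht => ?_
    · rw [interior_Ioo] at ht
      exact (hder t ht).differentiableAt.differentiableWithinAt
    · rw [interior_Ioo] at ht
      rw [(hder t ht).deriv]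
      exact mul_nonneg (Real.exp_pos _).le
        (hψ.re_pos _ (by rw [mem_unitDisk, Complex.norm_real]; exact habs t ht)).le
  have hle : ∀ t ∈ Set.Ioo (0 : ℝ) 1, m t ≤ 1 := fun t ht => by
    have h1 := hψ.strictMonoOn_re_logPrimitive (a := -t) (b := 0)
      (abs_lt.1 (habs t ht)) (by norm_num) (by linarith [ht.1])
    simp only [Complex.ofReal_zero, 
      logPrimitive_zero (F := fun z => ψ z - 1) hψ.sub_one_zero, Complex.zero_re] at h1
    exact mul_le_one₀ ht.2.le (Real.exp_pos _).le (Real.exp_le_one_iff.2 h1.le)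
  have hne : (Set.Ioo (0 : ℝ) 1).Nonempty := ⟨1 / 2, by norm_num⟩
  have hbdd : BddAbove (m '' Set.Ioo 0 1) := ⟨1, by rintro _ ⟨t, ht, rfl⟩; exact hle t ht⟩
  refine ⟨sSup (m '' Set.Ioo 0 1), ?_, ?_, hmono.tendsto_nhdsWithin_Ioo_left hne hbdd⟩
  · have h1 : 0 < m (1 / 2) := by rw [hm]; positivity
    exact h1.trans_le (le_csSup hbdd ⟨1 / 2, by norm_num, rfl⟩)
  · exact csSup_le (hne.image m) (by rintro _ ⟨t, ht, rfl⟩; exact hle t ht)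

end IsMaMinda

/-- One-sided first-order condition: a minimum over a closed disk may lie on the bounding circle,
where only inward radial comparison is available. -/
theorem not_hasDerivAt_pos_of_forall_le {g : ℝ → ℝ} {g' : ℝ} (hg : HasDerivAt g g' 1)
    (h : ∀ s ∈ Set.Ioo (0 : ℝ) 1, g 1 ≤ g s) : g' ≤ 0 := by
  by_contra! hpos
  have h4 := (hasDerivAt_iff_tendsto_slope.1 hg).eventually (lt_mem_nhds hpos)
  have h5 : ∀ᶠ t : ℝ in nhdsWithin 1 (Set.Iio 1), 0 < slope g 1 t :=
    h4.filter_mono (nhdsWithin_mono _ fun t ht => ne_of_lt ht)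
  obtain ⟨t, ht, ht0⟩ := (h5.and (Ioo_mem_nhdsLT (zero_lt_one' ℝ))).exists
  rw [slope_def_field] at ht
  have h6 := h t ht0
  have : (g t - g 1) / (t - 1) ≤ 0 :=
    div_nonpos_of_nonneg_of_nonpos (by linarith) (by linarith [ht0.2])
  linarith

/-- The radial primitive `∫₀ʳ (1 - s)² / (1 + s)⁴ ds`. -/
noncomputable def koebeGap (r : ℝ) : ℝ := (1 - ((1 - r) / (1 + r)) ^ 3) / 6

theorem hasDerivAt_koebeGap {r : ℝ} (hr : 0 ≤ r) :
    HasDerivAt koebeGap ((1 - r) ^ 2 / (1 + r) ^ 4) r := by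
  have h0 : 1 + r ≠ 0 := by positivity
  have h1 := ((((hasDerivAt_id r).const_sub 1).fun_div ((hasDerivAt_id r).const_add 1) h0).fun_pow
    3).const_sub 1 |>.div_const 6
  refine h1.congr_deriv ?_
  simp only [id]
  push_cast
  norm_num
  field_simp
  ring

theorem continuous_norm_koebeGap : Continuous fun z : ℂ => koebeGap ‖z‖ := by
  unfold koebeGap
  refine ((continuous_const.sub ((Continuous.div (by fun_prop) (by fun_prop)
    fun z => ?_).pow 3))).div_const 6
  positivity

/-- Growth theorem: the real part of `log (f(z)/z)` for `f` in a Ma–Minda class. -/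
theorem IsMaMinda.re_logPrimitive_comp_ge {ψ w : ℂ → ℂ} (hψ : IsMaMinda ψ) (hw : IsSchwarz w)
    {z : ℂ} (hz : z ∈ unitDisk) :
    (logPrimitive (fun z => ψ z - 1) ((-‖z‖ : ℝ) : ℂ)).re +
      (deriv ψ 0).re * (1 - ‖dslope w 0 0‖) * koebeGap ‖z‖ ≤
      (logPrimitive (fun z => ψ (w z) - 1) z).re := by
  set P := logPrimitive (fun z => ψ (w z) - 1) with hP
  set Q := logPrimitive (fun z => ψ z - 1) with hQ
  set B := (deriv ψ 0).re with hB
  set a := ‖dslope w 0 0‖ with ha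
  have ha1 : a ≤ 1 := hw.norm_dslope_le_one zero_mem_unitDisk
  have hB0 : 0 < B := hψ.deriv_re_pos
  have hPd : ∀ z ∈ unitDisk, HasDerivAt P (dslope (fun z => ψ (w z) - 1) 0 z) z := fun z hz =>
    hasDerivAt_logPrimitive (hψ.differentiableOn_comp_sub_one hw) (hψ.comp_sub_one_zero hw) hz
  have hPz : ∀ z, z * dslope (fun z => ψ (w z) - 1) 0 z = ψ (w z) - 1 :=
    mul_dslope_zero (F := fun z => ψ (w z) - 1) (hψ.comp_sub_one_zero hw)
  refine le_of_forall_pos_le_add fun ε hε => ?_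
  -- The term ε|z| makes the radial inequality at a non-zero minimum point strictly contradictory; ε
  -- is arbitrary, so it costs nothing.
  set u : ℂ → ℝ := fun z => (P z).re - (Q ((-‖z‖ : ℝ) : ℂ)).re - B * (1 - a) * koebeGap ‖z‖ +
    ε * ‖z‖ with hu
  have hz1 := mem_unitDisk.1 hz
  have hball : Metric.closedBall (0 : ℂ) ‖z‖ ⊆ unitDisk := Metric.closedBall_subset_ball hz1
  have hucont : ContinuousOn u (Metric.closedBall 0 ‖z‖) := by
    have h1 : ContinuousOn (fun z => (P z).re) (Metric.closedBall 0 ‖z‖) := fun y hy =>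
      (Complex.continuous_re.continuousAt.comp (hPd y (hball hy)).continuousAt).continuousWithinAt
    have h2 : ContinuousOn (fun z : ℂ => (Q ((-‖z‖ : ℝ) : ℂ)).re) (Metric.closedBall 0 ‖z‖) := by
      intro y hy
      have h3 := (hψ.hasDerivAt_re_logPrimitive (x := -‖y‖) (by
        rw [abs_neg, abs_norm]; exact mem_unitDisk.1 (hball hy))).continuousAt
      have h4 : ContinuousAt (fun z : ℂ => -‖z‖) y := by fun_prop
      exact (ContinuousAt.comp (f := fun z : ℂ => -‖z‖) h3 h4).continuousWithinAt
    exact ((h1.sub h2).sub (continuousOn_const.mul continuous_norm_koebeGap.continuousOn)).add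
      (continuousOn_const.mul continuous_norm.continuousOn)
  obtain ⟨z₀, hz₀, hmin⟩ := (isCompact_closedBall (0 : ℂ) ‖z‖).exists_isMinOn
    ⟨0, Metric.mem_closedBall_self (norm_nonneg z)⟩ hucont
  have hmin' : ∀ y : ℂ, ‖y‖ ≤ ‖z‖ → u z₀ ≤ u y := fun y hy =>
    hmin (mem_closedBall_zero_iff.2 hy)
  rw [mem_closedBall_zero_iff] at hz₀
  have hz₀D : z₀ ∈ unitDisk := mem_unitDisk.2 (hz₀.trans_lt hz1)
  have hu0 : 0 ≤ u z₀ := by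
    rcases eq_or_ne z₀ 0 with h0 | h0
    · rw [h0, hu]
      simp [hP, hQ, logPrimitive_zero (F := fun z => ψ (w z) - 1) (hψ.comp_sub_one_zero hw),
        logPrimitive_zero (F := fun z => ψ z - 1) hψ.sub_one_zero,
        koebeGap]
    exfalso
    set ρ := ‖z₀‖ with hρ
    have hρ0 : 0 < ρ := norm_pos_iff.2 h0
    have hρ1 : ρ < 1 := mem_unitDisk.1 hz₀D
    have hρa : |-ρ| < 1 := by rwa [abs_neg, abs_of_pos hρ0]
    -- the angular derivative vanishes
    have hang : (ψ (w z₀)).im = 0 := by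
      have h1 : HasDerivAt (fun θ : ℝ => z₀ * Complex.exp ((θ : ℂ) * Complex.I))
          (z₀ * Complex.I) 0 := by
        have h2 : HasDerivAt (fun θ : ℝ => (θ : ℂ) * Complex.I) (1 * Complex.I) 0 :=
          (Complex.ofRealCLM.hasDerivAt (x := 0)).mul_const Complex.I
        refine (h2.cexp.const_mul z₀).congr_deriv ?_
        simp
      have h3 : HasDerivAt P (dslope (fun z => ψ (w z) - 1) 0 z₀)
          (z₀ * Complex.exp (((0 : ℝ) : ℂ) * Complex.I)) := by simpa using hPd z₀ hz₀D
      have h4 := Complex.reCLM.hasFDerivAt.comp_hasDerivAt (0 : ℝ) (h3.comp (0 : ℝ) h1)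
      have h5 : IsLocalMin (Complex.reCLM ∘ P ∘ fun θ : ℝ => z₀ * Complex.exp ((θ : ℂ) * Complex.I))
          0 := by
        refine Filter.Eventually.of_forall fun θ => ?_
        have hn : ‖z₀ * Complex.exp ((θ : ℂ) * Complex.I)‖ = ρ := by
          rw [norm_mul, Complex.norm_exp_ofReal_mul_I, mul_one]
        have h6 := hmin' _ (hn.trans_le hz₀)
        simp only [hu, hn] at h6
        simp only [Function.comp_apply, Complex.reCLM_apply, Complex.ofReal_zero, zero_mul,
          Complex.exp_zero, mul_one]
        linarith
      have h7 := h5.hasDerivAt_eq_zero h4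
      rw [mul_comm, mul_right_comm, hPz, Complex.reCLM_apply] at h7
      simpa using h7
    have hwim := hψ.im_eq_zero_of_apply (hw.mapsTo hz₀D) hang
    set x := (w z₀).re with hx
    have hwx : w z₀ = (x : ℂ) := Complex.ext rfl (by simp [hwim])
    have hxn : |x| = ρ * ‖dslope w 0 z₀‖ := by
      rw [← Real.norm_eq_abs, ← Complex.norm_real, ← hwx, hw.apply_eq, norm_mul]
    have hφ := norm_le_of_bounded hw.differentiableOn_dslope
      (fun z hz => hw.norm_dslope_le_one hz) hz₀D
    have hφ1 := hw.norm_dslope_le_one hz₀D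
    rw [← hρ, ← ha] at hφ
    have hxρ : |x| ≤ ρ := by
      rw [hxn]
      exact mul_le_of_le_one_right hρ0.le hφ1
    -- How far w(z₀) stays from -ρ: the Harnack-type bound on φ(z) = w(z)/z, with a = |φ(0)|, bounds
    -- ρ - |x| from below.
    have hgap : ρ * (1 - a) * (1 - ρ) / (1 + ρ) ≤ x - -ρ := by
      have h1 : ρ * ((1 - ρ) / (1 + ρ) * (1 - a)) ≤ ρ - |x| := by
        rw [hxn]
        nlinarith
      have h2 := neg_abs_le x
      calc _ = ρ * ((1 - ρ) / (1 + ρ) * (1 - a)) := by ring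
        _ ≤ _ := by linarith
    have hgrow := hψ.re_growth hρa (hxρ.trans_lt hρ1) (by linarith [neg_abs_le x] : -ρ ≤ x)
    have hlow : B * (1 - a) * (ρ * ((1 - ρ) ^ 2 / (1 + ρ) ^ 4)) ≤
        B * ((x - -ρ) * (1 - -ρ * x) / ((1 + |-ρ|) ^ 2 * (1 + |x|) ^ 2)) := by
      rw [abs_neg, abs_of_pos hρ0]
      have h1 : 1 - ρ ^ 2 ≤ 1 - -ρ * x := by nlinarith [neg_abs_le x]
      have h1' : 0 ≤ 1 - ρ ^ 2 := by nlinarith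
      have h2 : 0 ≤ ρ * (1 - a) * (1 - ρ) / (1 + ρ) :=
        div_nonneg (mul_nonneg (mul_nonneg hρ0.le (by linarith)) (by linarith)) (by linarith)
      calc B * (1 - a) * (ρ * ((1 - ρ) ^ 2 / (1 + ρ) ^ 4))
          = B * ((ρ * (1 - a) * (1 - ρ) / (1 + ρ)) * (1 - ρ ^ 2) /
              ((1 + ρ) ^ 2 * (1 + ρ) ^ 2)) := by field_simp; ring
        _ ≤ _ := by
          have h3 : 0 ≤ x - -ρ := h2.trans hgap
          have h4 : 0 ≤ (x - -ρ) * (1 - -ρ * x) := mul_nonneg h3 (h1'.trans h1)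
          gcongr
    -- the radial derivative is nonpositive
    have hrad : (ψ (w z₀)).re - (ψ ((-ρ : ℝ) : ℂ)).re -
        B * (1 - a) * (ρ * ((1 - ρ) ^ 2 / (1 + ρ) ^ 4)) + ε * ρ ≤ 0 := by
      have h1 : HasDerivAt (fun s : ℝ => (s : ℂ) * z₀) (1 * z₀) 1 :=
        (Complex.ofRealCLM.hasDerivAt (x := 1)).mul_const z₀
      have h3 : HasDerivAt P (dslope (fun z => ψ (w z) - 1) 0 z₀) (((1 : ℝ) : ℂ) * z₀) := by
        simpa using hPd z₀ hz₀D
      have h4 := Complex.reCLM.hasFDerivAt.comp_hasDerivAt (1 : ℝ) (h3.comp (1 : ℝ) h1)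
      have h5 : HasDerivAt (fun s : ℝ => -(s * ρ)) (-(1 * ρ)) 1 :=
        ((hasDerivAt_id (1 : ℝ)).mul_const ρ).neg
      have h6 : HasDerivAt (fun x : ℝ => (Q x).re) (dslope (fun z => ψ z - 1) 0 ((-ρ : ℝ) : ℂ)).re
          (-(1 * ρ)) := by
        rw [one_mul]
        exact hψ.hasDerivAt_re_logPrimitive hρa
      have h7 := HasDerivAt.comp (1 : ℝ) h6 h5
      have h8 : HasDerivAt (fun s : ℝ => s * ρ) (1 * ρ) 1 := (hasDerivAt_id (1 : ℝ)).mul_const ρ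
      have h9 : HasDerivAt koebeGap ((1 - ρ) ^ 2 / (1 + ρ) ^ 4) (1 * ρ) := by
        rw [one_mul]
        exact hasDerivAt_koebeGap hρ0.le
      have h10 := ((h4.sub h7).sub ((HasDerivAt.comp (1 : ℝ) h9 h8).const_mul (B * (1 - a)))).add
        (h8.const_mul ε)
      have h11 := not_hasDerivAt_pos_of_forall_le h10 fun s hs => by
        have hn : ‖(s : ℂ) * z₀‖ = s * ρ := by
          rw [norm_mul, Complex.norm_real, Real.norm_of_nonneg hs.1.le]
        have h12 := hmin' ((s : ℂ) * z₀) (by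
          rw [hn]
          exact (mul_le_of_le_one_left hρ0.le hs.2.le).trans hz₀)
        simp only [hu, hn] at h12
        simpa using h12
      have h13 := congrArg Complex.re
        (mul_dslope_zero (F := fun z => ψ z - 1) hψ.sub_one_zero ((-ρ : ℝ) : ℂ))
      simp only [Complex.re_ofReal_mul, Complex.sub_re, Complex.one_re] at h13
      have h14 : (dslope (fun z => ψ (w z) - 1) 0 z₀ * (1 * z₀)).re = (ψ (w z₀)).re - 1 := by
        rw [one_mul, mul_comm, hPz, Complex.sub_re, Complex.one_re]
      rw [Complex.reCLM_apply, h14] at h11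
      linarith
    -- The lower growth bound for ψ(x) - ψ(-ρ) absorbs the whole `koebeGap` term, leaving ερ ≤ 0.
    rw [hwx] at hrad
    nlinarith [mul_pos hε hρ0]
  have h1 := hu0.trans (hmin' z le_rfl)
  simp only [hu] at h1
  nlinarith


/-! ### Univalence and the distance to the boundary -/

/-- A holomorphic function whose derivative has positive real part on a convex set is injective. -/
theorem injOn_of_re_deriv_pos {g g' : ℂ → ℂ} {s : Set ℂ} (hs : Convex ℝ s)
    (hg : ∀ z ∈ s, HasDerivAt g (g' z) z) (hpos : ∀ z ∈ s, 0 < (g' z).re) : Set.InjOn g s := by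
  intro a ha b hb hab
  by_contra hne
  have hab0 : 0 < ‖b - a‖ := norm_pos_iff.2 (sub_ne_zero.2 (Ne.symm hne))
  have hmem : ∀ t ∈ Set.Icc (0 : ℝ) 1, a + (t : ℂ) * (b - a) ∈ s := fun t ht => by
    simpa [Complex.real_smul] using hs.add_smul_sub_mem ha hb ht
  have hder : ∀ t ∈ Set.Icc (0 : ℝ) 1,
      HasDerivAt (fun t : ℝ => (g (a + (t : ℂ) * (b - a)) * starRingEnd ℂ (b - a)).re)
        ((g' (a + (t : ℂ) * (b - a))).re * ‖b - a‖ ^ 2) t := fun t ht => by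
    have h1 : HasDerivAt (fun t : ℝ => a + (t : ℂ) * (b - a)) (1 * (b - a)) t :=
      ((Complex.ofRealCLM.hasDerivAt (x := t)).mul_const (b - a)).const_add a
    have h2 := ((hg _ (hmem t ht)).comp t h1).mul_const (starRingEnd ℂ (b - a))
    refine (Complex.reCLM.hasFDerivAt.comp_hasDerivAt t h2).congr_deriv ?_
    rw [Complex.reCLM_apply, one_mul, mul_assoc, Complex.mul_conj', ← Complex.ofReal_pow,
      Complex.re_mul_ofReal]
  have hmono := strictMonoOn_of_deriv_pos (convex_Icc (0 : ℝ) 1)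
    (fun t ht => (hder t ht).continuousAt.continuousWithinAt) fun t ht => by
      have ht' := interior_subset ht
      rw [(hder t ht').deriv]
      have := hpos _ (hmem t ht')
      positivity
  have h := hmono (Set.left_mem_Icc.2 zero_le_one) (Set.right_mem_Icc.2 zero_le_one) zero_lt_one
  simp [hab] at h

/-- Starlike functions are univalent. -/
theorem injOn_mul_exp_logPrimitive {F : ℂ → ℂ} (hF : DifferentiableOn ℂ F unitDisk)
    (hF0 : F 0 = 0) (hre : ∀ z ∈ unitDisk, 0 < 1 + (F z).re) :
    Set.InjOn (fun z => z * Complex.exp (logPrimitive F z)) unitDisk := by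
  have hexp : ∀ ζ : ℂ, ζ.re < 0 → Complex.exp ζ ∈ unitDisk := fun ζ hζ => by
    rw [mem_unitDisk, Complex.norm_exp]
    exact Real.exp_lt_one_iff.2 hζ
  -- In the coordinate ζ = log z, the function log f is ζ + P(e^ζ), with derivative 1 + F(e^ζ) of
  -- positive real part on the convex left half-plane.
  have hinj : Set.InjOn (fun ζ => ζ + logPrimitive F (Complex.exp ζ)) {ζ : ℂ | ζ.re < 0} := by
    refine injOn_of_re_deriv_pos (convex_halfSpace_re_lt 0)
      (fun ζ hζ => (hasDerivAt_id ζ).add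
        ((hasDerivAt_logPrimitive hF hF0 (hexp ζ hζ)).comp ζ (Complex.hasDerivAt_exp ζ)))
      fun ζ hζ => ?_
    rw [mul_comm, mul_dslope_zero hF0, Complex.add_re, Complex.one_re]
    exact hre _ (hexp ζ hζ)
  intro z₁ hz₁ z₂ hz₂ h
  simp only at h
  rcases eq_or_ne z₁ 0 with h1 | h1
  · rw [h1, zero_mul, eq_comm, mul_eq_zero] at h
    rw [h1, h.resolve_right (Complex.exp_ne_zero _)]
  rcases eq_or_ne z₂ 0 with h2 | h2
  · rw [h2, zero_mul, mul_eq_zero] at h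
    exact absurd (h.resolve_right (Complex.exp_ne_zero _)) h1
  have hlog : ∀ z ∈ unitDisk, z ≠ 0 → (Complex.log z).re < 0 := fun z hz h0 => by
    rw [Complex.log_re]
    exact Real.log_neg (norm_pos_iff.2 h0) (mem_unitDisk.1 hz)
  have hE : Complex.exp (Complex.log z₁ + logPrimitive F z₁) =
      Complex.exp (Complex.log z₂ + logPrimitive F z₂) := by
    rw [Complex.exp_add, Complex.exp_add, Complex.exp_log h1, Complex.exp_log h2, h]
  obtain ⟨n, hn⟩ := Complex.exp_eq_exp_iff_exists_int.1 hE
  -- The branch ambiguity 2πin is absorbed into another logarithm of z₂, which lies in the same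
  -- half-plane.
  have hE2 : Complex.exp (Complex.log z₂ + n * (2 * Real.pi * Complex.I)) = z₂ := by
    rw [Complex.exp_add, Complex.exp_int_mul_two_pi_mul_I, mul_one, Complex.exp_log h2]
  have hre2 : (Complex.log z₂ + n * (2 * Real.pi * Complex.I)).re < 0 := by
    have : ((n : ℂ) * (2 * Real.pi * Complex.I)).re = 0 := by simp
    rw [Complex.add_re, this, add_zero]
    exact hlog z₂ hz₂ h2
  have h3 := hinj (hlog z₁ hz₁ h1) hre2 (by
    simp only [hE2, Complex.exp_log h1]
    rw [hn]
    ring)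
  rw [← Complex.exp_log h1, h3, hE2]

/-- If f(𝔻) were all of ℂ, its inverse would be a bounded entire function, contradicting Liouville.
Non-emptiness matters because `Metric.infDist` to the empty set is 0. -/
theorem frontier_image_nonempty {f : ℂ → ℂ} (hf : DifferentiableOn ℂ f unitDisk)
    (hinj : Set.InjOn f unitDisk) : (frontier (f '' unitDisk)).Nonempty := by
  by_contra hne
  rw [Set.not_nonempty_iff_eq_empty, ← isClopen_iff_frontier_eq_empty] at hne
  have huniv := hne.eq_univ ⟨f 0, 0, zero_mem_unitDisk, rfl⟩
  obtain ⟨g, hg, hgf⟩ := exists_holomorphic_inverse hf hinj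
  rw [huniv, differentiableOn_univ] at hg
  have hb : Bornology.IsBounded (Set.range g) := by
    refine (Metric.isBounded_ball (x := (0 : ℂ)) (r := 1)).subset ?_
    rintro _ ⟨v, rfl⟩
    obtain ⟨z, hz, rfl⟩ := huniv.symm ▸ Set.mem_univ v
    rw [hgf z hz]
    exact hz
  have hhalf : (1 / 2 : ℂ) ∈ unitDisk := by
    rw [mem_unitDisk]
    norm_num
  have h := hg.apply_eq_apply_of_bounded hb (f 0) (f (1 / 2))
  rw [hgf 0 zero_mem_unitDisk, hgf _ hhalf] at h
  norm_num at h

/-- For m < d and t near 1, f(𝔻) lies in the closed set f({|z| ≤ t}) ∪ {|u| ≥ m}. A frontier point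
is outside the open image, so it falls in the second piece. -/
theorem le_norm_of_mem_frontier {f : ℂ → ℂ} {μ : ℝ → ℝ} {d : ℝ} (hf : ContinuousOn f unitDisk)
    (hopen : IsOpen (f '' unitDisk)) (hμ : Filter.Tendsto μ (nhdsWithin 1 (Set.Iio 1)) (nhds d))
    (h : ∀ z ∈ unitDisk, μ ‖z‖ ≤ ‖f z‖) {v : ℂ} (hv : v ∈ frontier (f '' unitDisk)) :
    d ≤ ‖v‖ := by
  by_contra! hlt
  rw [hopen.frontier_eq] at hv
  obtain ⟨m, hm1, hm2⟩ := exists_between hlt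
  obtain ⟨t, ht, htm⟩ := (mem_nhdsLT_iff_exists_Ioo_subset' (zero_lt_one' ℝ)).1
    (hμ.eventually (lt_mem_nhds hm2))
  have hcpt : IsCompact (f '' Metric.closedBall 0 t) :=
    (isCompact_closedBall _ _).image_of_continuousOn
      (hf.mono (Metric.closedBall_subset_ball ht))
  have hsub : f '' unitDisk ⊆ f '' Metric.closedBall 0 t ∪ {u : ℂ | m ≤ ‖u‖} := by
    rintro _ ⟨z, hz, rfl⟩
    rcases le_or_gt ‖z‖ t with hzt | hzt
    · exact Or.inl ⟨z, mem_closedBall_zero_iff.2 hzt, rfl⟩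
    · exact Or.inr ((htm ⟨hzt, mem_unitDisk.1 hz⟩ : m < μ ‖z‖).le.trans (h z hz))
  have hcl := closure_minimal hsub
    (hcpt.isClosed.union (isClosed_le continuous_const continuous_norm)) hv.1
  rcases hcl with hc | hc
  · exact hv.2 (Set.image_mono (Metric.closedBall_subset_ball ht) hc)
  · exact absurd (Set.mem_ofPred.1 hc) (not_le.2 hm1)

namespace IsMaMinda

variable {ψ : ℂ → ℂ}

theorem injOn_mul_exp (hψ : IsMaMinda ψ) {w : ℂ → ℂ} (hw : IsSchwarz w) {f : ℂ → ℂ}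
    (h : ∀ z ∈ unitDisk, f z = z * Complex.exp (logPrimitive (fun z => ψ (w z) - 1) z)) :
    Set.InjOn f unitDisk := by
  refine (injOn_mul_exp_logPrimitive (hψ.differentiableOn_comp_sub_one hw)
    (hψ.comp_sub_one_zero hw) fun z hz => ?_).congr fun z hz => (h z hz).symm
  simpa using hψ.re_pos _ (hw.mapsTo hz)

theorem isOpen_image_of_eq_mul_exp (hψ : IsMaMinda ψ) {w : ℂ → ℂ} (hw : IsSchwarz w) {f : ℂ → ℂ}
    (hf : DifferentiableOn ℂ f unitDisk)
    (h : ∀ z ∈ unitDisk, f z = z * Complex.exp (logPrimitive (fun z => ψ (w z) - 1) z)) :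
    IsOpen (f '' unitDisk) :=
  isOpen_image_of_injOn hf (hψ.injOn_mul_exp hw h) subset_rfl isOpen_unitDisk

/-- The growth theorem as |z| → 1; the 6 comes from `koebeGap 1 = 1/6`. -/
theorem mul_exp_le_boundaryDist (hψ : IsMaMinda ψ) {ℓ : ℝ}
    (hℓ : Filter.Tendsto
      (fun t : ℝ => t * Real.exp (logPrimitive (fun z => ψ z - 1) ((-t : ℝ) : ℂ)).re)
      (nhdsWithin 1 (Set.Iio 1)) (nhds ℓ))
    {f w : ℂ → ℂ} (hf : IsNormalized f) (hw : IsSchwarz w)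
    (h : ∀ z ∈ unitDisk, f z = z * Complex.exp (logPrimitive (fun z => ψ (w z) - 1) z)) :
    ℓ * Real.exp ((deriv ψ 0).re * (1 - ‖dslope w 0 0‖) / 6) ≤ boundaryDist f := by
  rw [boundaryDist, hf.map_zero]
  refine (Metric.le_infDist (frontier_image_nonempty hf.analytic (hψ.injOn_mul_exp hw h))).2
    fun v hv => ?_
  rw [dist_zero_left]
  set c := (deriv ψ 0).re * (1 - ‖dslope w 0 0‖)
  have hgap : Filter.Tendsto (fun t => Real.exp (c * koebeGap t)) (nhdsWithin 1 (Set.Iio 1))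
      (nhds (Real.exp (c / 6))) := by
    have h1 := (hasDerivAt_koebeGap zero_le_one).continuousAt.tendsto
    have h2 : koebeGap 1 = 1 / 6 := by simp [koebeGap]
    rw [h2] at h1
    have h3 := (Real.continuous_exp.tendsto _).comp (h1.const_mul c)
    rw [mul_one_div] at h3
    exact h3.mono_left nhdsWithin_le_nhds
  refine le_norm_of_mem_frontier hf.analytic.continuousOn
    (hψ.isOpen_image_of_eq_mul_exp hw hf.analytic h) (hℓ.mul hgap) (fun z hz => ?_) hv
  rw [h z hz, norm_mul, Complex.norm_exp, mul_assoc, ← Real.exp_add]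
  gcongr
  exact hψ.re_logPrimitive_comp_ge hw hz

theorem isSchwarz_id : IsSchwarz fun z => z :=
  ⟨differentiableOn_id, rfl, Set.mapsTo_id _⟩

theorem injOn_extremal (hψ : IsMaMinda ψ) : Set.InjOn (extremal ψ) unitDisk :=
  hψ.injOn_mul_exp isSchwarz_id fun z _ => extremal_eq ψ z

theorem tendsto_extremal_neg (hψ : IsMaMinda ψ) {ℓ : ℝ}
    (hℓ : Filter.Tendsto
      (fun t : ℝ => t * Real.exp (logPrimitive (fun z => ψ z - 1) ((-t : ℝ) : ℂ)).re)
      (nhdsWithin 1 (Set.Iio 1)) (nhds ℓ)) :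
    Filter.Tendsto (fun t : ℝ => extremal ψ (-(t : ℂ))) (nhdsWithin 1 (Set.Iio 1))
      (nhds (-(ℓ : ℂ))) := by
  refine (((Complex.continuous_ofReal.tendsto ℓ).comp hℓ).neg).congr' ?_
  filter_upwards [Ioo_mem_nhdsLT (zero_lt_one' ℝ)] with t ht
  rw [hψ.extremal_neg_ofReal (by rw [abs_of_pos ht.1]; exact ht.2)]
  rfl

/-- The lower bound is the general one with w = id, whose exponential factor is 1. For the upper
bound, -ℓ is a limit of f₀(-t); were it attained at z in the disk, continuity of the inverse would
force z = -1. -/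
theorem boundaryDist_extremal (hψ : IsMaMinda ψ) {ℓ : ℝ} (hℓ0 : 0 < ℓ)
    (hℓ : Filter.Tendsto
      (fun t : ℝ => t * Real.exp (logPrimitive (fun z => ψ z - 1) ((-t : ℝ) : ℂ)).re)
      (nhdsWithin 1 (Set.Iio 1)) (nhds ℓ)) : boundaryDist (extremal ψ) = ℓ := by
  have hf := hψ.isNormalized_extremal
  refine le_antisymm ?_ ?_
  · have hopen := hψ.isOpen_image_of_eq_mul_exp isSchwarz_id hf.analytic
      fun z _ => extremal_eq ψ z
    have hlim := hψ.tendsto_extremal_neg hℓ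
    have hD : ∀ᶠ t : ℝ in nhdsWithin 1 (Set.Iio 1), -(t : ℂ) ∈ unitDisk := by
      filter_upwards [Ioo_mem_nhdsLT (zero_lt_one' ℝ)] with t ht
      rw [mem_unitDisk, norm_neg, Complex.norm_real, Real.norm_of_nonneg ht.1.le]
      exact ht.2
    have hmem : -(ℓ : ℂ) ∈ frontier (extremal ψ '' unitDisk) := by
      rw [hopen.frontier_eq]
      refine ⟨mem_closure_of_tendsto hlim (hD.mono fun t ht => ⟨_, ht, rfl⟩), ?_⟩
      rintro ⟨z, hz, hzℓ⟩
      obtain ⟨g, hg, hgf⟩ := exists_holomorphic_inverse hf.analytic hψ.injOn_extremal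
      have hgc : ContinuousAt g (-(ℓ : ℂ)) :=
        hg.continuousOn.continuousAt (hopen.mem_nhds ⟨z, hz, hzℓ⟩)
      have h1 : Filter.Tendsto (fun t : ℝ => -(t : ℂ)) (nhdsWithin 1 (Set.Iio 1))
          (nhds (g (-(ℓ : ℂ)))) :=
        (hgc.tendsto.comp hlim).congr' (hD.mono fun t ht => hgf _ ht)
      have h2 : Filter.Tendsto (fun t : ℝ => -(t : ℂ)) (nhdsWithin 1 (Set.Iio 1))
          (nhds (-((1 : ℝ) : ℂ))) :=
        ((Complex.continuous_ofReal.neg).tendsto 1).mono_left nhdsWithin_le_nhds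
      have h3 := tendsto_nhds_unique h1 h2
      rw [← hzℓ, hgf z hz] at h3
      rw [h3, mem_unitDisk] at hz
      simp at hz
    refine (Metric.infDist_le_dist_of_mem hmem).trans ?_
    rw [hf.map_zero, dist_zero_left, norm_neg, Complex.norm_real, Real.norm_of_nonneg hℓ0.le]
  · have h := hψ.mul_exp_le_boundaryDist hℓ hf isSchwarz_id fun z _ => extremal_eq ψ z
    have h1 : dslope (fun z : ℂ => z) 0 0 = 1 := by simp [dslope_same]
    simpa [h1] using h

end IsMaMinda


/-! ### Majorant estimates for Ma–Minda starlike functions -/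

theorem eqOn_of_taylorCoeff_eq {f g : ℂ → ℂ} (hf : DifferentiableOn ℂ f unitDisk)
    (hg : DifferentiableOn ℂ g unitDisk) (h : ∀ m, taylorCoeff f m = taylorCoeff g m) :
    Set.EqOn f g unitDisk := fun z hz => by
  have h1 := hasSum_taylorCoeff hf hz
  simp only [h] at h1
  exact h1.unique (hasSum_taylorCoeff hg hz)

theorem majorant_le_div_mul {f : ℂ → ℂ} (hf : DifferentiableOn ℂ f unitDisk) (h0 : f 0 = 0)
    {r R : ℝ} (hr0 : 0 ≤ r) (hrR : r ≤ R) (hR0 : 0 < R) (hR : R < 1) :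
    majorant f r ≤ r / R * majorant f R := by
  rw [majorant, majorant, ← tsum_mul_left]
  refine (summable_majorant hf hr0 (hrR.trans_lt hR)).tsum_le_tsum (fun m => ?_)
    ((summable_majorant hf hR0.le hR).mul_left _)
  rcases m with _ | m
  · simp [h0]
  · have h1 : r ^ m ≤ R ^ m := by gcongr
    calc ‖taylorCoeff f (m + 1)‖ * r ^ (m + 1) = ‖taylorCoeff f (m + 1)‖ * (r * r ^ m) := by ring
      _ ≤ ‖taylorCoeff f (m + 1)‖ * (r * R ^ m) := by gcongr
      _ = _ := by
        field_simp
        ring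

/-- Formally the left side is ∫₀ᴿ D̂(s)/s ds. Comparing derivatives of E and of partial sums
replaces this integral by any E with D̂(s) ≤ s E'(s). -/
theorem majorant_logPrimitive_le {D : ℂ → ℂ} {E E' : ℝ → ℝ} {R : ℝ}
    (hD : DifferentiableOn ℂ D unitDisk) (hD0 : D 0 = 0) (hR0 : 0 ≤ R) (hR : R < 1)
    (hE : ∀ s ∈ Set.Icc 0 R, HasDerivAt E (E' s) s)
    (hle : ∀ s ∈ Set.Ioc 0 R, majorant D s ≤ s * E' s) :
    majorant (logPrimitive D) R ≤ E R - E 0 := by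
  have hQ := differentiableOn_logPrimitive hD hD0
  rw [majorant, (summable_majorant hQ hR0 hR).tsum_eq_zero_add]
  simp only [taylorCoeff_zero, logPrimitive_zero hD0, norm_zero, zero_mul, zero_add,
    taylorCoeff_logPrimitive hD hD0]
  refine Real.tsum_le_of_sum_range_le (fun m => by positivity) fun N => ?_
  have hder : ∀ s ∈ Set.Icc 0 R, HasDerivAt (fun s => E s - ∑ m ∈ Finset.range N,
      ‖taylorCoeff D (m + 1) / ((m : ℂ) + 1)‖ * s ^ (m + 1))
      (E' s - ∑ m ∈ Finset.range N, ‖taylorCoeff D (m + 1)‖ * s ^ m) s := fun s hs => by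
    refine (hE s hs).sub (HasDerivAt.fun_sum fun m _ => ?_)
    refine ((hasDerivAt_pow (m + 1) s).const_mul _).congr_deriv ?_
    have h1 : ‖(m : ℂ) + 1‖ = m + 1 := by exact_mod_cast Complex.norm_natCast (m + 1)
    have h2 : (m : ℝ) + 1 ≠ 0 := by positivity
    rw [norm_div, h1]
    push_cast
    field_simp
  have hmono := monotoneOn_of_deriv_nonneg (convex_Icc 0 R)
    (fun s hs => (hder s hs).continuousAt.continuousWithinAt)
    (fun s hs => (hder s (interior_subset hs)).differentiableAt.differentiableWithinAt)
    fun s hs => by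
      rw [(hder s (interior_subset hs)).deriv]
      rw [interior_Icc] at hs
      have h1 := hle s ⟨hs.1, hs.2.le⟩
      have h2 := (summable_majorant hD hs.1.le (hs.2.trans hR))
      have h3 : s * ∑ m ∈ Finset.range N, ‖taylorCoeff D (m + 1)‖ * s ^ m ≤ majorant D s := by
        refine le_trans ?_ (h2.sum_le_tsum (Finset.range (N + 1)) fun m _ =>
          mul_nonneg (norm_nonneg _) (pow_nonneg hs.1.le m))
        rw [Finset.sum_range_succ', Finset.mul_sum]
        refine (Finset.sum_congr rfl fun m _ => ?_).trans_le
          (le_add_of_nonneg_right (mul_nonneg (norm_nonneg _) (pow_nonneg hs.1.le 0)))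
        ring
      exact sub_nonneg.2 (le_of_mul_le_mul_left (h3.trans h1) hs.1)
  have h := hmono (Set.left_mem_Icc.2 hR0) (Set.right_mem_Icc.2 hR0) hR0
  simp only at h
  have h0 : ∑ m ∈ Finset.range N, ‖taylorCoeff D (m + 1) / ((m : ℂ) + 1)‖ * (0 : ℝ) ^ (m + 1) = 0 :=
    Finset.sum_eq_zero fun m _ => by simp
  rw [h0] at h
  linarith

namespace IsSchwarz

variable {w : ℂ → ℂ}

theorem norm_dslope_mul_mem (hw : IsSchwarz w) {z : ℂ} (hz : z ∈ unitDisk) :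
    dslope w 0 0 * z ∈ unitDisk := by
  rw [mem_unitDisk, norm_mul]
  exact (mul_le_of_le_one_left (norm_nonneg z)
    (hw.norm_dslope_le_one zero_mem_unitDisk)).trans_lt (mem_unitDisk.1 hz)

/-- Factor w(z) - cz = z(φ(z) - φ(0)) with φ(z) = w(z)/z bounded by 1: the coefficients of φ beyond
the constant are at most 2(1 - |c|), so w is nearly linear when |c| is near 1. -/
theorem majorant_sub_linear_le (hw : IsSchwarz w) {s : ℝ} (hs0 : 0 ≤ s) (hs : s < 1) :
    majorant (fun z => w z - dslope w 0 0 * z) s ≤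
      s * (2 * (1 - ‖dslope w 0 0‖) * (s / (1 - s))) := by
  have h : (fun z => w z - dslope w 0 0 * z) =
      fun z => z * (dslope w 0 z - dslope w 0 0) := funext fun z => by
    rw [hw.apply_eq]
    ring
  rw [h, majorant_id_mul (hw.differentiableOn_dslope.sub_const _) hs0 hs]
  gcongr
  exact majorant_sub_apply_zero_le hw.differentiableOn_dslope
    (fun z hz => hw.norm_dslope_le_one hz) hs0 hs

theorem majorant_linear_le (hw : IsSchwarz w) {s : ℝ} (hs0 : 0 ≤ s) (hs : s < 1) :
    majorant (fun z => dslope w 0 0 * z) s ≤ s := by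
  have h1 : majorant (fun z : ℂ => z) s = s := by
    have := majorant_id_mul (differentiableOn_const (1 : ℂ)) hs0 hs
    simpa [majorant_const] using this
  rw [majorant_const_mul (f := fun z => z) differentiableOn_id, h1]
  exact mul_le_of_le_one_left hs0 (hw.norm_dslope_le_one zero_mem_unitDisk)

theorem majorant_pow_sub_pow_le (hw : IsSchwarz w) {s : ℝ} (hs0 : 0 ≤ s) (hs : s ≤ 1 / 3) (n : ℕ) :
    majorant (fun z => w z ^ (n + 1) - (dslope w 0 0 * z) ^ (n + 1)) s ≤
      (n + 1) * s ^ n * (s * (2 * (1 - ‖dslope w 0 0‖) * (s / (1 - s)))) := by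
  have hs1 : s < 1 := by linarith
  have hl : DifferentiableOn ℂ (fun z => dslope w 0 0 * z) unitDisk :=
    differentiableOn_id.const_mul _
  have hδ := hw.majorant_sub_linear_le hs0 hs1
  set δ := s * (2 * (1 - ‖dslope w 0 0‖) * (s / (1 - s)))
  have hδ0 : 0 ≤ δ := (majorant_nonneg _ hs0).trans hδ
  induction n with
  | zero => simpa using hδ
  | succ n ih =>
    have h : (fun z => w z ^ (n + 1 + 1) - (dslope w 0 0 * z) ^ (n + 1 + 1)) =
        fun z => w z * (w z ^ (n + 1) - (dslope w 0 0 * z) ^ (n + 1)) +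
          (w z - dslope w 0 0 * z) * (dslope w 0 0 * z) ^ (n + 1) := funext fun z => by ring
    have hd := (hw.analytic.fun_pow (n + 1)).fun_sub (hl.fun_pow (n + 1))
    rw [h]
    refine (majorant_add_le (hw.analytic.mul hd) ((hw.analytic.sub hl).mul (hl.fun_pow (n + 1)))
      hs0 hs1).trans ?_
    have h1 := (majorant_mul_le hw.analytic hd hs0 hs1).trans
      (mul_le_mul (hw.majorant_le hs0 hs) ih (majorant_nonneg _ hs0) hs0)
    have h2 := (majorant_mul_le (hw.analytic.fun_sub hl) (hl.fun_pow (n + 1)) hs0 hs1).trans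
      (mul_le_mul hδ ((majorant_pow_le hl hs0 hs1 (n + 1)).trans
        (pow_le_pow_left₀ (majorant_nonneg _ hs0) (hw.majorant_linear_le hs0 hs1) _))
        (majorant_nonneg _ hs0) hδ0)
    refine (add_le_add h1 h2).trans_eq ?_
    push_cast
    ring

/-- Deviation of `ψ ∘ w` from `ψ (w'(0) z)`. -/
theorem majorant_comp_sub_comp_le (hw : IsSchwarz w) {ψ : ℂ → ℂ}
    (hψ : DifferentiableOn ℂ ψ unitDisk) {s : ℝ} (hs0 : 0 < s) (hs : s ≤ 1 / 3) :
    majorant (fun z => ψ (w z) - ψ (dslope w 0 0 * z)) s ≤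
      majorant (deriv ψ) s * (s * (2 * (1 - ‖dslope w 0 0‖) * (s / (1 - s)))) := by
  have hs1 : s < 1 := by linarith
  have hl : DifferentiableOn ℂ (fun z => dslope w 0 0 * z) unitDisk :=
    differentiableOn_id.const_mul _
  set δ := s * (2 * (1 - ‖dslope w 0 0‖) * (s / (1 - s))) with hδ
  have hd : ∀ n, DifferentiableOn ℂ
      (fun z => w z ^ (n + 1) - (dslope w 0 0 * z) ^ (n + 1)) unitDisk := fun n =>
    (hw.analytic.fun_pow (n + 1)).fun_sub (hl.fun_pow (n + 1))
  have hle : ∀ n, majorant (fun z => taylorCoeff ψ (n + 1) *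
      (w z ^ (n + 1) - (dslope w 0 0 * z) ^ (n + 1))) s ≤
      ‖taylorCoeff (deriv ψ) n‖ * s ^ n * δ := fun n => by
    have h1 : ‖(n : ℂ) + 1‖ = n + 1 := by exact_mod_cast Complex.norm_natCast (n + 1)
    rw [majorant_const_mul (hd n), taylorCoeff_deriv, norm_mul, h1]
    refine (mul_le_mul_of_nonneg_left (hw.majorant_pow_sub_pow_le hs0.le hs n)
      (norm_nonneg _)).trans_eq ?_
    rw [← hδ]
    ring
  have hsum := (summable_majorant (hψ.deriv isOpen_unitDisk) hs0.le hs1).mul_right δ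
  have hsum' := Summable.of_nonneg_of_le (fun n => majorant_nonneg _ hs0.le) hle hsum
  rw [majorant.eq_def (deriv ψ), ← tsum_mul_right]
  refine (majorant_le_tsum (fun n => (hd n).const_mul _) hs0 hs1 hsum' fun z hz => ?_).trans
    (hsum'.tsum_le_tsum hle hsum)
  have hz := mem_unitDisk.2 (hz.trans hs1)
  have h1 := (hasSum_taylorCoeff hψ (hw.mapsTo hz)).sub
    (hasSum_taylorCoeff hψ (hw.norm_dslope_mul_mem hz))
  rw [← hasSum_nat_add_iff' 1] at h1
  simp only [Finset.range_one, Finset.sum_singleton, pow_zero, sub_self, sub_zero] at h1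
  exact h1.congr_fun' fun n => by ring

end IsSchwarz

theorem hasDerivAt_inv_one_sub {s : ℝ} (hs : s ≠ 1) :
    HasDerivAt (fun s : ℝ => (1 - s)⁻¹) ((1 - s)⁻¹ ^ 2) s := by
  refine (((hasDerivAt_id s).const_sub 1).fun_inv (sub_ne_zero.2 hs.symm)).congr_deriv ?_
  simp

namespace IsMaMinda

variable {ψ : ℂ → ℂ}

theorem norm_deriv_zero (hψ : IsMaMinda ψ) : ‖deriv ψ 0‖ = (deriv ψ 0).re := by
  rw [← Complex.abs_re_eq_norm.2 hψ.deriv_im, abs_of_pos hψ.deriv_re_pos]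

/-- From |bₙ| ≤ nB, the sum is at most B ∑ (n+1)² sⁿ, where (n+1)² = 2·C(n+2, 2) - C(n+1, 1). This
is the better bound for small B. -/
theorem majorant_deriv_le (hψ : IsMaMinda ψ) {s : ℝ} (hs0 : 0 ≤ s) (hs : s < 1) :
    majorant (deriv ψ) s ≤ (deriv ψ 0).re * (2 * (1 - s)⁻¹ ^ 3 - (1 - s)⁻¹ ^ 2) := by
  have hs' : ‖s‖ < 1 := by rwa [Real.norm_of_nonneg hs0]
  have h1 := ((hasSum_choose_mul_geometric_of_norm_lt_one 2 hs').mul_left 2).sub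
    (hasSum_choose_mul_geometric_of_norm_lt_one 1 hs')
  have h2 := h1.mul_left (deriv ψ 0).re
  have h3 : (deriv ψ 0).re * (2 * (1 / (1 - s) ^ (2 + 1)) - 1 / (1 - s) ^ (1 + 1)) =
      (deriv ψ 0).re * (2 * (1 - s)⁻¹ ^ 3 - (1 - s)⁻¹ ^ 2) := by
    simp only [one_div, inv_pow]
  rw [← h3, ← h2.tsum_eq]
  refine (summable_majorant (hψ.analytic.deriv isOpen_unitDisk) hs0 hs).tsum_le_tsum
    (fun n => ?_) h2.summable
  have h1 : ‖(n : ℂ) + 1‖ = n + 1 := by exact_mod_cast Complex.norm_natCast (n + 1)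
  rw [taylorCoeff_deriv, norm_mul, h1, Nat.cast_choose_two, Nat.choose_one_right]
  push_cast
  calc _ ≤ ((n : ℝ) + 1) * ((n + 1) * (deriv ψ 0).re) * s ^ n := by
        gcongr
        exact hψ.norm_taylorCoeff_succ_le n
    _ = _ := by ring

/-- From |bₙ| ≤ 2, keeping the exact first coefficient B: hence the correction B - 2. -/
theorem majorant_deriv_le' (hψ : IsMaMinda ψ) {s : ℝ} (hs0 : 0 ≤ s) (hs : s < 1) :
    majorant (deriv ψ) s ≤ (deriv ψ 0).re - 2 + 2 * (1 - s)⁻¹ ^ 2 := by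
  have hs' : ‖s‖ < 1 := by rwa [Real.norm_of_nonneg hs0]
  have h1 := (hasSum_ite_eq 0 ((deriv ψ 0).re - 2)).add
    ((hasSum_choose_mul_geometric_of_norm_lt_one 1 hs').mul_left 2)
  have h3 : (deriv ψ 0).re - 2 + 2 * (1 / (1 - s) ^ (1 + 1)) =
      (deriv ψ 0).re - 2 + 2 * (1 - s)⁻¹ ^ 2 := by
    simp only [one_div, inv_pow]
  rw [← h3, ← h1.tsum_eq]
  refine (summable_majorant (hψ.analytic.deriv isOpen_unitDisk) hs0 hs).tsum_le_tsum
    (fun n => ?_) h1.summable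
  rcases eq_or_ne n 0 with rfl | hn
  · simp [hψ.norm_deriv_zero]
  have h1 : ‖(n : ℂ) + 1‖ = n + 1 := by exact_mod_cast Complex.norm_natCast (n + 1)
  rw [taylorCoeff_deriv, norm_mul, h1, Nat.choose_one_right, if_neg hn]
  push_cast
  calc _ ≤ ((n : ℝ) + 1) * 2 * s ^ n := by
        gcongr
        exact hψ.norm_taylorCoeff_le_two n.succ_ne_zero
    _ = _ := by ring

variable {w : ℂ → ℂ}

theorem differentiableOn_deviation (hψ : IsMaMinda ψ) (hw : IsSchwarz w) :
    DifferentiableOn ℂ (fun z => ψ (w z) - ψ (dslope w 0 0 * z)) unitDisk :=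
  (hw.differentiableOn_comp hψ.analytic).fun_sub
    (hψ.analytic.comp (differentiableOn_id.const_mul _) fun _ hz => hw.norm_dslope_mul_mem hz)

theorem deviation_zero (hw : IsSchwarz w) :
    (fun z => ψ (w z) - ψ (dslope w 0 0 * z)) 0 = 0 := by
  simp [hw.map_zero]

theorem logPrimitive_comp_eq (hψ : IsMaMinda ψ) (hw : IsSchwarz w) :
    Set.EqOn (logPrimitive fun z => ψ (w z) - 1)
      (fun z => logPrimitive (fun z => ψ z - 1) (dslope w 0 0 * z) +
        logPrimitive (fun z => ψ (w z) - ψ (dslope w 0 0 * z)) z) unitDisk := by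
  have hc := hw.norm_dslope_le_one zero_mem_unitDisk
  have hQ := differentiableOn_logPrimitive hψ.analytic_sub_one hψ.sub_one_zero
  have hQc : DifferentiableOn ℂ
      (fun z => logPrimitive (fun z => ψ z - 1) (dslope w 0 0 * z)) unitDisk :=
    hQ.comp (differentiableOn_id.const_mul _) fun _ hz => hw.norm_dslope_mul_mem hz
  have hD := hψ.differentiableOn_deviation hw
  have hD0 := deviation_zero (ψ := ψ) hw
  have hΔ := differentiableOn_logPrimitive hD hD0
  have hF := hψ.differentiableOn_comp_sub_one hw
  have hF0 := hψ.comp_sub_one_zero hw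
  have hψc : DifferentiableOn ℂ (fun z => ψ (dslope w 0 0 * z)) unitDisk :=
    hψ.analytic.comp (differentiableOn_id.const_mul _) fun _ hz => hw.norm_dslope_mul_mem hz
  refine eqOn_of_taylorCoeff_eq (differentiableOn_logPrimitive hF hF0) (hQc.add hΔ) fun m => ?_
  rw [taylorCoeff_add hQc hΔ, taylorCoeff_comp_const_mul hQ hc]
  rcases m with _ | m
  · simp only [taylorCoeff_zero]
    rw [logPrimitive_zero (F := fun z => ψ (w z) - 1) hF0,
      logPrimitive_zero (F := fun z => ψ (w z) - ψ (dslope w 0 0 * z)) hD0,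
      logPrimitive_zero (F := fun z => ψ z - 1) hψ.sub_one_zero]
    simp
  · rw [taylorCoeff_logPrimitive hF hF0, taylorCoeff_logPrimitive hD hD0,
      taylorCoeff_logPrimitive hψ.analytic_sub_one hψ.sub_one_zero,
      taylorCoeff_sub (hw.differentiableOn_comp hψ.analytic) (differentiableOn_const _),
      taylorCoeff_sub (hw.differentiableOn_comp hψ.analytic) hψc,
      taylorCoeff_comp_const_mul hψ.analytic hc, hψ.taylorCoeff_sub_one_succ, taylorCoeff_const,
      if_neg m.succ_ne_zero]
    ring

/-- The two summands are matched to `majorant_mul_exp_le`: B/6 is the surplus in the distance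
estimate, and B/(3 + B) is the gain from dilating by c at r = 1/3. -/
theorem majorant_logPrimitive_deviation_le (hψ : IsMaMinda ψ) (hw : IsSchwarz w) :
    majorant (logPrimitive fun z => ψ (w z) - ψ (dslope w 0 0 * z)) (1 / 3) ≤
      (1 - ‖dslope w 0 0‖) *
        ((deriv ψ 0).re / 6 + (deriv ψ 0).re / (3 + (deriv ψ 0).re)) := by
  have hD := hψ.differentiableOn_deviation hw
  have hD0 := deviation_zero (ψ := ψ) hw
  have hB := hψ.deriv_re_pos
  have hB2 := hψ.deriv_re_le_two
  set B := (deriv ψ 0).re with hBdef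
  have hε : 0 ≤ 1 - ‖dslope w 0 0‖ := by linarith [hw.norm_dslope_le_one zero_mem_unitDisk]
  set ε := 1 - ‖dslope w 0 0‖ with hεdef
  have hne : ∀ s ∈ Set.Icc (0 : ℝ) (1 / 3), s ≠ 1 := fun s hs => by
    linarith [hs.2] |> fun h : s < 1 => h.ne
  have hdev : ∀ s ∈ Set.Ioc (0 : ℝ) (1 / 3), ∀ N, majorant (deriv ψ) s ≤ N →
      majorant (fun z => ψ (w z) - ψ (dslope w 0 0 * z)) s ≤
        s * (2 * ε * (s * (1 - s)⁻¹ * N)) := fun s hs N hN => by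
    refine (hw.majorant_comp_sub_comp_le hψ.analytic hs.1 hs.2).trans ?_
    have h1 : 0 < 1 - s := by linarith [hs.2]
    have h2 : 0 ≤ s * (2 * ε * (s / (1 - s))) := by
      have := hs.1
      positivity
    refine (mul_le_mul_of_nonneg_right hN h2).trans_eq ?_
    rw [div_eq_mul_inv]
    ring
  have hinv : ∀ s ∈ Set.Ioc (0 : ℝ) (1 / 3), s * (1 - s)⁻¹ = (1 - s)⁻¹ - 1 := fun s hs => by
    have h1 : 1 - s ≠ 0 := by linarith [hs.2] |> fun h : 0 < 1 - s => h.ne'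
    field_simp
    ring
  rcases le_total B 1 with hB1 | hB1
  -- For B ≤ 1 the bound |bₙ| ≤ nB is used. Here E(1/3) - E(0) = 5εB/12 = ε(B/6 + B/4), and 3 + B ≤
  -- 4.
  · have h := majorant_logPrimitive_le (E := fun s => 2 * ε * (B * (2 / 3 * (1 - s)⁻¹ ^ 3 -
        3 / 2 * (1 - s)⁻¹ ^ 2 + (1 - s)⁻¹)))
      (E' := fun s => 2 * ε * (B * (2 * (1 - s)⁻¹ ^ 4 - 3 * (1 - s)⁻¹ ^ 3 + (1 - s)⁻¹ ^ 2)))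
      (R := 1 / 3) hD hD0 (by norm_num) (by norm_num) (fun s hs => ?_) fun s hs => ?_
    · refine h.trans ?_
      have h1 : B / 4 ≤ B / (3 + B) := by gcongr; linarith
      norm_num
      nlinarith
    · have hv := hasDerivAt_inv_one_sub (hne s hs)
      refine (((((hv.fun_pow 3).const_mul (2 / 3)).sub ((hv.fun_pow 2).const_mul (3 / 2))).add
        hv).const_mul B |>.const_mul (2 * ε)).congr_deriv ?_
      push_cast
      ring
    · refine (hdev s hs _ (hψ.majorant_deriv_le hs.1.le (by linarith [hs.2]))).trans_eq ?_
      rw [hinv s hs]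
      ring
  -- For 1 ≤ B ≤ 2 the bound |bₙ| ≤ 2 is used. As B - 2 ≤ 0, s/(1 - s) may be replaced in that term
  -- by the smaller s + s², which keeps logarithms out of E.
  · have h := majorant_logPrimitive_le (E := fun s => 2 * ε * ((B - 2) * (1 / 2 * s ^ 2 +
        1 / 3 * s ^ 3) + ((1 - s)⁻¹ ^ 2 - 2 * (1 - s)⁻¹)))
      (E' := fun s => 2 * ε * ((B - 2) * (s + s ^ 2) + (2 * (1 - s)⁻¹ ^ 3 - 2 * (1 - s)⁻¹ ^ 2)))
      (R := 1 / 3) hD hD0 (by norm_num) (by norm_num) (fun s hs => ?_) fun s hs => ?_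
    · refine h.trans ?_
      have h1 : B / 5 ≤ B / (3 + B) := by gcongr; linarith
      norm_num
      nlinarith
    · have hv := hasDerivAt_inv_one_sub (hne s hs)
      refine ((((((hasDerivAt_pow 2 s).const_mul (1 / 2)).add
        ((hasDerivAt_pow 3 s).const_mul (1 / 3))).const_mul (B - 2)).add
          ((hv.fun_pow 2).sub (hv.const_mul 2))).const_mul (2 * ε)).congr_deriv ?_
      push_cast
      ring
    · refine (hdev s hs _ (hψ.majorant_deriv_le' hs.1.le (by linarith [hs.2]))).trans ?_
      have h0 := hs.1.le
      gcongr
      have h1 : 1 + s ≤ (1 - s)⁻¹ := by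
        rw [le_inv_comm₀ (by positivity) (by linarith [hs.2]), inv_eq_one_div,
          le_div_iff₀ (by positivity)]
        nlinarith
      have h2 := hinv s hs
      rw [← hBdef]
      have h3 : s * (1 - s)⁻¹ * (B - 2 + 2 * (1 - s)⁻¹ ^ 2) = (B - 2) * (s * (1 - s)⁻¹) +
          (2 * (1 - s)⁻¹ ^ 3 - 2 * (1 - s)⁻¹ ^ 2) := by
        linear_combination 2 * (1 - s)⁻¹ ^ 2 * h2
      rw [h3]
      have h4 : s * (1 + s) ≤ s * (1 - s)⁻¹ := by gcongr
      nlinarith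

end IsMaMinda

/-- Dilation estimate for a power series with given first two coefficients. -/
theorem majorant_comp_mul_le {Φ : ℂ → ℂ} (hΦ : DifferentiableOn ℂ Φ unitDisk) (h0 : ‖Φ 0‖ = 1)
    {c : ℂ} (hc : ‖c‖ ≤ 1) {r : ℝ} (hr0 : 0 ≤ r) (hr : r < 1) :
    majorant (fun z => Φ (c * z)) r * (1 + ‖deriv Φ 0‖ * r) ≤
      majorant Φ r * (1 + ‖c‖ * ‖deriv Φ 0‖ * r) := by
  have hs := summable_majorant hΦ hr0 hr
  have hs2 := (summable_nat_add_iff 2).2 hs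
  -- Only the crude contraction |c|^(m+2) ≤ |c| is needed for the tail T. After cross-multiplying,
  -- the claim reduces to T(1 - |c|) ≥ 0.
  have hle : ∀ m, ‖taylorCoeff Φ (m + 2) * c ^ (m + 2)‖ * r ^ (m + 2) ≤
      ‖c‖ * (‖taylorCoeff Φ (m + 2)‖ * r ^ (m + 2)) := fun m => by
    have h1 : ‖c‖ ^ (m + 2) ≤ ‖c‖ := pow_le_of_le_one (norm_nonneg c) hc (by omega)
    rw [norm_mul, norm_pow]
    calc _ ≤ ‖taylorCoeff Φ (m + 2)‖ * ‖c‖ * r ^ (m + 2) := by gcongr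
      _ = _ := by ring
  have hsc : Summable fun m => ‖taylorCoeff Φ m * c ^ m‖ * r ^ m := by
    refine Summable.of_nonneg_of_le (fun m => by positivity) (fun m => ?_) hs
    rw [norm_mul, norm_pow]
    gcongr
    exact mul_le_of_le_one_right (norm_nonneg _) (pow_le_one₀ (norm_nonneg c) hc)
  have hT : (∑' m, ‖taylorCoeff Φ (m + 2) * c ^ (m + 2)‖ * r ^ (m + 2)) ≤
      ‖c‖ * ∑' m, ‖taylorCoeff Φ (m + 2)‖ * r ^ (m + 2) := by
    rw [← tsum_mul_left]
    exact ((summable_nat_add_iff 2).2 hsc).tsum_le_tsum hle (hs2.mul_left _)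
  have hT0 : 0 ≤ ∑' m, ‖taylorCoeff Φ (m + 2)‖ * r ^ (m + 2) :=
    tsum_nonneg fun m => by positivity
  have e1 : majorant (fun z => Φ (c * z)) r = 1 + ‖c‖ * ‖deriv Φ 0‖ * r +
      ∑' m, ‖taylorCoeff Φ (m + 2) * c ^ (m + 2)‖ * r ^ (m + 2) := by
    simp only [majorant, taylorCoeff_comp_const_mul hΦ hc]
    rw [← hsc.sum_add_tsum_nat_add 2]
    simp [Finset.sum_range_succ, h0, mul_comm]
  have e2 : majorant Φ r = 1 + ‖deriv Φ 0‖ * r +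
      ∑' m, ‖taylorCoeff Φ (m + 2)‖ * r ^ (m + 2) := by
    simp only [majorant]
    rw [← hs.sum_add_tsum_nat_add 2]
    simp [Finset.sum_range_succ, h0]
  rw [e1, e2]
  set T := ∑' m, ‖taylorCoeff Φ (m + 2)‖ * r ^ (m + 2)
  have hb : 0 ≤ ‖deriv Φ 0‖ * r := by positivity
  have hTc := mul_le_mul_of_nonneg_right hT (add_nonneg zero_le_one hb)
  have h3 : ‖c‖ * T * (1 + ‖deriv Φ 0‖ * r) ≤ T * (1 + ‖c‖ * ‖deriv Φ 0‖ * r) := by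
    have := mul_nonneg hT0 (sub_nonneg.2 hc)
    nlinarith
  nlinarith

namespace IsMaMinda

variable {ψ w : ℂ → ℂ}

/-- Factor f(z) = z Φ(cz) e^{Δ(z)} with Φ = f₀/z. Dilating by c gains a factor e^{-(1-a)Br/(1+Br)},
which pays for all of Δ̂ except the allowed B(1-a)/6. -/
theorem majorant_mul_exp_le (hψ : IsMaMinda ψ) (hw : IsSchwarz w) {f : ℂ → ℂ}
    (h : ∀ z ∈ unitDisk, f z = z * Complex.exp (logPrimitive (fun z => ψ (w z) - 1) z))
    {r : ℝ} (hr0 : 0 < r) (hr : r ≤ 1 / 3) :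
    majorant f r ≤ majorant (extremal ψ) r *
      Real.exp ((deriv ψ 0).re * (1 - ‖dslope w 0 0‖) / 6) := by
  have hr1 : r < 1 := by linarith
  have hB := hψ.deriv_re_pos
  have hc := hw.norm_dslope_le_one zero_mem_unitDisk
  have hQ := differentiableOn_logPrimitive hψ.analytic_sub_one hψ.sub_one_zero
  have hD := hψ.differentiableOn_deviation hw
  have hD0 := deviation_zero (ψ := ψ) hw
  have hΔ := differentiableOn_logPrimitive hD hD0
  set Δ := logPrimitive fun z => ψ (w z) - ψ (dslope w 0 0 * z) with hΔdef
  set Φ : ℂ → ℂ := fun z => Complex.exp (logPrimitive (fun z => ψ z - 1) z) with hΦdef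
  have hΦ : DifferentiableOn ℂ Φ unitDisk := hQ.cexp
  have hΦ0 : ‖Φ 0‖ = 1 := by
    simp [hΦdef, logPrimitive_zero (F := fun z => ψ z - 1) hψ.sub_one_zero]
  have hΦ1 : ‖deriv Φ 0‖ = (deriv ψ 0).re := by
    have h1 := (hasDerivAt_logPrimitive hψ.analytic_sub_one hψ.sub_one_zero
      zero_mem_unitDisk).cexp.deriv
    rw [hΦdef, h1, logPrimitive_zero (F := fun z => ψ z - 1) hψ.sub_one_zero, dslope_same,
      Complex.exp_zero, one_mul, deriv_sub_const, hψ.norm_deriv_zero]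
  have hΦc : DifferentiableOn ℂ (fun z => Φ (dslope w 0 0 * z)) unitDisk :=
    hΦ.comp (differentiableOn_id.const_mul _) fun _ hz => hw.norm_dslope_mul_mem hz
  have hexp : DifferentiableOn ℂ (fun z => Complex.exp (Δ z)) unitDisk := hΔ.cexp
  have hf : majorant f r ≤ r * (majorant (fun z => Φ (dslope w 0 0 * z)) r *
      Real.exp (majorant Δ r)) := by
    rw [majorant_congr (g := fun z => z * (Φ (dslope w 0 0 * z) * Complex.exp (Δ z)))
      fun z hz => by rw [h z hz, hψ.logPrimitive_comp_eq hw hz, Complex.exp_add],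
      majorant_id_mul (hΦc.fun_mul hexp) hr0.le hr1]
    gcongr
    refine (majorant_mul_le hΦc hexp hr0.le hr1).trans ?_
    gcongr
    · exact majorant_nonneg _ hr0.le
    · exact majorant_exp_le hΔ hr0 hr1
  have hext : majorant (extremal ψ) r = r * majorant Φ r := majorant_id_mul hΦ hr0.le hr1
  have hdil := majorant_comp_mul_le hΦ hΦ0 hc hr0.le hr1
  rw [hΦ1] at hdil
  have hΔr := majorant_le_div_mul hΔ (logPrimitive_zero hD0) hr0.le hr (by norm_num) (by norm_num)
  have hΔ3 := hψ.majorant_logPrimitive_deviation_le hw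
  rw [← hΔdef] at hΔ3
  set B := (deriv ψ 0).re
  set a := ‖dslope w 0 0‖
  have hε : 0 ≤ 1 - a := by linarith
  have h1Br : 0 < 1 + B * r := by positivity
  have hΦpos := majorant_nonneg Φ hr0.le
  have hdil2 : majorant (fun z => Φ (dslope w 0 0 * z)) r ≤
      majorant Φ r * Real.exp (-((1 - a) * (B * r / (1 + B * r)))) := by
    -- The left side equals 1 - (1-a)Br/(1+Br), and 1 + x ≤ e^x.
    have h1 : (1 + a * B * r) / (1 + B * r) ≤ Real.exp (-((1 - a) * (B * r / (1 + B * r)))) := by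
      refine le_trans (le_of_eq ?_) (Real.add_one_le_exp _)
      field_simp
      ring
    calc _ ≤ majorant Φ r * ((1 + a * B * r) / (1 + B * r)) := by
          rw [← mul_div_assoc, le_div_iff₀ h1Br]
          exact hdil
      _ ≤ _ := by gcongr
  have hexpo : -((1 - a) * (B * r / (1 + B * r))) + majorant Δ r ≤ B * (1 - a) / 6 := by
    have h1 : majorant Δ r ≤ 3 * r * ((1 - a) * (B / 6 + B / (3 + B))) := by
      refine hΔr.trans ?_
      have : r / (1 / 3) = 3 * r := by ring
      rw [this]
      gcongr
    -- Equivalent to 3Br ≤ B, so r ≤ 1/3 is exactly what is needed.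
    have h2 : 3 * r * (B / (3 + B)) ≤ B * r / (1 + B * r) := by
      rw [← mul_div_assoc, div_le_div_iff₀ (by positivity) h1Br]
      have : 0 ≤ B * r * (B * (1 - 3 * r)) := by
        have : 0 ≤ 1 - 3 * r := by linarith
        positivity
      nlinarith
    have h3 := mul_le_mul_of_nonneg_left h2 hε
    have h4 : 0 ≤ (1 - 3 * r) * ((1 - a) * B) :=
      mul_nonneg (by linarith) (mul_nonneg hε hB.le)
    nlinarith
  calc majorant f r ≤ r * (majorant (fun z => Φ (dslope w 0 0 * z)) r *
        Real.exp (majorant Δ r)) := hf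
    _ ≤ r * (majorant Φ r * Real.exp (-((1 - a) * (B * r / (1 + B * r)))) *
        Real.exp (majorant Δ r)) := by gcongr
    _ = majorant (extremal ψ) r *
        Real.exp (-((1 - a) * (B * r / (1 + B * r))) + majorant Δ r) := by
        rw [hext, Real.exp_add]
        ring
    _ ≤ _ := by
        gcongr
        exact majorant_nonneg _ hr0.le

end IsMaMinda


/-! ### Harmonic maps -/

/-- The differential is both complex linear and conjugate linear; testing on 1 and i kills it. -/
theorem hasDerivAt_eq_zero_of_eq_conj {A B : ℂ → ℂ} {a b z : ℂ} (hA : HasDerivAt A a z)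
    (hB : HasDerivAt B b z) (h : A =ᶠ[nhds z] fun x => starRingEnd ℂ (B x)) : a = 0 := by
  have key : ∀ v : ℂ, a * v = starRingEnd ℂ (b * v) := fun v => by
    have h1 : HasDerivAt (fun t : ℝ => z + (t : ℂ) * v) (1 * v) 0 :=
      ((Complex.ofRealCLM.hasDerivAt (x := (0 : ℝ))).mul_const v).const_add z
    have h0 : z + ((0 : ℝ) : ℂ) * v = z := by simp
    have hA' : HasDerivAt A a (z + ((0 : ℝ) : ℂ) * v) := by rwa [h0]
    have hB' : HasDerivAt B b (z + ((0 : ℝ) : ℂ) * v) := by rwa [h0]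
    have h2 := HasDerivAt.comp (0 : ℝ) hA' h1
    have h3 := Complex.conjCLE.toContinuousLinearMap.hasFDerivAt.comp_hasDerivAt (0 : ℝ)
      (HasDerivAt.comp (0 : ℝ) hB' h1)
    have hc : Filter.Tendsto (fun t : ℝ => z + (t : ℂ) * v) (nhds 0) (nhds z) := by
      simpa using h1.continuousAt.tendsto
    have h4 := h2.unique (h3.congr_of_eventuallyEq (hc.eventually h))
    simpa using h4
  have e1 := key 1
  have e2 := key Complex.I
  rw [mul_one, mul_one] at e1
  rw [map_mul, Complex.conj_I, ← e1, mul_neg, self_eq_neg] at e2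
  exact (mul_eq_zero.1 e2).resolve_right Complex.I_ne_zero

theorem eqOn_zero_of_eq_conj {A B : ℂ → ℂ} (hA : DifferentiableOn ℂ A unitDisk)
    (hB : DifferentiableOn ℂ B unitDisk) (h : ∀ z ∈ unitDisk, A z = starRingEnd ℂ (B z))
    (h0 : A 0 = 0) : ∀ z ∈ unitDisk, A z = 0 := fun z hz => by
  rw [← h0]
  refine isOpen_unitDisk.is_const_of_deriv_eq_zero isPreconnected_unitDisk hA (fun x hx => ?_) hz
    zero_mem_unitDisk
  exact hasDerivAt_eq_zero_of_eq_conj (hA.differentiableAt (unitDisk_mem_nhds hx)).hasDerivAt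
    (hB.differentiableAt (unitDisk_mem_nhds hx)).hasDerivAt
    (Filter.eventuallyEq_of_mem (unitDisk_mem_nhds hx) h)

/-- Uniqueness of the decomposition `f + \bar g` of a harmonic map. -/
theorem harmonicMap_unique {f g F G : ℂ → ℂ} (hf : DifferentiableOn ℂ f unitDisk)
    (hg : DifferentiableOn ℂ g unitDisk) (hF : DifferentiableOn ℂ F unitDisk)
    (hG : DifferentiableOn ℂ G unitDisk) (h0 : g 0 = G 0)
    (h : ∀ z ∈ unitDisk, harmonicMap f g z = harmonicMap F G z) :
    Set.EqOn f F unitDisk ∧ Set.EqOn g G unitDisk := by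
  have h1 : ∀ z ∈ unitDisk, f z - F z = starRingEnd ℂ (G z - g z) := fun z hz => by
    have := h z hz
    simp only [harmonicMap] at this
    rw [map_sub]
    linear_combination this
  have h2 : ∀ z ∈ unitDisk, f z - F z = 0 := eqOn_zero_of_eq_conj (hf.fun_sub hF) (hG.fun_sub hg)
    h1 (by rw [h1 0 zero_mem_unitDisk, h0, sub_self, map_zero])
  refine ⟨fun z hz => sub_eq_zero.1 (h2 z hz), fun z hz => ?_⟩
  have h3 := (h1 z hz).symm.trans (h2 z hz)
  rw [map_eq_zero, sub_eq_zero] at h3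
  exact h3.symm

theorem hasSum_bohrTerm {f g : ℂ → ℂ} (hf : DifferentiableOn ℂ f unitDisk)
    (hg : DifferentiableOn ℂ g unitDisk) (hf0 : f 0 = 0) (hg0 : g 0 = 0) {r : ℝ} (hr0 : 0 ≤ r)
    (hr : r < 1) :
    HasSum (fun m => bohrTerm f g r (m + 1)) (majorant f r + majorant g r) := by
  have h : ∀ {F : ℂ → ℂ}, DifferentiableOn ℂ F unitDisk → F 0 = 0 →
      HasSum (fun m => ‖taylorCoeff F (m + 1)‖ * r ^ (m + 1)) (majorant F r) := fun hF h0 => by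
    have := (hasSum_nat_add_iff' 1).2 (summable_majorant hF hr0 hr).hasSum
    simpa [h0, majorant] using this
  exact ((h hf hf0).add (h hg hg0)).congr_fun' fun m => add_mul _ _ _

/-- If `g' = κ f'`, the majorant of `g` is controlled by that of `κ`. -/
theorem majorant_le_of_deriv_eq_mul {f g κ : ℂ → ℂ} (hf : DifferentiableOn ℂ f unitDisk)
    (hg : DifferentiableOn ℂ g unitDisk) (hκ : DifferentiableOn ℂ κ unitDisk) (hf0 : f 0 = 0)
    (hg0 : g 0 = 0) (h : ∀ z ∈ unitDisk, deriv g z = κ z * deriv f z) {r : ℝ} (hr0 : 0 ≤ r)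
    (hr : r < 1) : majorant g r ≤ majorant κ r * majorant f r := by
  have hshift : ∀ {F : ℂ → ℂ}, DifferentiableOn ℂ F unitDisk → F 0 = 0 →
      HasSum (fun m => ‖taylorCoeff F (m + 1)‖ * r ^ (m + 1)) (majorant F r) := fun hF h0 => by
    have := (hasSum_nat_add_iff' 1).2 (summable_majorant hF hr0 hr).hasSum
    simpa [h0, majorant] using this
  have hnorm : ∀ m : ℕ, ‖(m : ℂ) + 1‖ = m + 1 := fun m => by
    exact_mod_cast Complex.norm_natCast (m + 1)
  have hcoef : ∀ m, ‖taylorCoeff g (m + 1)‖ ≤ ∑ p ∈ Finset.HasAntidiagonal.antidiagonal m,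
      ‖taylorCoeff κ p.1‖ * ‖taylorCoeff f (p.2 + 1)‖ := fun m => by
    have h1 := taylorCoeff_mul hκ (hf.deriv isOpen_unitDisk) m
    rw [← taylorCoeff_congr h, taylorCoeff_deriv] at h1
    have h2 := congrArg norm h1
    rw [norm_mul, hnorm] at h2
    have h3 : (0 : ℝ) < m + 1 := by positivity
    refine le_of_mul_le_mul_left (h2.le.trans ((norm_sum_le _ _).trans ?_)) h3
    rw [Finset.mul_sum]
    refine Finset.sum_le_sum fun p hp => ?_
    -- The factors from differentiating f never exceed the factor m + 1 from differentiating g, so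
    -- they can be dropped.
    have h4 : (p.2 : ℝ) + 1 ≤ m + 1 := by
      have := Finset.HasAntidiagonal.mem_antidiagonal.1 hp
      have : p.2 ≤ m := by omega
      exact_mod_cast Nat.succ_le_succ this
    rw [taylorCoeff_deriv, norm_mul, norm_mul, hnorm]
    calc ‖taylorCoeff κ p.1‖ * ((p.2 + 1) * ‖taylorCoeff f (p.2 + 1)‖)
        = (p.2 + 1) * (‖taylorCoeff κ p.1‖ * ‖taylorCoeff f (p.2 + 1)‖) := by ring
      _ ≤ _ := by gcongr
  have hsκ := (summable_majorant hκ hr0 hr).norm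
  have hsf := (hshift hf hf0).summable.norm
  have hprod := tsum_mul_tsum_eq_tsum_sum_antidiagonal_of_summable_norm hsκ hsf
  rw [(hshift hf hf0).tsum_eq] at hprod
  rw [← (hshift hg hg0).tsum_eq, majorant.eq_def κ, hprod]
  refine (hshift hg hg0).summable.tsum_le_tsum (fun m => ?_)
    (summable_norm_sum_mul_antidiagonal_of_summable_norm hsκ hsf).of_norm
  calc _ ≤ (∑ p ∈ Finset.HasAntidiagonal.antidiagonal m,
      ‖taylorCoeff κ p.1‖ * ‖taylorCoeff f (p.2 + 1)‖) * r ^ (m + 1) := by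
        gcongr
        exact hcoef m
    _ = _ := by
        rw [Finset.sum_mul]
        refine Finset.sum_congr rfl fun p hp => ?_
        rw [← Finset.HasAntidiagonal.mem_antidiagonal.1 hp]
        ring

/-- The positive Jacobian forces f' ≠ 0, so κ = g'/f' is analytic and Bohr's inequality bounds its
majorant by k. -/
theorem IsQuasiconformalHarmonic.majorant_right_le {K : ℝ} {f g : ℂ → ℂ}
    (h : IsQuasiconformalHarmonic K f g) (hf0 : f 0 = 0) {r : ℝ} (hr0 : 0 ≤ r) (hr : r ≤ 1 / 3) :
    majorant g r ≤ (K - 1) / (K + 1) * majorant f r := by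
  have hne : ∀ z ∈ unitDisk, deriv f z ≠ 0 := fun z hz h0 => by
    have := h.sense_preserving z hz
    rw [h0, norm_zero] at this
    nlinarith [sq_nonneg ‖deriv g z‖]
  have hκ : DifferentiableOn ℂ (fun z => deriv g z / deriv f z) unitDisk :=
    (h.analytic_right.deriv isOpen_unitDisk).div (h.analytic_left.deriv isOpen_unitDisk) hne
  refine (majorant_le_of_deriv_eq_mul h.analytic_left h.analytic_right hκ hf0 h.right_zero
    (fun z hz => (div_mul_cancel₀ _ (hne z hz)).symm) hr0 (by linarith)).trans ?_
  exact mul_le_mul_of_nonneg_right (majorant_le_of_bounded hκ h.dilatation hr0 hr)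
    (majorant_nonneg f hr0)

theorem one_add_dilatation {K : ℝ} (hK : 1 ≤ K) : 1 + (K - 1) / (K + 1) = 2 * K / (K + 1) := by
  have : K + 1 ≠ 0 := by positivity
  field_simp
  ring

/-- A function subordinate to `f + \bar g` has its Bohr sum bounded in terms of that of `f`. -/
theorem bohrSum_le_of_subordinate {K : ℝ} (hK : 1 ≤ K) {f g f₁ g₁ : ℂ → ℂ}
    (h : IsQuasiconformalHarmonic K f g) (hf0 : f 0 = 0) (hf₁ : DifferentiableOn ℂ f₁ unitDisk)
    (hg₁ : DifferentiableOn ℂ g₁ unitDisk) (hg₁0 : g₁ 0 = 0)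
    (hsub : Subordinate (harmonicMap f₁ g₁) (harmonicMap f g)) {r : ℝ} (hr0 : 0 < r)
    (hr : r ≤ 1 / 3) : bohrSum f₁ g₁ r ≤ 2 * K / (K + 1) * majorant f r := by
  obtain ⟨ω, hω, hωh⟩ := hsub
  obtain ⟨h1, h2⟩ := harmonicMap_unique hf₁ hg₁ (hω.differentiableOn_comp h.analytic_left)
    (hω.differentiableOn_comp h.analytic_right) (by rw [hg₁0, hω.map_zero, h.right_zero]) hωh
  have hf₁0 : f₁ 0 = 0 := by
    rw [h1 zero_mem_unitDisk]
    simp only [hω.map_zero, hf0]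
  rw [bohrSum, (hasSum_bohrTerm hf₁ hg₁ hf₁0 hg₁0 hr0.le (by linarith)).tsum_eq,
    majorant_congr h1, majorant_congr h2, ← one_add_dilatation hK, one_add_mul]
  exact add_le_add (hω.majorant_comp_le h.analytic_left hr0 hr)
    ((hω.majorant_comp_le h.analytic_right hr0 hr).trans (h.majorant_right_le hf0 hr0.le hr))

theorem isEmbedding_add_mul_conj {k : ℝ} (hk0 : 0 ≤ k) (hk : k < 1) :
    Topology.IsEmbedding fun x : ℂ => x + (k : ℂ) * starRingEnd ℂ x := by
  have hker : LinearMap.ker (LinearMap.id + k • Complex.conjAe.toLinearMap : ℂ →ₗ[ℝ] ℂ) = ⊥ := by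
    refine (LinearMap.ker_eq_bot').2 fun x hx => ?_
    have h1 : x = -((k : ℂ) * starRingEnd ℂ x) := by
      rw [← add_eq_zero_iff_eq_neg]
      simpa using hx
    have h2 := congrArg norm h1
    rw [norm_neg, norm_mul, RCLike.norm_conj, Complex.norm_real, Real.norm_of_nonneg hk0] at h2
    have h3 : (1 - k) * ‖x‖ = 0 := by linear_combination h2
    exact norm_eq_zero.1 ((mul_eq_zero.1 h3).resolve_left (sub_pos.2 hk).ne')
  convert (LinearMap.isClosedEmbedding_of_injective hker).isEmbedding using 1
  funext x
  simp

theorem isEmbedding_domRestrict {f : ℂ → ℂ} (hf : DifferentiableOn ℂ f unitDisk)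
    (hinj : Set.InjOn f unitDisk) : Topology.IsEmbedding (unitDisk.domRestrict f) := by
  refine (Topology.IsOpenEmbedding.of_continuous_injective_isOpenMap
    hf.continuousOn.domRestrict (Set.injOn_iff_injective.1 hinj) fun U hU => ?_).isEmbedding
  rw [Set.domRestrict_eq, Set.image_comp]
  exact isOpen_image_of_injOn hf hinj (Subtype.coe_image_subset _ _)
    (isOpen_unitDisk.isOpenMap_subtype_val U hU)

/-! ### The extremal harmonic map and the radius equation -/

namespace IsMaMinda

variable {ψ : ℂ → ℂ}

/-- The map is L ∘ f₀ with L(x) = x + k x̄, an injective real-linear map because k < 1; so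
univalence of f₀ gives the embedding. -/
theorem isQuasiconformalHarmonic_extremal (hψ : IsMaMinda ψ) {K : ℝ} (hK : 1 ≤ K) :
    IsQuasiconformalHarmonic K (extremal ψ) (extremalCo K ψ) := by
  have hk0 : 0 ≤ (K - 1) / (K + 1) := div_nonneg (by linarith) (by linarith)
  have hk1 : (K - 1) / (K + 1) < 1 := by
    rw [div_lt_one (by linarith)]
    linarith
  have hd := hψ.differentiableOn_extremal
  have hne : ∀ z ∈ unitDisk, deriv (extremal ψ) z ≠ 0 := fun z hz => by
    rw [(hψ.hasDerivAt_extremal hz).deriv]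
    refine mul_ne_zero (Complex.exp_ne_zero _) fun h => ?_
    have := hψ.re_pos z hz
    rw [h, Complex.zero_re] at this
    exact lt_irrefl _ this
  have hco : ∀ z, deriv (extremalCo K ψ) z =
      (((K - 1) / (K + 1) : ℝ) : ℂ) * deriv (extremal ψ) z := fun z =>
    deriv_const_mul_field _
  refine ⟨hd, hd.const_mul _, by simp [extremalCo, extremal_zero], ?_, fun z hz => ?_,
    fun z hz => ?_⟩
  · convert (isEmbedding_add_mul_conj hk0 hk1).comp
      (isEmbedding_domRestrict hd hψ.injOn_extremal) using 1
    funext z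
    simp [harmonicMap, extremalCo]
  · rw [hco, norm_mul, Complex.norm_real, Real.norm_of_nonneg hk0]
    have h1 := norm_pos_iff.2 (hne z hz)
    have h2 : ((K - 1) / (K + 1) * ‖deriv (extremal ψ) z‖) ^ 2 < ‖deriv (extremal ψ) z‖ ^ 2 :=
      pow_lt_pow_left₀ (mul_lt_of_lt_one_left h1 hk1) (by positivity) two_ne_zero
    linarith
  · rw [hco, mul_div_cancel_right₀ _ (hne z hz), Complex.norm_real, Real.norm_of_nonneg hk0]

theorem hasSum_bohrTerm_extremal (hψ : IsMaMinda ψ) {K : ℝ} (hK : 1 ≤ K) {r : ℝ} (hr0 : 0 ≤ r)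
    (hr : r < 1) : HasSum (fun m => bohrTerm (extremal ψ) (extremalCo K ψ) r (m + 1))
      (2 * K / (K + 1) * majorant (extremal ψ) r) := by
  have hd := hψ.differentiableOn_extremal
  have hk0 : 0 ≤ (K - 1) / (K + 1) := div_nonneg (by linarith) (by linarith)
  have hq := hψ.isQuasiconformalHarmonic_extremal hK
  have h := hasSum_bohrTerm hd hq.analytic_right (extremal_zero ψ) hq.right_zero hr0 hr
  have h1 : majorant (extremalCo K ψ) r = (K - 1) / (K + 1) * majorant (extremal ψ) r := by
    have := majorant_const_mul hd (((K - 1) / (K + 1) : ℝ) : ℂ) r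
    rwa [Complex.norm_real, Real.norm_of_nonneg hk0] at this
  rwa [h1, ← one_add_mul, one_add_dilatation hK] at h

theorem strictMonoOn_majorant_extremal (hψ : IsMaMinda ψ) :
    StrictMonoOn (majorant (extremal ψ)) (Set.Ico 0 1) :=
  majorant_strictMonoOn hψ.differentiableOn_extremal (by simp [hψ.deriv_extremal_zero])

/-- For R ≥ 1/2, f₀(R) ≥ R e^{Q(1/2)} with Q(1/2) > 0, which exceeds 1 for R near 1. As ℓ ≤ 1 ≤
2K/(K+1), this supplies the upper end for the intermediate value theorem. -/
theorem exists_one_lt_majorant_extremal (hψ : IsMaMinda ψ) :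
    ∃ R : ℝ, 0 < R ∧ R < 1 ∧ 1 < majorant (extremal ψ) R := by
  set q := Real.exp (logPrimitive (fun z => ψ z - 1) ((1 / 2 : ℝ) : ℂ)).re with hq
  have hQ := hψ.strictMonoOn_re_logPrimitive
  have hq1 : 1 < q := by
    have h1 := hQ (a := 0) (b := 1 / 2) (by norm_num) (by norm_num) (by norm_num)
    simp only [Complex.ofReal_zero, logPrimitive_zero (F := fun z => ψ z - 1) hψ.sub_one_zero,
      Complex.zero_re] at h1
    exact Real.one_lt_exp_iff.2 h1
  obtain ⟨R, hR1, hR2⟩ := exists_between (max_lt (inv_lt_one_of_one_lt₀ hq1)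
    (by norm_num : (1 / 2 : ℝ) < 1))
  obtain ⟨hRq, hRh⟩ := max_lt_iff.1 hR1
  have hR0 : 0 < R := by linarith
  refine ⟨R, hR0, hR2, ?_⟩
  have h2 := hQ.monotoneOn (a := 1 / 2) (b := R) (by norm_num)
    ⟨by linarith, hR2⟩ hRh.le
  have h3 := norm_le_majorant hψ.differentiableOn_extremal hR2 (z := (R : ℂ))
    (by rw [Complex.norm_real, Real.norm_of_nonneg hR0.le])
  rw [extremal_eq, norm_mul, Complex.norm_real, Real.norm_of_nonneg hR0.le,
    Complex.norm_exp] at h3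
  refine lt_of_lt_of_le ?_ h3
  calc 1 < R * q := by rwa [← inv_lt_iff_one_lt_mul₀ (by linarith)]
    _ ≤ _ := by
      rw [hq]
      gcongr

/-- The Bohr radius equation has a root. -/
theorem exists_root (hψ : IsMaMinda ψ) {K ℓ : ℝ} (hK : 1 ≤ K) (hℓ0 : 0 < ℓ) (hℓ1 : ℓ ≤ 1) :
    ∃ r : ℝ, 0 < r ∧ r < 1 ∧ 2 * K / (K + 1) * majorant (extremal ψ) r = ℓ := by
  obtain ⟨R, hR0, hR1, hR⟩ := hψ.exists_one_lt_majorant_extremal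
  have hK1 : 1 ≤ 2 * K / (K + 1) := by
    rw [le_div_iff₀ (by linarith)]
    linarith
  have hcont : ContinuousOn (fun r => 2 * K / (K + 1) * majorant (extremal ψ) r) (Set.Icc 0 R) :=
    continuousOn_const.mul (continuousOn_majorant hψ.differentiableOn_extremal hR1)
  have hzero : majorant (extremal ψ) 0 = 0 := by
    rw [majorant, tsum_eq_single 0 fun m hm => by simp [hm]]
    simp [extremal_zero]
  obtain ⟨r, hr, hrℓ⟩ := intermediate_value_Icc hR0.le hcont
    (show ℓ ∈ Set.Icc _ _ from ⟨by simpa [hzero] using hℓ0.le, by nlinarith⟩)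
  refine ⟨r, lt_of_le_of_ne hr.1 ?_, hr.2.trans_lt hR1, hrℓ⟩
  rintro rfl
  simp only [hzero, mul_zero] at hrℓ
  exact hℓ0.ne hrℓ

end IsMaMinda

end HarmonicBohr

/-! ### The main theorem -/

theorem mainTheorem1 (ψ : ℂ → ℂ) (hψ : IsMaMinda ψ) (K : ℝ) (hK : 1 ≤ K) :
    -- `f₀ = extremal ψ` is the function of class `𝒜` with `z f₀' / f₀ = ψ`
    (IsNormalized (extremal ψ) ∧ (∀ z ∈ unitDisk, z ≠ 0 → extremal ψ z ≠ 0) ∧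
      ∀ z ∈ unitDisk, starlikeQuotient (extremal ψ) z = ψ z) ∧
    (∀ r : ℝ, 0 ≤ r → r < 1 → Summable fun m : ℕ => ‖taylorCoeff (extremal ψ) m‖ * r ^ m) ∧
    -- `ℓ = -f₀(-1)`, a radial limit
    ∃ ℓ : ℝ, Filter.Tendsto (fun t : ℝ => extremal ψ (-(t : ℂ))) (nhdsWithin 1 (Set.Iio 1))
        (nhds (-(ℓ : ℂ))) ∧
      ∃ r₀ : ℝ,
        -- `r₀` is the unique root in `(0, 1)`
        (0 < r₀ ∧ r₀ < 1 ∧ 2 * K / (K + 1) * majorant (extremal ψ) r₀ = ℓ) ∧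
        (∀ r : ℝ, 0 < r → r < 1 → 2 * K / (K + 1) * majorant (extremal ψ) r = ℓ → r = r₀) ∧
        -- the Bohr inequality
        (∀ f g f₁ g₁ : ℂ → ℂ, IsQuasiconformalHarmonic K f g → IsMaMindaStarlike ψ f →
          DifferentiableOn ℂ f₁ unitDisk → DifferentiableOn ℂ g₁ unitDisk → g₁ 0 = 0 →
          Subordinate (harmonicMap f₁ g₁) (harmonicMap f g) →
          ∀ r : ℝ, 0 ≤ r → r ≤ min r₀ (1 / 3) →
            (Summable fun m : ℕ => bohrTerm f₁ g₁ r (m + 1)) ∧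
              bohrSum f₁ g₁ r ≤ boundaryDist f) ∧
        -- sharpness for `p = f₀ + k \bar f₀`, `k = (K - 1) / (K + 1)`
        ((∀ m : ℕ, taylorCoeff (extremal ψ) m = (‖taylorCoeff (extremal ψ) m‖ : ℂ)) →
          min r₀ (1 / 3) = r₀ →
            IsMaMindaStarlike ψ (extremal ψ) ∧ IsQuasiconformalHarmonic K (extremal ψ) (extremalCo K ψ) ∧
            Subordinate (harmonicMap (extremal ψ) (extremalCo K ψ))
              (harmonicMap (extremal ψ) (extremalCo K ψ)) ∧
            bohrSum (extremal ψ) (extremalCo K ψ) r₀ = boundaryDist (extremal ψ) ∧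
            ∀ r : ℝ, r₀ < r → r < 1 →
              (Summable fun m : ℕ => bohrTerm (extremal ψ) (extremalCo K ψ) r (m + 1)) ∧
                boundaryDist (extremal ψ) < bohrSum (extremal ψ) (extremalCo K ψ) r) := by
  obtain ⟨ℓ, hℓ0, hℓ1, hℓ⟩ := hψ.exists_radial_limit
  obtain ⟨r₀, hr₀0, hr₀1, hr₀⟩ := hψ.exists_root hK hℓ0 hℓ1
  have hext := hψ.differentiableOn_extremal
  have hmono := hψ.strictMonoOn_majorant_extremal
  have hK0 : 0 < 2 * K / (K + 1) := by positivity
  refine ⟨⟨hψ.isNormalized_extremal, fun z _ h => IsMaMinda.extremal_ne_zero ψ h,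
    fun z hz => hψ.starlikeQuotient_extremal hz⟩, fun r hr0 hr => summable_majorant hext hr0 hr,
    ℓ, hψ.tendsto_extremal_neg hℓ, r₀, ⟨hr₀0, hr₀1, hr₀⟩, fun r h0 h1 hr => ?_, ?_, ?_⟩
  · exact hmono.injOn ⟨h0.le, h1⟩ ⟨hr₀0.le, hr₀1⟩ (mul_left_cancel₀ hK0.ne' (hr.trans hr₀.symm))
  · intro f g f₁ g₁ hq hf hf₁ hg₁ hg₁0 hsub r hr0 hr
    have hr1 : r < 1 := (hr.trans (min_le_left _ _)).trans_lt hr₀1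
    have hr3 := hr.trans (min_le_right _ _)
    have hf0 := hf.normalized.map_zero
    have hs : Summable fun m : ℕ => bohrTerm f₁ g₁ r (m + 1) :=
      (((summable_nat_add_iff 1).2 (summable_majorant hf₁ hr0 hr1)).add
        ((summable_nat_add_iff 1).2 (summable_majorant hg₁ hr0 hr1))).congr fun m =>
          (add_mul _ _ _).symm
    refine ⟨hs, ?_⟩
    -- The majorant estimates require r > 0; at r = 0 the sum is zero.
    rcases hr0.eq_or_lt with rfl | hrpos
    · have : bohrSum f₁ g₁ 0 = 0 := by simp [bohrSum, bohrTerm]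
      rw [this]
      exact Metric.infDist_nonneg
    obtain ⟨w, hw, hfw⟩ := hf.exists_eq_mul_exp hψ
    have hle : 2 * K / (K + 1) * majorant (extremal ψ) r ≤ ℓ := by
      rw [← hr₀]
      gcongr
      exact majorant_mono _ hext hr0 (hr.trans (min_le_left _ _)) hr₀1
    -- The factor e^{B(1-a)/6} lost in the majorant is the one gained in the distance.
    calc bohrSum f₁ g₁ r ≤ 2 * K / (K + 1) * majorant f r :=
          bohrSum_le_of_subordinate hK hq hf0 hf₁ hg₁ hg₁0 hsub hrpos hr3
      _ ≤ 2 * K / (K + 1) * (majorant (extremal ψ) r *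
          Real.exp ((deriv ψ 0).re * (1 - ‖dslope w 0 0‖) / 6)) := by
          gcongr
          exact hψ.majorant_mul_exp_le hw hfw hrpos hr3
      _ = 2 * K / (K + 1) * majorant (extremal ψ) r *
          Real.exp ((deriv ψ 0).re * (1 - ‖dslope w 0 0‖) / 6) := by ring
      _ ≤ ℓ * Real.exp ((deriv ψ 0).re * (1 - ‖dslope w 0 0‖) / 6) := by gcongr
      _ ≤ boundaryDist f := hψ.mul_exp_le_boundaryDist hℓ hf.normalized hw hfw
  · intro _ _
    rw [hψ.boundaryDist_extremal hℓ0 hℓ]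
    refine ⟨hψ.isMaMindaStarlike_extremal, hψ.isQuasiconformalHarmonic_extremal hK,
      ⟨fun z => z, IsMaMinda.isSchwarz_id, fun _ _ => rfl⟩,
      (hψ.hasSum_bohrTerm_extremal hK hr₀0.le hr₀1).tsum_eq.trans hr₀, fun r h0 h1 => ?_⟩
    have h := hψ.hasSum_bohrTerm_extremal hK (hr₀0.trans h0).le h1
    refine ⟨h.summable, ?_⟩
    rw [bohrSum, h.tsum_eq, ← hr₀]
    exact mul_lt_mul_of_pos_left (hmono ⟨hr₀0.le, hr₀1⟩ ⟨(hr₀0.trans h0).le, h1⟩ h0) hK0
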